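/- **Conventions.** Everything is over $\mathbb{C}$ and $\mathbb{Z}_2$-graded; $|x|$ is the parity of a homogeneous $x$. Homomorphisms of supermodules over a Lie superalgebra are sums of even and odd linear maps $f$ with $f(xm)=(-1)^{|f||x|}xf(m)$; a Lie superalgebra acts on a tensor product by $x(m\otimes m')=xm\otimes m'+(-1)^{|x||m|}m\otimes xm'$; and $(f\otimes g)(m\otimes m')=(-1)^{|g||m|}f(m)\otimes g(m')$. In a monoidal supercategory, accordingly, $(f\otimes g)\circ(h\otimes k)=(-1)^{|g||h|}(f\circ h)\otimes(g\circ k)$. A functor of monoidal supercategories is a parity preserving $\mathbb{C}$-linear functor $F$ with even natural isomorphisms $F(X)\otimes F(Y)\cong F(X\otimes Y)$ and an even isomorphism $\mathbb{1}\cong F(\mathbb{1})$ satisfying the usual coherence conditions. It is essentially surjective if every object of the target is isomorphic, by an even isomorphism, to some $F(X)$. **The target.** $\mathfrak{q}(n)$ is the Lie superalgebra of the matrices $\begin{pmatrix}A&B\\B&A\end{pmatrix}$ with $A,B\in M_n(\mathbb{C})$ ($B=0$: even; $A=0$: odd) under the graded commutator. $V_n=\mathbb{C}^{n|n}$ is its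 natural supermodule, with even basis vectors $v_1,\dots,v_n$ and odd basis vectors $v_{\bar1},\dots,v_{\bar n}$. Let $c\colon V_n\to V_n$ be the odd map $c(v_i)=\sqrt{-1}\,v_{\bar i}$, $c(v_{\bar i})=-\sqrt{-1}\,v_i$. $S^k(V_n)$ is the $k$-th supersymmetric power (the quotient of $V_n^{\otimes k}$ by the degree $k$ part of the ideal generated by all $v\otimes w-(-1)^{|v||w|}w\otimes v$), and $S^0(V_n)=\mathbb{C}$ is trivial. $\mathfrak{q}(n)\text{-}\mathbf{Mod}_{\mathcal S}$ is the full monoidal subsupercategory of $\mathfrak{q}(n)$-supermodules tensor generated by the $S^p(V_n)$, $p\ge0$. **The source.** $\mathfrak{q}\text{-}\mathbf{Web}_\uparrow$ is the strict monoidal supercategory whose objects are the words $\uparrow_\lambda=\uparrow_{\lambda_1}\cdots\uparrow_{\lambda_t}$, $\lambda_i\in\mathbb{Z}_{\ge0}$, and whose morphisms are generated by odd dots $d_k\colon\uparrow_k\to\uparrow_k$, even merges $m_{k,l}\colon\uparrow_k\uparrow_l\to\uparrow_{k+l}$ and even splits $s_{k,l}\colon\uparrow_{k+l}\to\uparrow_k\uparrow_l$.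 Edges labelled $0$ may be inserted and erased: there are mutually inverse even isomorphisms $\mathbb{1}\cong\uparrow_0$ under which $m_{0,k},m_{k,0},s_{0,k},s_{k,0}$ become identities, and $d_0=0$. The defining relations are as follows, for all nonnegative labels, where a web with a negatively labelled edge is $0$. 1. Associativity: $m_{h+k,l}(m_{h,k}\otimes1)=m_{h,k+l}(1\otimes m_{k,l})$ and $(s_{h,k}\otimes1)s_{h+k,l}=(1\otimes s_{k,l})s_{h,k+l}$. 2. Digon removal: $m_{k,l}s_{k,l}=\binom{k+l}{l}$. 3. Dot collision: $d_kd_k=k$. 4. Dots past merges and splits: $d_{k+l}m_{k,l}=m_{k,l}(d_k\otimes1+1\otimes d_l)$ and $s_{k,l}d_{k+l}=(d_k\otimes1+1\otimes d_l)s_{k,l}$. 5. Dumbbell: with $D=s_{1,1}m_{1,1}$, $D-(d_1\otimes d_1)D(d_1\otimes d_1)=2$. 6. For two neighbouring strands with labels $(k,l)$ and $x\in\{1,d_1\}$, let $E^x=(m_{k,1}\otimes1)(1\otimes x\otimes1)(1\otimes s_{1,l-1})\colon(k,l)\to(k+1,l-1)$ and $F^x=(1\otimes m_{1,l})(1\otimes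 x\otimes1)(s_{k-1,1}\otimes1)\colon(k,l)\to(k-1,l+1)$; write $E=E^1$, $\bar E=E^{d_1}$, $F=F^1$, $\bar F=F^{d_1}$. Then on $(k,l)$: $EF-FE=k-l$ (square switch), and $\bar EF-F\bar E=d_k\otimes1-1\otimes d_l=E\bar F-\bar FE$ (square switch with dots). 7. For three neighbouring strands, let $E_1,F_1$ act on strands 1, 2 and $E_2,F_2$ on strands 2, 3 (and likewise with bars). Then (double rungs) $E_1E_2-E_2E_1=\bar E_1\bar E_2+\bar E_2\bar E_1$, $\;E_1\bar E_2-\bar E_2E_1=\bar E_1E_2-E_2\bar E_1$, and the mirror images $F_2F_1-F_1F_2=\bar F_2\bar F_1+\bar F_1\bar F_2$, $\;F_2\bar F_1-\bar F_1F_2=\bar F_2F_1-F_1\bar F_2$. **Proposition.** For every $n\ge1$ there is an essentially surjective functor of monoidal supercategories $$\Psi_n\colon\mathfrak{q}\text{-}\mathbf{Web}_\uparrow\to\mathfrak{q}(n)\text{-}\mathbf{Mod}_{\mathcal S}$$ given on objects by $\Psi_n(\uparrow_\lambda)=S^{\lambda_1}(V_n)\otimes\cdots\otimes S^{\lambda_t}(V_n)$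 (the empty word goes to $\mathbb{C}$), whose structure isomorphisms $\Psi_n(\uparrow_\lambda)\otimes\Psi_n(\uparrow_\mu)\cong\Psi_n(\uparrow_\lambda\uparrow_\mu)$ and $\mathbb{C}\cong\Psi_n(\mathbb{1})$ are the canonical rebracketing isomorphisms and the identity. It sends the isomorphism $\mathbb{1}\to\uparrow_0$ to $1\mapsto1\in S^0(V_n)$, and the dot, the merge and the split, respectively, to the following maps, for all $k,l\ge0$ and homogeneous $v_i,w_j\in V_n$: $$S^k(V_n)\to S^k(V_n),\quad v_1\cdots v_k\mapsto\sum_{t=1}^k(-1)^{|v_1|+\dots+|v_{t-1}|}v_1\cdots c(v_t)\cdots v_k;$$ $$S^k(V_n)\otimes S^l(V_n)\to S^{k+l}(V_n),\quad v_1\cdots v_k\otimes w_1\cdots w_l\mapsto v_1\cdots v_kw_1\cdots w_l;$$ $$S^{k+l}(V_n)\to S^k(V_n)\otimes S^l(V_n),\quad v_1\cdots v_{k+l}\mapsto\sum_{I,J}(-1)^{\varepsilon_{I,J}}v_{i_1}\cdots v_{i_k}\otimes v_{j_1}\cdots v_{j_l},$$ the last sum over all $I=\{i_1<\dots<i_k\}$,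 $J=\{j_1<\dots<j_l\}$ with $I\sqcup J=\{1,\dots,k+l\}$, where $\varepsilon_{I,J}=\sum_{j\in J,\,i\in I,\,j<i}|v_i||v_j|$, the sign with $v_{i_1}\cdots v_{i_k}v_{j_1}\cdots v_{j_l}=(-1)^{\varepsilon_{I,J}}v_1\cdots v_{k+l}$. -/

import Mathlib

open CategoryTheory
open scoped TensorProduct

/-- The sign `(-1)^p` of a parity `p : ZMod 2`. -/
def sgn (p : ZMod 2) : ℂ := if p = 0 then 1 else -1

@[simp] theorem sgn_zero : sgn 0 = 1 := by simp [sgn]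

@[simp] theorem sgn_one : sgn 1 = -1 := by simp [sgn]

theorem parity_cases (p : ZMod 2) : p = 0 ∨ p = 1 := by
  revert p; decide

theorem sgn_add (p q : ZMod 2) : sgn (p + q) = sgn p * sgn q := by
  have h : (1 : ZMod 2) + 1 = 0 := by decide
  rcases parity_cases p with rfl | rfl <;> rcases parity_cases q with rfl | rfl <;> simp [h]

theorem sgn_mul_self (p : ZMod 2) : sgn p * sgn p = 1 := by
  rcases parity_cases p with rfl | rfl <;> simp

/-! ### Superspaces -/

/-- A complex superspace: a complex vector space with a decomposition
`V = V₀ ⊕ V₁` into an even and an odd part. -/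
structure SuperSpace where
  carrier : Type
  [addCommGroup : AddCommGroup carrier]
  [module : Module ℂ carrier]
  part : ZMod 2 → Submodule ℂ carrier
  isCompl : IsCompl (part 0) (part 1)

attribute [instance] SuperSpace.addCommGroup SuperSpace.module

namespace SuperSpace

instance : CoeSort SuperSpace Type := ⟨SuperSpace.carrier⟩

variable (M N P Q M' N' P' : SuperSpace)

theorem isCompl' (p : ZMod 2) : IsCompl (M.part p) (M.part (p + 1)) := by
  fin_cases p
  · exact M.isCompl
  · exact M.isCompl.symm

/-- The projection of a superspace onto its component of parity `p`. -/
noncomputable def proj (p : ZMod 2) : M →ₗ[ℂ] M :=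
  (M.part p).projection (M.part (p + 1)) (M.isCompl' p)

variable {M N P Q M' N' P'}

theorem proj_mem (p : ZMod 2) (m : M) : M.proj p m ∈ M.part p :=
  Submodule.projection_apply_mem _ _

theorem proj_of_mem {p : ZMod 2} {m : M} (h : m ∈ M.part p) : M.proj p m = m :=
  Submodule.projection_apply_of_mem_left _ h

theorem proj_of_mem_ne {p q : ZMod 2} (hpq : q ≠ p) {m : M} (h : m ∈ M.part p) :
    M.proj q m = 0 := by
  have : p = q + 1 := by clear h; revert p q; decide
  subst this
  exact (Submodule.projection_apply_eq_zero_iff _).2 h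

theorem proj_of_mem_eq {p q : ZMod 2} {m : M} (h : m ∈ M.part p) :
    M.proj q m = if q = p then m else 0 := by
  split_ifs with hq
  · subst hq; exact proj_of_mem h
  · exact proj_of_mem_ne hq h

theorem proj_add_proj (m : M) : M.proj 0 m + M.proj 1 m = m :=
  Submodule.projection_add_projection_eq_self M.isCompl m

theorem mem_of_proj {p : ZMod 2} {m : M} (h : M.proj p m = m) : m ∈ M.part p := by
  rw [← h]; exact proj_mem p m

theorem hom_induction {C : M → Prop} (hadd : ∀ x y, C x → C y → C (x + y))
    (hom : ∀ p, ∀ x ∈ M.part p, C x) (x : M) : C x := by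
  rw [← proj_add_proj x]
  exact hadd _ _ (hom _ _ (proj_mem 0 x)) (hom _ _ (proj_mem 1 x))

theorem lin_ext {X : Type*} [AddCommGroup X] [Module ℂ X] {f g : M →ₗ[ℂ] X}
    (h : ∀ p, ∀ x ∈ M.part p, f x = g x) : f = g := by
  ext x
  induction x using hom_induction with
  | hadd x y hx hy => rw [map_add, map_add, hx, hy]
  | hom p x hx => exact h p x hx

/-- A criterion for two submodules indexed by parities to be complementary. -/
theorem isCompl_of_proj {X : Type*} [AddCommGroup X] [Module ℂ X]
    (A : ZMod 2 → Submodule ℂ X) (π : ZMod 2 → X →ₗ[ℂ] X)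
    (hmem : ∀ p x, π p x ∈ A p) (hadd : ∀ x, π 0 x + π 1 x = x)
    (h0 : ∀ x ∈ A 1, π 0 x = 0) (h1 : ∀ x ∈ A 0, π 0 x = x) : IsCompl (A 0) (A 1) := by
  constructor
  · rw [Submodule.disjoint_def]
    intro x hx hx'
    rw [← h1 x hx, h0 x hx']
  · rw [codisjoint_iff, Submodule.eq_top_iff']
    intro x
    rw [← hadd x]
    exact Submodule.add_mem_sup (hmem 0 x) (hmem 1 x)

/-- The linear maps of parity `p` between two superspaces: those that send `M_e` to `N_(e+p)`. -/
def linPart (M N : SuperSpace) (p : ZMod 2) : Submodule ℂ (M →ₗ[ℂ] N) where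
  carrier := {f | ∀ e, ∀ m ∈ M.part e, f m ∈ N.part (e + p)}
  add_mem' hf hg e m hm := add_mem (hf e m hm) (hg e m hm)
  zero_mem' _ _ _ := zero_mem _
  smul_mem' c _ hf e m hm := Submodule.smul_mem _ c (hf e m hm)

/-- The component of parity `p` of a linear map between superspaces. -/
noncomputable def linComp (p : ZMod 2) (f : M →ₗ[ℂ] N) : M →ₗ[ℂ] N :=
  N.proj p ∘ₗ f ∘ₗ M.proj 0 + N.proj (p + 1) ∘ₗ f ∘ₗ M.proj 1

theorem linComp_apply {p e : ZMod 2} (f : M →ₗ[ℂ] N) {m : M} (hm : m ∈ M.part e) :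
    linComp p f m = N.proj (e + p) (f m) := by
  rcases parity_cases e with rfl | rfl
  · simp [linComp, proj_of_mem hm, proj_of_mem_ne (q := 1) (p := 0) (by decide) hm]
  · simp [linComp, proj_of_mem hm, proj_of_mem_ne (q := 0) (p := 1) (by decide) hm, add_comm]

theorem linComp_mem (p : ZMod 2) (f : M →ₗ[ℂ] N) : linComp p f ∈ linPart M N p := by
  intro e m hm
  rw [linComp_apply f hm]
  exact proj_mem _ _

theorem linComp_add_linComp (f : M →ₗ[ℂ] N) : linComp 0 f + linComp 1 f = f := by
  apply lin_ext
  intro e m hm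
  rw [LinearMap.add_apply, linComp_apply f hm, linComp_apply f hm]
  rcases parity_cases e with rfl | rfl
  · exact proj_add_proj _
  · rw [add_comm]; exact proj_add_proj _

theorem linComp_of_mem {p q : ZMod 2} {f : M →ₗ[ℂ] N} (hf : f ∈ linPart M N p) :
    linComp q f = if q = p then f else 0 := by
  apply lin_ext
  intro e m hm
  rw [linComp_apply f hm, proj_of_mem_eq (hf e m hm)]
  simp only [add_right_inj]
  split_ifs <;> rfl

theorem linPart_disjoint {f : M →ₗ[ℂ] N} (h0 : f ∈ linPart M N 0) (h1 : f ∈ linPart M N 1) :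
    f = 0 := by
  have h := linComp_of_mem (q := 0) h0
  rw [linComp_of_mem h1] at h
  simpa using h.symm

theorem linPart_id : (LinearMap.id : M →ₗ[ℂ] M) ∈ linPart M M 0 := by
  intro e m hm
  simpa using hm

theorem linPart_comp {p q : ZMod 2} {f : M →ₗ[ℂ] N} {g : N →ₗ[ℂ] P}
    (hf : f ∈ linPart M N p) (hg : g ∈ linPart N P q) : g ∘ₗ f ∈ linPart M P (p + q) := by
  intro e m hm
  rw [← add_assoc]
  exact hg _ _ (hf e m hm)

/-! ### Tensor products of superspaces -/

/-- The component of parity `p` of the tensor product of two superspaces, spanned by the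
`m ⊗ n` with `m` and `n` homogeneous and `|m| + |n| = p`. -/
noncomputable def tensorPart (M N : SuperSpace) (p : ZMod 2) : Submodule ℂ (M ⊗[ℂ] N) :=
  ⨆ e : ZMod 2, Submodule.map₂ (TensorProduct.mk ℂ M N) (M.part e) (N.part (p - e))

noncomputable def tensorProj (M N : SuperSpace) (p : ZMod 2) : M ⊗[ℂ] N →ₗ[ℂ] M ⊗[ℂ] N :=
  TensorProduct.map (M.proj 0) (N.proj p) + TensorProduct.map (M.proj 1) (N.proj (p - 1))

theorem tmul_mem_tensorPart {e d : ZMod 2} {m : M} {n : N} (hm : m ∈ M.part e)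
    (hn : n ∈ N.part d) : m ⊗ₜ[ℂ] n ∈ tensorPart M N (e + d) := by
  refine Submodule.mem_iSup_of_mem e ?_
  exact Submodule.apply_mem_map₂ (TensorProduct.mk ℂ M N) hm (by simpa using hn)

theorem tensorPart_induction {p : ZMod 2} {C : M ⊗[ℂ] N → Prop} {x : M ⊗[ℂ] N}
    (hx : x ∈ tensorPart M N p) (hzero : C 0) (hadd : ∀ x y, C x → C y → C (x + y))
    (htmul : ∀ e d, e + d = p → ∀ m ∈ M.part e, ∀ n ∈ N.part d, C (m ⊗ₜ[ℂ] n)) : C x := by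
  refine Submodule.iSup_induction (motive := C) _ hx (fun e y hy => ?_) hzero hadd
  rw [Submodule.map₂_eq_span_image2] at hy
  induction hy using Submodule.closure_induction with
  | zero => exact hzero
  | add x y _ _ hx hy => exact hadd _ _ hx hy
  | smul_mem r x hx =>
    obtain ⟨m, hm, n, hn, rfl⟩ := hx
    have : r • (TensorProduct.mk ℂ M N) m n = (r • m) ⊗ₜ[ℂ] n := by
      simp [TensorProduct.smul_tmul']
    rw [this]
    exact htmul e (p - e) (by ring) _ (Submodule.smul_mem _ _ hm) _ hn

theorem tensorProj_tmul {p e d : ZMod 2} {m : M} {n : N} (hm : m ∈ M.part e)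
    (hn : n ∈ N.part d) : tensorProj M N p (m ⊗ₜ[ℂ] n) = if p = e + d then m ⊗ₜ n else 0 := by
  have h0 := proj_of_mem_eq (q := 0) hm
  have h1 := proj_of_mem_eq (q := 1) hm
  have h2 := proj_of_mem_eq (q := p) hn
  have h3 := proj_of_mem_eq (q := p - 1) hn
  simp only [tensorProj, LinearMap.add_apply, TensorProduct.map_tmul, h0, h1, h2, h3]
  clear h0 h1 h2 h3 hm hn
  rcases parity_cases e with rfl | rfl
  · simp; split_ifs <;> simp
  · have : (p - 1 = d) ↔ (p = 1 + d) := by revert p d; decide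
    simp [this]; split_ifs <;> simp

theorem tmul_induction {C : M ⊗[ℂ] N → Prop} (hadd : ∀ x y, C x → C y → C (x + y))
    (htmul : ∀ e d, ∀ m ∈ M.part e, ∀ n ∈ N.part d, C (m ⊗ₜ[ℂ] n)) (x : M ⊗[ℂ] N) : C x := by
  induction x with
  | zero => simpa using htmul 0 0 0 (zero_mem _) 0 (zero_mem _)
  | add x y hx hy => exact hadd _ _ hx hy
  | tmul m n =>
    induction m using hom_induction with
    | hadd x y hx hy => rw [TensorProduct.add_tmul]; exact hadd _ _ hx hy
    | hom p m hm =>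
      induction n using hom_induction with
      | hadd x y hx hy => rw [TensorProduct.tmul_add]; exact hadd _ _ hx hy
      | hom q n hn => exact htmul p q m hm n hn

theorem tmul_ext {X : Type*} [AddCommGroup X] [Module ℂ X] {f g : M ⊗[ℂ] N →ₗ[ℂ] X}
    (h : ∀ e d, ∀ m ∈ M.part e, ∀ n ∈ N.part d, f (m ⊗ₜ n) = g (m ⊗ₜ n)) : f = g := by
  apply LinearMap.ext
  intro x
  induction x using tmul_induction with
  | hadd x y hx hy => rw [map_add, map_add, hx, hy]
  | htmul e d m hm n hn => exact h e d m hm n hn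

theorem tensorProj_of_mem {p q : ZMod 2} {x : M ⊗[ℂ] N} (hx : x ∈ tensorPart M N p) :
    tensorProj M N q x = if q = p then x else 0 := by
  refine tensorPart_induction (C := fun x => tensorProj M N q x = if q = p then x else 0) hx ?_ ?_ ?_
  · simp
  · intro x y hx hy; rw [map_add, hx, hy]; split_ifs <;> simp
  · intro e d hed m hm n hn; rw [tensorProj_tmul hm hn, hed]

/-- The tensor product of two superspaces. -/
noncomputable abbrev tensor (M N : SuperSpace) : SuperSpace where
  carrier := M ⊗[ℂ] N
  part := tensorPart M N
  isCompl := by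
    refine isCompl_of_proj _ (tensorProj M N) ?_ ?_ ?_ ?_
    · intro p x
      induction x using tmul_induction with
      | hadd x y hx hy => rw [map_add]; exact add_mem hx hy
      | htmul e d m hm n hn =>
        rw [tensorProj_tmul hm hn]
        split_ifs with h
        · rw [h]; exact tmul_mem_tensorPart hm hn
        · exact zero_mem _
    · intro x
      induction x using tmul_induction with
      | hadd x y hx hy =>
        rw [map_add, map_add]
        nth_rewrite 3 [← hx]
        nth_rewrite 3 [← hy]
        abel
      | htmul e d m hm n hn =>
        rw [tensorProj_tmul hm hn, tensorProj_tmul hm hn]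
        rcases parity_cases (e + d) with h | h <;> simp [h]
    · intro x hx
      rw [tensorProj_of_mem hx]; simp
    · intro x hx
      rw [tensorProj_of_mem hx]; simp

/-- The super tensor product of two linear maps between superspaces. On homogeneous elements
it is `(f ⊗ g)(m ⊗ n) = (-1)^(|g||m|) f(m) ⊗ g(n)`. -/
noncomputable def tensorMap (f : M →ₗ[ℂ] M') (g : N →ₗ[ℂ] N') : tensor M N →ₗ[ℂ] tensor M' N' :=
  TensorProduct.map f (linComp 0 g) +
    TensorProduct.map (f ∘ₗ (M.proj 0 - M.proj 1)) (linComp 1 g)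

theorem tensorMap_tmul (f : M →ₗ[ℂ] M') {g : N →ₗ[ℂ] N'} {p e : ZMod 2}
    (hg : g ∈ linPart N N' p) {m : M} (hm : m ∈ M.part e) (n : N) :
    tensorMap f g (m ⊗ₜ[ℂ] n) = sgn (p * e) • (f m ⊗ₜ[ℂ] g n) := by
  have h0 := linComp_of_mem (q := 0) hg
  have h1 := linComp_of_mem (q := 1) hg
  have h2 := proj_of_mem_eq (q := 0) hm
  have h3 := proj_of_mem_eq (q := 1) hm
  simp only [tensorMap, LinearMap.add_apply, h0, h1]
  rcases parity_cases p with rfl | rfl <;> rcases parity_cases e with rfl | rfl <;>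
    simp [h2, h3, TensorProduct.neg_tmul]

theorem tensorMap_add_left (f f' : M →ₗ[ℂ] M') (g : N →ₗ[ℂ] N') :
    tensorMap (f + f') g = tensorMap f g + tensorMap f' g := by
  simp only [tensorMap, LinearMap.add_comp, TensorProduct.map_add_left]; abel

theorem linComp_add (p : ZMod 2) (f g : M →ₗ[ℂ] N) :
    linComp p (f + g) = linComp p f + linComp p g := by
  simp only [linComp, LinearMap.add_comp, LinearMap.comp_add]; abel

theorem linComp_smul (p : ZMod 2) (c : ℂ) (f : M →ₗ[ℂ] N) :
    linComp p (c • f) = c • linComp p f := by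
  simp only [linComp, LinearMap.smul_comp, LinearMap.comp_smul, smul_add]

theorem tensorMap_add_right (f : M →ₗ[ℂ] M') (g g' : N →ₗ[ℂ] N') :
    tensorMap f (g + g') = tensorMap f g + tensorMap f g' := by
  simp only [tensorMap, linComp_add, TensorProduct.map_add_right]; abel

theorem tensorMap_smul_left (c : ℂ) (f : M →ₗ[ℂ] M') (g : N →ₗ[ℂ] N') :
    tensorMap (c • f) g = c • tensorMap f g := by
  simp only [tensorMap, LinearMap.smul_comp, TensorProduct.map_smul_left]; rw [smul_add]

theorem tensorMap_smul_right (c : ℂ) (f : M →ₗ[ℂ] M') (g : N →ₗ[ℂ] N') :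
    tensorMap f (c • g) = c • tensorMap f g := by
  simp only [tensorMap, linComp_smul, TensorProduct.map_smul_right]; rw [smul_add]

theorem lin_hom_induction {C : (M →ₗ[ℂ] N) → Prop} (hadd : ∀ f g, C f → C g → C (f + g))
    (hom : ∀ p, ∀ f ∈ linPart M N p, C f) (f : M →ₗ[ℂ] N) : C f := by
  rw [← linComp_add_linComp f]
  exact hadd _ _ (hom _ _ (linComp_mem 0 f)) (hom _ _ (linComp_mem 1 f))

theorem tensorMap_mem {p q : ZMod 2} {f : M →ₗ[ℂ] M'} {g : N →ₗ[ℂ] N'}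
    (hf : f ∈ linPart M M' p) (hg : g ∈ linPart N N' q) :
    tensorMap f g ∈ linPart (tensor M N) (tensor M' N') (p + q) := by
  intro e x hx
  change x ∈ tensorPart M N e at hx
  change tensorMap f g x ∈ tensorPart M' N' _
  refine tensorPart_induction (C := fun x => tensorMap f g x ∈ tensorPart M' N' (e + (p + q)))
    hx ?_ ?_ ?_
  · rw [map_zero]; exact zero_mem _
  · intro x y hx hy; rw [map_add]; exact add_mem hx hy
  · intro a b hab m hm n hn
    rw [tensorMap_tmul f hg hm]
    have := tmul_mem_tensorPart (hf a m hm) (hg b n hn)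
    rw [show a + p + (b + q) = e + (p + q) by rw [← hab]; ring] at this
    exact Submodule.smul_mem _ _ this

theorem tensorMap_id : tensorMap (LinearMap.id : M →ₗ[ℂ] M) (LinearMap.id : N →ₗ[ℂ] N) =
    LinearMap.id := by
  apply tmul_ext
  intro e d m hm n hn
  rw [tensorMap_tmul _ linPart_id hm]
  simp

/-- The super interchange law. -/
theorem tensorMap_comp {p q : ZMod 2} (f : M' →ₗ[ℂ] P) {g : N' →ₗ[ℂ] Q} {h : M →ₗ[ℂ] M'}
    (k : N →ₗ[ℂ] N') (hg : g ∈ linPart N' Q p) (hh : h ∈ linPart M M' q) :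
    tensorMap f g ∘ₗ tensorMap h k = sgn (p * q) • tensorMap (f ∘ₗ h) (g ∘ₗ k) := by
  induction k using lin_hom_induction with
  | hadd k k' hk hk' =>
    rw [tensorMap_add_right, LinearMap.comp_add, LinearMap.comp_add, tensorMap_add_right, hk, hk',
      smul_add]
  | hom r k hk =>
    apply tmul_ext
    intro e d m hm n hn
    rw [LinearMap.comp_apply, tensorMap_tmul _ hk hm, LinearMap.smul_apply,
      tensorMap_tmul _ (linPart_comp hk hg) hm, map_smul, tensorMap_tmul _ hg (hh _ _ hm),
      smul_smul, smul_smul, ← sgn_add, ← sgn_add]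
    congr 2
    ring

/-- The associativity isomorphism `(M ⊗ N) ⊗ P ≃ M ⊗ (N ⊗ P)`. -/
noncomputable def assoc (M N P : SuperSpace) :
    tensor (tensor M N) P ≃ₗ[ℂ] tensor M (tensor N P) :=
  TensorProduct.assoc ℂ M N P

theorem assoc_tmul (m : M) (n : N) (p : P) :
    assoc M N P ((m ⊗ₜ n) ⊗ₜ p) = m ⊗ₜ (n ⊗ₜ p) := rfl

theorem assoc_mem : (assoc M N P).toLinearMap ∈
    linPart (tensor (tensor M N) P) (tensor M (tensor N P)) 0 := by
  intro e x hx
  rw [add_zero]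
  refine tensorPart_induction (M := tensor M N) (N := P) (C := fun x => assoc M N P x ∈ tensorPart M (tensor N P) e) hx ?_ ?_ ?_
  · rw [map_zero]; exact zero_mem _
  · intro x y hx hy; rw [map_add]; exact add_mem hx hy
  · intro a b hab y hy z hz
    refine tensorPart_induction (M := M) (N := N) (C := fun y => assoc M N P (y ⊗ₜ z) ∈ tensorPart M (tensor N P) e) hy ?_ ?_ ?_
    · rw [TensorProduct.zero_tmul, map_zero]; exact zero_mem _
    · intro x y hx hy; rw [TensorProduct.add_tmul, map_add]; exact add_mem hx hy
    · intro c d hcd m hm n hn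
      have := tmul_mem_tensorPart (N := tensor N P) hm (tmul_mem_tensorPart hn hz)
      rw [← add_assoc, hcd, hab] at this
      exact this

end SuperSpace

/-! ### Supercategories -/

/-- A (`ℂ`-linear) supercategory: a category enriched in superspaces. The superspace structure on
`X ⟶ Y` has homogeneous parts `homPart X Y 0` and `homPart X Y 1`. -/
class Supercategory.{v, u} (C : Type u) [Category.{v} C] [Preadditive C] [Linear ℂ C] where
  homPart : ∀ X Y : C, ZMod 2 → Submodule ℂ (X ⟶ Y)
  isCompl_homPart : ∀ X Y : C, IsCompl (homPart X Y 0) (homPart X Y 1)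
  id_mem : ∀ X : C, 𝟙 X ∈ homPart X X 0
  comp_mem : ∀ {X Y Z : C} {p q : ZMod 2} {f : X ⟶ Y} {g : Y ⟶ Z},
    f ∈ homPart X Y p → g ∈ homPart Y Z q → f ≫ g ∈ homPart X Z (p + q)

/-- A monoidal supercategory. The tensor product is a superfunctor of two variables, which
amounts to bilinearity, compatibility with parities and the super interchange law
`(f ⊗ g) ∘ (h ⊗ k) = (-1)^(|g||h|) (f ∘ h) ⊗ (g ∘ k)`; the coherence maps are even supernatural
isomorphisms that satisfy the pentagon and the triangle axiom. -/
class MonoidalSupercategory.{v, u} (C : Type u) [Category.{v} C] [Preadditive C] [Linear ℂ C]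
    extends Supercategory C where
  tensorObj : C → C → C
  tensorUnit : C
  tensorHom : ∀ {X Y X' Y' : C},
    (X ⟶ Y) →ₗ[ℂ] (X' ⟶ Y') →ₗ[ℂ] (tensorObj X X' ⟶ tensorObj Y Y')
  tensorHom_mem : ∀ {X Y X' Y' : C} {p q : ZMod 2} {f : X ⟶ Y} {g : X' ⟶ Y'},
    f ∈ homPart X Y p → g ∈ homPart X' Y' q →
      tensorHom f g ∈ homPart (tensorObj X X') (tensorObj Y Y') (p + q)
  tensorHom_id : ∀ X Y : C, tensorHom (𝟙 X) (𝟙 Y) = 𝟙 (tensorObj X Y)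
  tensorHom_comp : ∀ {X Y Z X' Y' Z' : C} {p q : ZMod 2} (h : X ⟶ Y) (f : Y ⟶ Z)
    (k : X' ⟶ Y') (g : Y' ⟶ Z'), g ∈ homPart Y' Z' p → h ∈ homPart X Y q →
      tensorHom h k ≫ tensorHom f g = sgn (p * q) • tensorHom (h ≫ f) (k ≫ g)
  associator : ∀ X Y Z : C, tensorObj (tensorObj X Y) Z ≅ tensorObj X (tensorObj Y Z)
  leftUnitor : ∀ X : C, tensorObj tensorUnit X ≅ X
  rightUnitor : ∀ X : C, tensorObj X tensorUnit ≅ X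
  associator_mem : ∀ X Y Z : C, (associator X Y Z).hom ∈ homPart _ _ 0
  leftUnitor_mem : ∀ X : C, (leftUnitor X).hom ∈ homPart _ _ 0
  rightUnitor_mem : ∀ X : C, (rightUnitor X).hom ∈ homPart _ _ 0
  associator_naturality : ∀ {X Y Z X' Y' Z' : C} (f : X ⟶ X') (g : Y ⟶ Y') (h : Z ⟶ Z'),
    tensorHom (tensorHom f g) h ≫ (associator X' Y' Z').hom =
      (associator X Y Z).hom ≫ tensorHom f (tensorHom g h)
  leftUnitor_naturality : ∀ {X Y : C} (f : X ⟶ Y),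
    tensorHom (𝟙 tensorUnit) f ≫ (leftUnitor Y).hom = (leftUnitor X).hom ≫ f
  rightUnitor_naturality : ∀ {X Y : C} (f : X ⟶ Y),
    tensorHom f (𝟙 tensorUnit) ≫ (rightUnitor Y).hom = (rightUnitor X).hom ≫ f
  pentagon : ∀ W X Y Z : C,
    tensorHom (associator W X Y).hom (𝟙 Z) ≫ (associator W (tensorObj X Y) Z).hom ≫
        tensorHom (𝟙 W) (associator X Y Z).hom =
      (associator (tensorObj W X) Y Z).hom ≫ (associator W X (tensorObj Y Z)).hom
  triangle : ∀ X Y : C,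
    (associator X tensorUnit Y).hom ≫ tensorHom (𝟙 X) (leftUnitor Y).hom =
      tensorHom (rightUnitor X).hom (𝟙 Y)

open Supercategory MonoidalSupercategory

/-- A monoidal functor between monoidal supercategories with the map `F` on objects: a
parity-preserving `ℂ`-linear functor with even (super)natural isomorphisms
`F X ⊗ F Y ≅ F (X ⊗ Y)` and an even isomorphism `𝟙 ≅ F 𝟙` that are compatible with the
coherence maps. -/
structure MonoidalSuperfunctor.{v, v', u, u'} {C : Type u} [Category.{v} C] [Preadditive C]
    [Linear ℂ C] [MonoidalSupercategory C] {D : Type u'} [Category.{v'} D] [Preadditive D]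
    [Linear ℂ D] [MonoidalSupercategory D] (F : C → D) where
  map : ∀ {X Y : C}, (X ⟶ Y) →ₗ[ℂ] (F X ⟶ F Y)
  map_mem : ∀ {X Y : C} {p : ZMod 2} {f : X ⟶ Y}, f ∈ homPart X Y p → map f ∈ homPart _ _ p
  map_id : ∀ X : C, map (𝟙 X) = 𝟙 (F X)
  map_comp : ∀ {X Y Z : C} (f : X ⟶ Y) (g : Y ⟶ Z), map (f ≫ g) = map f ≫ map g
  unitIso : (tensorUnit : D) ≅ F tensorUnit
  unitIso_mem : unitIso.hom ∈ homPart _ _ 0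
  tensorIso : ∀ X Y : C, tensorObj (F X) (F Y) ≅ F (tensorObj X Y)
  tensorIso_mem : ∀ X Y : C, (tensorIso X Y).hom ∈ homPart _ _ 0
  tensorIso_naturality : ∀ {X Y X' Y' : C} (f : X ⟶ Y) (g : X' ⟶ Y'),
    tensorHom (map f) (map g) ≫ (tensorIso Y Y').hom =
      (tensorIso X X').hom ≫ map (tensorHom f g)
  associativity : ∀ X Y Z : C,
    tensorHom (tensorIso X Y).hom (𝟙 (F Z)) ≫ (tensorIso (tensorObj X Y) Z).hom ≫
        map (associator X Y Z).hom =
      (associator (F X) (F Y) (F Z)).hom ≫ tensorHom (𝟙 (F X)) (tensorIso Y Z).hom ≫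
        (tensorIso X (tensorObj Y Z)).hom
  left_unitality : ∀ X : C,
    (leftUnitor (F X)).hom =
      tensorHom unitIso.hom (𝟙 (F X)) ≫ (tensorIso tensorUnit X).hom ≫ map (leftUnitor X).hom
  right_unitality : ∀ X : C,
    (rightUnitor (F X)).hom =
      tensorHom (𝟙 (F X)) unitIso.hom ≫ (tensorIso X tensorUnit).hom ≫ map (rightUnitor X).hom

/-- The map `F` on objects is essentially surjective: every object of the target supercategory is
isomorphic to some `F X` by an even isomorphism. -/
def SuperEssSurj.{v, u, u'} {C : Type u} {D : Type u'} [Category.{v} D] [Preadditive D]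
    [Linear ℂ D] [Supercategory D] (F : C → D) : Prop :=
  ∀ Y : D, ∃ (X : C) (i : F X ≅ Y), i.hom ∈ homPart (F X) Y 0

/-! ### Lie superalgebras and supermodules -/

/-- A complex Lie superalgebra. -/
structure LieSuperalgebra extends SuperSpace where
  bracket : carrier →ₗ[ℂ] carrier →ₗ[ℂ] carrier
  bracket_mem : ∀ {p q : ZMod 2} {x y : carrier}, x ∈ part p → y ∈ part q →
    bracket x y ∈ part (p + q)
  bracket_skew : ∀ {p q : ZMod 2} {x y : carrier}, x ∈ part p → y ∈ part q →
    bracket x y = -(sgn (p * q) • bracket y x)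
  jacobi : ∀ {p q : ZMod 2} {x y : carrier} (z : carrier), x ∈ part p → y ∈ part q →
    bracket x (bracket y z) = bracket (bracket x y) z + sgn (p * q) • bracket y (bracket x z)

/-- A supermodule for a Lie superalgebra. -/
structure SuperModule (𝔤 : LieSuperalgebra) extends SuperSpace where
  act : 𝔤.carrier →ₗ[ℂ] (carrier →ₗ[ℂ] carrier)
  act_mem : ∀ {p : ZMod 2} {x : 𝔤.carrier}, x ∈ 𝔤.part p → ∀ {e : ZMod 2} {m : carrier},
    m ∈ part e → act x m ∈ part (e + p)
  act_bracket : ∀ {p q : ZMod 2} {x y : 𝔤.carrier}, x ∈ 𝔤.part p → y ∈ 𝔤.part q →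
    ∀ m : carrier, act (𝔤.bracket x y) m = act x (act y m) - sgn (p * q) • act y (act x m)

namespace SuperModule

open SuperSpace

variable {𝔤 : LieSuperalgebra} (M N P Q M' N' P' : SuperModule 𝔤)

/-- The homomorphisms of parity `p` between two supermodules: linear maps `f` of parity `p` with
`f (x m) = (-1)^(p|x|) x f(m)`. -/
def homPart (p : ZMod 2) : Submodule ℂ (M.carrier →ₗ[ℂ] N.carrier) where
  carrier := {f | f ∈ linPart M.toSuperSpace N.toSuperSpace p ∧
    ∀ r, ∀ x ∈ 𝔤.part r, f ∘ₗ M.act x = sgn (p * r) • (N.act x ∘ₗ f)}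
  add_mem' := by
    rintro f g ⟨hf, hf'⟩ ⟨hg, hg'⟩
    refine ⟨add_mem hf hg, fun r x hx => ?_⟩
    rw [LinearMap.add_comp, LinearMap.comp_add, hf' r x hx, hg' r x hx, smul_add]
  zero_mem' := ⟨zero_mem _, fun r x hx => by simp⟩
  smul_mem' := by
    rintro c f ⟨hf, hf'⟩
    refine ⟨Submodule.smul_mem _ c hf, fun r x hx => ?_⟩
    rw [LinearMap.smul_comp, LinearMap.comp_smul, hf' r x hx, smul_comm]

/-- All homomorphisms between two supermodules: sums of even and odd ones. -/
def homSub : Submodule ℂ (M.carrier →ₗ[ℂ] N.carrier) := homPart M N 0 ⊔ homPart M N 1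

variable {M N P Q M' N' P'}

theorem homPart_le (p : ZMod 2) : homPart M N p ≤ homSub M N := by
  rcases parity_cases p with rfl | rfl
  · exact le_sup_left
  · exact le_sup_right

theorem homSub_induction {C : (M.carrier →ₗ[ℂ] N.carrier) → Prop} {f : M.carrier →ₗ[ℂ] N.carrier}
    (hf : f ∈ homSub M N) (hadd : ∀ f g, C f → C g → C (f + g))
    (hom : ∀ p, ∀ f ∈ homPart M N p, C f) : C f := by
  obtain ⟨a, ha, b, hb, rfl⟩ := Submodule.mem_sup.1 hf
  exact hadd _ _ (hom _ _ ha) (hom _ _ hb)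

theorem id_mem_homPart : (LinearMap.id : M.carrier →ₗ[ℂ] M.carrier) ∈ homPart M M 0 :=
  ⟨linPart_id, fun r x _ => by simp⟩

theorem comp_mem_homPart {p q : ZMod 2} {f : M.carrier →ₗ[ℂ] N.carrier}
    {g : N.carrier →ₗ[ℂ] P.carrier} (hf : f ∈ homPart M N p) (hg : g ∈ homPart N P q) :
    g ∘ₗ f ∈ homPart M P (p + q) := by
  refine ⟨linPart_comp hf.1 hg.1, fun r x hx => ?_⟩
  rw [LinearMap.comp_assoc, hf.2 r x hx, LinearMap.comp_smul, ← LinearMap.comp_assoc,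
    hg.2 r x hx, LinearMap.smul_comp, smul_smul, ← sgn_add, LinearMap.comp_assoc, add_mul]

theorem comp_mem_homSub {f : M.carrier →ₗ[ℂ] N.carrier} {g : N.carrier →ₗ[ℂ] P.carrier}
    (hf : f ∈ homSub M N) (hg : g ∈ homSub N P) : g ∘ₗ f ∈ homSub M P := by
  refine homSub_induction (C := fun f => g ∘ₗ f ∈ homSub M P) hf (fun a b ha hb => ?_)
    (fun p f hf => ?_)
  · rw [LinearMap.comp_add]; exact add_mem ha hb
  · refine homSub_induction (C := fun g => g ∘ₗ f ∈ homSub M P) hg (fun a b ha hb => ?_) (fun q g hg => ?_)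
    · rw [LinearMap.add_comp]; exact add_mem ha hb
    · exact homPart_le _ (comp_mem_homPart hf hg)

/-- The category of supermodules, with all (not only the even) homomorphisms. -/
instance : Category (SuperModule 𝔤) where
  Hom M N := homSub M N
  id M := ⟨LinearMap.id, homPart_le 0 id_mem_homPart⟩
  comp f g := ⟨g.1 ∘ₗ f.1, comp_mem_homSub f.2 g.2⟩

instance : Preadditive (SuperModule 𝔤) where
  homGroup M N := inferInstanceAs (AddCommGroup (homSub M N))
  add_comp _ _ _ f f' g := Subtype.ext (LinearMap.comp_add f.1 f'.1 g.1)
  comp_add _ _ _ f g g' := Subtype.ext (LinearMap.add_comp f.1 g'.1 g.1)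

instance : Linear ℂ (SuperModule 𝔤) where
  homModule M N := inferInstanceAs (Module ℂ (homSub M N))
  smul_comp _ _ _ r f g := Subtype.ext (LinearMap.comp_smul g.1 r f.1)
  comp_smul _ _ _ f r g := Subtype.ext (LinearMap.smul_comp r g.1 f.1)

instance : Supercategory (SuperModule 𝔤) where
  homPart M N p := (homPart M N p).comap (homSub M N).subtype
  isCompl_homPart M N := by
    constructor
    · rw [Submodule.disjoint_def]
      intro f h0 h1
      exact Subtype.ext (linPart_disjoint h0.1 h1.1)
    · rw [codisjoint_iff, Submodule.eq_top_iff']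
      rintro ⟨f, hf⟩
      obtain ⟨a, ha, b, hb, rfl⟩ := Submodule.mem_sup.1 hf
      exact Submodule.mem_sup.2
        ⟨⟨a, homPart_le 0 ha⟩, ha, ⟨b, homPart_le 1 hb⟩, hb, rfl⟩
  id_mem M := id_mem_homPart
  comp_mem hf hg := comp_mem_homPart hf hg

theorem act_linPart {p : ZMod 2} {x : 𝔤.carrier} (hx : x ∈ 𝔤.part p) :
    M.act x ∈ linPart M.toSuperSpace M.toSuperSpace p :=
  fun _ _ hm => M.act_mem hx hm

theorem act_bracket' {p q : ZMod 2} {x y : 𝔤.carrier} (hx : x ∈ 𝔤.part p) (hy : y ∈ 𝔤.part q) :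
    M.act (𝔤.bracket x y) = M.act x ∘ₗ M.act y - sgn (p * q) • (M.act y ∘ₗ M.act x) :=
  LinearMap.ext fun m => M.act_bracket hx hy m

/-- The action on a tensor product, `x (m ⊗ n) = x m ⊗ n + (-1)^(|x||m|) m ⊗ x n`. -/
noncomputable def tensorAct (M N : SuperModule 𝔤) : 𝔤.carrier →ₗ[ℂ]
    (M.toSuperSpace.tensor N.toSuperSpace →ₗ[ℂ] M.toSuperSpace.tensor N.toSuperSpace) where
  toFun x := tensorMap (M.act x) LinearMap.id + tensorMap LinearMap.id (N.act x)
  map_add' x y := by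
    rw [map_add, map_add, tensorMap_add_left, tensorMap_add_right]; abel
  map_smul' c x := by
    rw [map_smul, map_smul, tensorMap_smul_left, tensorMap_smul_right, RingHom.id_apply, smul_add]

theorem tensorAct_apply (x : 𝔤.carrier) :
    tensorAct M N x = tensorMap (M.act x) LinearMap.id + tensorMap LinearMap.id (N.act x) := rfl

theorem tensorAct_tmul {p e : ZMod 2} {x : 𝔤.carrier} (hx : x ∈ 𝔤.part p) {m : M.carrier}
    (hm : m ∈ M.part e) (n : N.carrier) :
    tensorAct M N x (m ⊗ₜ[ℂ] n) = M.act x m ⊗ₜ n + sgn (p * e) • (m ⊗ₜ N.act x n) := by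
  rw [tensorAct_apply, LinearMap.add_apply, tensorMap_tmul _ linPart_id hm,
    tensorMap_tmul _ (act_linPart hx) hm]
  simp

theorem tensorAct_linPart {p : ZMod 2} {x : 𝔤.carrier} (hx : x ∈ 𝔤.part p) :
    tensorAct M N x ∈ linPart (M.toSuperSpace.tensor N.toSuperSpace)
      (M.toSuperSpace.tensor N.toSuperSpace) p := by
  rw [tensorAct_apply]
  refine add_mem ?_ ?_
  · simpa using tensorMap_mem (act_linPart (M := M) hx) (linPart_id (M := N.toSuperSpace))
  · simpa using tensorMap_mem (linPart_id (M := M.toSuperSpace)) (act_linPart (M := N) hx)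

/-- The tensor product of two supermodules. -/
noncomputable abbrev tensor (M N : SuperModule 𝔤) : SuperModule 𝔤 where
  toSuperSpace := M.toSuperSpace.tensor N.toSuperSpace
  act := tensorAct M N
  act_mem hx _ _ hm := tensorAct_linPart hx _ _ hm
  act_bracket {p q x y} hx hy m := by
    have hidM := linPart_id (M := M.toSuperSpace)
    have hidN := linPart_id (M := N.toSuperSpace)
    have hxM := act_linPart (M := M) hx
    have hyM := act_linPart (M := M) hy
    have hxN := act_linPart (M := N) hx
    have hyN := act_linPart (M := N) hy
    have h1 : ∀ {r s : ZMod 2} {a b : 𝔤.carrier}, a ∈ 𝔤.part r → b ∈ 𝔤.part s →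
        tensorAct M N a ∘ₗ tensorAct M N b =
          tensorMap (M.act a ∘ₗ M.act b) LinearMap.id + tensorMap (M.act a) (N.act b) +
          (sgn (r * s) • tensorMap (M.act b) (N.act a) +
            tensorMap LinearMap.id (N.act a ∘ₗ N.act b)) := by
      intro r s a b ha hb
      have haN := act_linPart (M := N) ha
      have hbM := act_linPart (M := M) hb
      rw [tensorAct_apply, tensorAct_apply, LinearMap.add_comp, LinearMap.comp_add,
        LinearMap.comp_add, tensorMap_comp _ _ hidN hbM, tensorMap_comp _ _ hidN hidM,
        tensorMap_comp _ _ haN hbM, tensorMap_comp _ _ haN hidM]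
      simp
    suffices h2 : tensorAct M N (𝔤.bracket x y) = tensorAct M N x ∘ₗ tensorAct M N y -
        sgn (p * q) • (tensorAct M N y ∘ₗ tensorAct M N x) by
      exact LinearMap.congr_fun h2 m
    rw [h1 hx hy, h1 hy hx, tensorAct_apply, act_bracket' hx hy, act_bracket' hx hy,
      sub_eq_add_neg, ← neg_smul, tensorMap_add_left, tensorMap_smul_left,
      sub_eq_add_neg, ← neg_smul, tensorMap_add_right, tensorMap_smul_right]
    rw [smul_add, smul_add, smul_add, smul_smul, mul_comm q p, sgn_mul_self, one_smul]
    module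

theorem tensorMap_mem_homPart {p q : ZMod 2} {f : M.carrier →ₗ[ℂ] M'.carrier}
    {g : N.carrier →ₗ[ℂ] N'.carrier} (hf : f ∈ homPart M M' p) (hg : g ∈ homPart N N' q) :
    tensorMap f g ∈ homPart (tensor M N) (tensor M' N') (p + q) := by
  refine ⟨tensorMap_mem hf.1 hg.1, fun r x hx => ?_⟩
  change tensorMap f g ∘ₗ tensorAct M N x = sgn ((p + q) * r) • (tensorAct M' N' x ∘ₗ tensorMap f g)
  rw [tensorAct_apply, tensorAct_apply, LinearMap.comp_add, LinearMap.add_comp,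
    tensorMap_comp _ _ hg.1 (act_linPart hx), tensorMap_comp _ _ hg.1 linPart_id,
    tensorMap_comp _ _ linPart_id hf.1, tensorMap_comp _ _ (act_linPart hx) hf.1,
    hf.2 r x hx, hg.2 r x hx, tensorMap_smul_left, tensorMap_smul_right]
  simp only [LinearMap.comp_id, LinearMap.id_comp, mul_zero, zero_mul, sgn_zero, one_smul,
    smul_add, smul_smul, add_mul, sgn_add, mul_comm r p]
  congr 2
  · ring
  · linear_combination (-sgn (q * r)) * sgn_mul_self (p * r)

theorem tensorMap_mem_homSub {f : M.carrier →ₗ[ℂ] M'.carrier} {g : N.carrier →ₗ[ℂ] N'.carrier}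
    (hf : f ∈ homSub M M') (hg : g ∈ homSub N N') :
    tensorMap f g ∈ homSub (tensor M N) (tensor M' N') := by
  refine homSub_induction (C := fun f => tensorMap f g ∈ homSub (tensor M N) (tensor M' N')) hf
    (fun a b ha hb => ?_) (fun p f hf => ?_)
  · rw [tensorMap_add_left]; exact add_mem ha hb
  · refine homSub_induction (C := fun g => tensorMap f g ∈ homSub (tensor M N) (tensor M' N')) hg
      (fun a b ha hb => ?_) (fun q g hg => ?_)
    · rw [tensorMap_add_right]; exact add_mem ha hb
    · exact homPart_le _ (tensorMap_mem_homPart hf hg)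

/-- The trivial supermodule `ℂ`, concentrated in even parity. -/
noncomputable abbrev unit : SuperModule 𝔤 where
  carrier := ℂ
  part p := if p = 0 then ⊤ else ⊥
  isCompl := by simpa using isCompl_top_bot
  act := 0
  act_mem _ _ _ _ := by simp
  act_bracket _ _ _ := by simp

/-- An even equivariant linear equivalence is an isomorphism of supermodules. -/
def mkIso (e : M.carrier ≃ₗ[ℂ] N.carrier) (he : e.toLinearMap ∈ homPart M N 0) : M ≅ N where
  hom := ⟨e.toLinearMap, homPart_le 0 he⟩
  inv := ⟨e.symm.toLinearMap, homPart_le 0 (by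
    refine ⟨fun p n hn => ?_, fun r x hx => ?_⟩
    · have h : ∀ m, N.proj p (e m) = e (M.proj p m) := by
        intro m
        induction m using SuperSpace.hom_induction with
        | hadd a b ha hb => rw [map_add, map_add, map_add, map_add, ha, hb]
        | hom q a ha =>
          have := he.1 q a ha
          rw [add_zero] at this
          have h2 := proj_of_mem_eq (q := p) this
          simp only [LinearEquiv.coe_coe] at h2
          rw [h2, proj_of_mem_eq ha]
          split_ifs <;> simp
      rw [add_zero]
      apply mem_of_proj
      apply e.injective
      change e (M.proj p (e.symm n)) = e (e.symm n)
      rw [← h, LinearEquiv.apply_symm_apply, proj_of_mem hn]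
    · ext n
      have := LinearMap.congr_fun (he.2 r x hx) (e.symm n)
      apply e.injective
      simp only [zero_mul, sgn_zero, one_smul, LinearMap.comp_apply, LinearEquiv.coe_coe,
        LinearEquiv.apply_symm_apply] at this ⊢
      exact this.symm)⟩
  hom_inv_id := Subtype.ext (LinearMap.ext fun m => e.symm_apply_apply m)
  inv_hom_id := Subtype.ext (LinearMap.ext fun m => e.apply_symm_apply m)

theorem assoc_tensorMap {M N P M' N' P' : SuperSpace} (f : M →ₗ[ℂ] M') (g : N →ₗ[ℂ] N')
    (h : P →ₗ[ℂ] P') :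
    (assoc M' N' P').toLinearMap ∘ₗ tensorMap (tensorMap f g) h =
      tensorMap f (tensorMap g h) ∘ₗ (assoc M N P).toLinearMap := by
  induction g using lin_hom_induction with
  | hadd g g' hg hg' =>
    rw [tensorMap_add_right, tensorMap_add_left, LinearMap.comp_add, hg, hg', tensorMap_add_left,
      tensorMap_add_right, LinearMap.add_comp]
  | hom q g hg =>
    induction h using lin_hom_induction with
    | hadd h h' hh hh' =>
      rw [tensorMap_add_right, LinearMap.comp_add, hh, hh', tensorMap_add_right,
        tensorMap_add_right, LinearMap.add_comp]
    | hom r h hh =>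
      refine TensorProduct.ext (TensorProduct.ext ?_)
      refine lin_ext fun a m hm => lin_ext fun b n hn => LinearMap.ext fun z => ?_
      change assoc M' N' P' (tensorMap (tensorMap f g) h ((m ⊗ₜ[ℂ] n) ⊗ₜ[ℂ] z)) =
        tensorMap f (tensorMap g h) (m ⊗ₜ[ℂ] (n ⊗ₜ[ℂ] z))
      have h1 := tensorMap_tmul (M := SuperSpace.tensor M N) (tensorMap f g) hh
        (tmul_mem_tensorPart hm hn) z
      have h2 := tensorMap_tmul (N := SuperSpace.tensor N P) (N' := SuperSpace.tensor N' P') f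
        (tensorMap_mem hg hh) hm (n ⊗ₜ[ℂ] z)
      rw [h1, h2, tensorMap_tmul f hg hm, tensorMap_tmul g hh hn]
      simp only [TensorProduct.tmul_smul, ← TensorProduct.smul_tmul', map_smul, smul_smul, ← sgn_add]
      rw [show r * (a + b) + q * a = (q + r) * a + r * b by ring]
      rfl

theorem assoc_mem_homPart : (assoc M.toSuperSpace N.toSuperSpace P.toSuperSpace).toLinearMap ∈
    homPart (tensor (tensor M N) P) (tensor M (tensor N P)) 0 := by
  refine ⟨assoc_mem, fun r x _ => ?_⟩
  change _ ∘ₗ tensorAct (tensor M N) P x = sgn _ • (tensorAct M (tensor N P) x ∘ₗ _)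
  rw [tensorAct_apply, tensorAct_apply]
  change _ ∘ₗ (tensorMap (tensorAct M N x) _ + _) = _ • ((_ + tensorMap _ (tensorAct N P x)) ∘ₗ _)
  rw [tensorAct_apply, tensorAct_apply]
  rw [tensorMap_add_left, tensorMap_add_right,
    ← tensorMap_id (M := M.toSuperSpace) (N := N.toSuperSpace),
    ← tensorMap_id (M := N.toSuperSpace) (N := P.toSuperSpace)]
  rw [LinearMap.comp_add, LinearMap.comp_add, LinearMap.add_comp, LinearMap.add_comp, zero_mul,
    sgn_zero, one_smul]
  erw [assoc_tensorMap, assoc_tensorMap, assoc_tensorMap]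
  abel

/-- The left unit isomorphism `ℂ ⊗ M ≃ M`. -/
noncomputable def lunit (M : SuperModule 𝔤) : (tensor unit M).carrier ≃ₗ[ℂ] M.carrier :=
  TensorProduct.lid ℂ M.carrier

/-- The right unit isomorphism `M ⊗ ℂ ≃ M`. -/
noncomputable def runit (M : SuperModule 𝔤) : (tensor M unit).carrier ≃ₗ[ℂ] M.carrier :=
  TensorProduct.rid ℂ M.carrier

theorem lunit_tensorMap (f : M.carrier →ₗ[ℂ] N.carrier) :
    (lunit N).toLinearMap ∘ₗ tensorMap LinearMap.id f = f ∘ₗ (lunit M).toLinearMap := by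
  induction f using lin_hom_induction with
  | hadd g g' hg hg' => rw [tensorMap_add_right, LinearMap.comp_add, hg, hg', LinearMap.add_comp]
  | hom q g hg =>
    refine TensorProduct.ext (LinearMap.ext fun (c : ℂ) => LinearMap.ext fun m => ?_)
    change lunit N (tensorMap LinearMap.id g (c ⊗ₜ[ℂ] m)) = g (lunit M (c ⊗ₜ[ℂ] m))
    rw [tensorMap_tmul (M := unit.toSuperSpace) (e := 0) _ hg (by simp)]
    simp [lunit]

theorem runit_tensorMap (f : M.carrier →ₗ[ℂ] N.carrier) :
    (runit N).toLinearMap ∘ₗ tensorMap f LinearMap.id = f ∘ₗ (runit M).toLinearMap := by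
  refine TensorProduct.ext (lin_ext fun e m hm => LinearMap.ext fun (c : ℂ) => ?_)
  change runit N (tensorMap f LinearMap.id (m ⊗ₜ[ℂ] c)) = f (runit M (m ⊗ₜ[ℂ] c))
  rw [tensorMap_tmul _ linPart_id hm]
  simp [runit]

theorem lunit_mem : (lunit M).toLinearMap ∈ homPart (tensor unit M) M 0 := by
  refine ⟨fun e x hx => ?_, fun r x _ => ?_⟩
  · refine tensorPart_induction (M := (unit : SuperModule 𝔤).toSuperSpace)
      (C := fun x => lunit M x ∈ M.part (e + 0)) hx ?_ ?_ ?_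
    · rw [map_zero]; exact zero_mem _
    · intro x y hx hy; rw [map_add]; exact add_mem hx hy
    · intro a b hab (c : ℂ) hc m hm
      change c • m ∈ _
      rcases parity_cases a with rfl | rfl
      · rw [add_zero, ← hab, zero_add]; exact Submodule.smul_mem _ _ hm
      · have : c = 0 := by simpa using hc
        rw [this, zero_smul]; exact zero_mem _
  · change _ ∘ₗ tensorAct unit M x = _
    rw [tensorAct_apply, LinearMap.comp_add, lunit_tensorMap]
    have : tensorMap ((unit : SuperModule 𝔤).act x) (LinearMap.id : M.carrier →ₗ[ℂ] M.carrier)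
        = 0 := by
      have := tensorMap_smul_left 0 ((unit : SuperModule 𝔤).act x)
        (LinearMap.id : M.carrier →ₗ[ℂ] M.carrier)
      rw [zero_smul, zero_smul] at this
      exact this
    rw [this]
    simp

theorem runit_mem : (runit M).toLinearMap ∈ homPart (tensor M unit) M 0 := by
  refine ⟨fun e x hx => ?_, fun r x _ => ?_⟩
  · refine tensorPart_induction (N := (unit : SuperModule 𝔤).toSuperSpace)
      (C := fun x => runit M x ∈ M.part (e + 0)) hx ?_ ?_ ?_
    · rw [map_zero]; exact zero_mem _
    · intro x y hx hy; rw [map_add]; exact add_mem hx hy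
    · intro a b hab m hm (c : ℂ) hc
      change c • m ∈ _
      rcases parity_cases b with rfl | rfl
      · rw [← hab]; simpa using Submodule.smul_mem _ _ hm
      · have : c = 0 := by simpa using hc
        rw [this, zero_smul]; exact zero_mem _
  · change _ ∘ₗ tensorAct M unit x = _
    rw [tensorAct_apply, LinearMap.comp_add, runit_tensorMap]
    have : tensorMap (LinearMap.id : M.carrier →ₗ[ℂ] M.carrier) ((unit : SuperModule 𝔤).act x)
        = 0 := by
      have := tensorMap_smul_right 0 (LinearMap.id : M.carrier →ₗ[ℂ] M.carrier)
        ((unit : SuperModule 𝔤).act x)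
      rw [zero_smul, zero_smul] at this
      exact this
    rw [this]
    simp

noncomputable instance : MonoidalSupercategory (SuperModule 𝔤) where
  tensorObj := tensor
  tensorUnit := unit
  tensorHom := LinearMap.mk₂ ℂ (fun f g => ⟨tensorMap f.1 g.1, tensorMap_mem_homSub f.2 g.2⟩)
    (fun f f' g => Subtype.ext (tensorMap_add_left f.1 f'.1 g.1))
    (fun c f g => Subtype.ext (tensorMap_smul_left c f.1 g.1))
    (fun f g g' => Subtype.ext (tensorMap_add_right f.1 g.1 g'.1))
    (fun c f g => Subtype.ext (tensorMap_smul_right c f.1 g.1))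
  tensorHom_mem hf hg := tensorMap_mem_homPart hf hg
  tensorHom_id _ _ := Subtype.ext tensorMap_id
  tensorHom_comp h f k g hg hh := Subtype.ext (tensorMap_comp f.1 k.1 hg.1 hh.1)
  associator _ _ _ := mkIso _ assoc_mem_homPart
  leftUnitor _ := mkIso _ lunit_mem
  rightUnitor _ := mkIso _ runit_mem
  associator_mem _ _ _ := assoc_mem_homPart
  leftUnitor_mem _ := lunit_mem
  rightUnitor_mem _ := runit_mem
  associator_naturality f g h := Subtype.ext (assoc_tensorMap f.1 g.1 h.1)
  leftUnitor_naturality f := Subtype.ext (lunit_tensorMap f.1)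
  rightUnitor_naturality f := Subtype.ext (runit_tensorMap f.1)
  pentagon W X Y Z := by
    refine Subtype.ext (TensorProduct.ext (TensorProduct.ext (TensorProduct.ext ?_)))
    refine lin_ext fun a w hw => lin_ext fun b x hx => lin_ext fun c y hy => LinearMap.ext fun z => ?_
    have h1 := tensorMap_tmul (M := (tensor (tensor W X) Y).toSuperSpace) (N := Z.toSuperSpace)
      (assoc W.toSuperSpace X.toSuperSpace Y.toSuperSpace).toLinearMap linPart_id
      (tmul_mem_tensorPart (tmul_mem_tensorPart hw hx) hy) z
    have h2 := tensorMap_tmul (M := W.toSuperSpace) (N := (tensor (tensor X Y) Z).toSuperSpace)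
      LinearMap.id assoc_mem hw ((x ⊗ₜ[ℂ] y) ⊗ₜ[ℂ] z)
    rw [zero_mul, sgn_zero, one_smul] at h1 h2
    refine Eq.trans (congrArg (fun t => tensorMap LinearMap.id (assoc X.toSuperSpace Y.toSuperSpace
      Z.toSuperSpace).toLinearMap (assoc W.toSuperSpace (tensor X Y).toSuperSpace
      Z.toSuperSpace t)) h1) (Eq.trans h2 rfl)
  triangle X Y := by
    refine Subtype.ext (TensorProduct.ext (TensorProduct.ext ?_))
    refine lin_ext fun a x hx => LinearMap.ext fun (c : ℂ) => LinearMap.ext fun y => ?_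
    have h1 := tensorMap_tmul (M := X.toSuperSpace) (N := (tensor unit Y).toSuperSpace)
      LinearMap.id (lunit_mem (M := Y)).1 hx (c ⊗ₜ[ℂ] y)
    have h2 := tensorMap_tmul (M := (tensor X unit).toSuperSpace) (N := Y.toSuperSpace)
      (runit X).toLinearMap linPart_id (tmul_mem_tensorPart hx (d := 0) (n := c) (by simp)) y
    rw [zero_mul, sgn_zero, one_smul] at h1 h2
    refine Eq.trans h1 (Eq.trans ?_ h2.symm)
    exact (TensorProduct.smul_tmul c x y).symm

end SuperModule

/-! ### Symmetric powers -/

namespace SuperModule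

open SuperSpace

section Quotient

variable {𝔤 : LieSuperalgebra} {M N : SuperModule 𝔤}

/-- Graded subspaces that are stable under the action. -/
structure IsSub (R : Submodule ℂ M.carrier) : Prop where
  proj_mem : ∀ (p : ZMod 2), ∀ m ∈ R, M.proj p m ∈ R
  act_mem : ∀ (p : ZMod 2), ∀ x ∈ 𝔤.part p, ∀ m ∈ R, M.act x m ∈ R

theorem IsSub.act_mem' {R : Submodule ℂ M.carrier} (hR : IsSub R) (x : 𝔤.carrier) :
    R ≤ R.comap (M.act x) := by
  intro m hm
  induction x using SuperSpace.hom_induction (M := 𝔤.toSuperSpace) with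
  | hadd x y hx hy =>
    rw [Submodule.mem_comap, map_add, LinearMap.add_apply]
    exact add_mem hx hy
  | hom p x hx => exact hR.act_mem p x hx m hm

/-- The quotient of a supermodule by a sub-supermodule. -/
noncomputable def quot (M : SuperModule 𝔤) (R : Submodule ℂ M.carrier) (hR : IsSub R) :
    SuperModule 𝔤 where
  carrier := M.carrier ⧸ R
  part p := (M.part p).map R.mkQ
  isCompl := by
    refine isCompl_of_proj (fun p => (M.part p).map R.mkQ)
      (fun p => R.mapQ R (M.proj p) (hR.proj_mem p)) ?_ ?_ ?_ ?_
    · intro p x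
      obtain ⟨m, rfl⟩ := R.mkQ_surjective x
      exact ⟨M.proj p m, SuperSpace.proj_mem p m, rfl⟩
    · intro x
      obtain ⟨m, rfl⟩ := R.mkQ_surjective x
      change R.mkQ (M.proj 0 m) + R.mkQ (M.proj 1 m) = R.mkQ m
      rw [← map_add, proj_add_proj]
    · rintro _ ⟨m, hm, rfl⟩
      change R.mkQ (M.proj 0 m) = 0
      rw [proj_of_mem_ne (by decide) hm, map_zero]
    · rintro _ ⟨m, hm, rfl⟩
      change R.mkQ (M.proj 0 m) = _
      rw [proj_of_mem hm]
  act :=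
    { toFun := fun x => R.mapQ R (M.act x) (hR.act_mem' x)
      map_add' := by
        intro x y
        apply Submodule.linearMap_qext
        ext m
        change R.mkQ (M.act (x + y) m) = R.mkQ (M.act x m) + R.mkQ (M.act y m)
        rw [map_add, LinearMap.add_apply, map_add]
      map_smul' := by
        intro c x
        apply Submodule.linearMap_qext
        ext m
        change R.mkQ (M.act (c • x) m) = c • R.mkQ (M.act x m)
        rw [map_smul, LinearMap.smul_apply, map_smul] }
  act_mem := by
    rintro p x hx e _ ⟨m, hm, rfl⟩
    exact ⟨M.act x m, M.act_mem hx hm, rfl⟩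
  act_bracket := by
    intro p q x y hx hy m
    obtain ⟨m, rfl⟩ := R.mkQ_surjective m
    change R.mkQ (M.act (𝔤.bracket x y) m) =
      R.mkQ (M.act x (M.act y m)) - sgn (p * q) • R.mkQ (M.act y (M.act x m))
    rw [M.act_bracket hx hy, map_sub, map_smul]

theorem isSub_bot : IsSub (⊥ : Submodule ℂ M.carrier) where
  proj_mem p m hm := by
    rw [Submodule.mem_bot] at hm ⊢
    rw [hm, map_zero]
  act_mem p x _ m hm := by
    rw [Submodule.mem_bot] at hm ⊢
    rw [hm, map_zero]

theorem isSub_sup {R S : Submodule ℂ M.carrier} (hR : IsSub R) (hS : IsSub S) :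
    IsSub (R ⊔ S) where
  proj_mem p m hm := by
    obtain ⟨a, ha, b, hb, rfl⟩ := Submodule.mem_sup.1 hm
    rw [map_add]
    exact Submodule.add_mem_sup (hR.proj_mem p a ha) (hS.proj_mem p b hb)
  act_mem p x hx m hm := by
    obtain ⟨a, ha, b, hb, rfl⟩ := Submodule.mem_sup.1 hm
    rw [map_add]
    exact Submodule.add_mem_sup (hR.act_mem p x hx a ha) (hS.act_mem p x hx b hb)

/-- A span of homogeneous elements that the action preserves is a sub-supermodule. -/
theorem isSub_span {S : Set M.carrier} (h : ∀ s ∈ S, ∃ p, s ∈ M.part p)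
    (h' : ∀ p, ∀ x ∈ 𝔤.part p, ∀ s ∈ S, M.act x s ∈ Submodule.span ℂ S) :
    IsSub (Submodule.span ℂ S) where
  proj_mem p m hm := by
    have : Submodule.span ℂ S ≤ (Submodule.span ℂ S).comap (M.proj p) := by
      rw [Submodule.span_le]
      intro s hs
      obtain ⟨q, hq⟩ := h s hs
      rw [SetLike.mem_coe, Submodule.mem_comap, proj_of_mem_eq hq]
      split_ifs
      · exact Submodule.subset_span hs
      · exact zero_mem _
    exact this hm
  act_mem p x hx m hm := by
    have : Submodule.span ℂ S ≤ (Submodule.span ℂ S).comap (M.act x) := by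
      rw [Submodule.span_le]
      intro s hs
      exact h' p x hx s hs
    exact this hm

/-- The relations `m ⊗ m' ⊗ t = (-1)^(|m||m'|) m' ⊗ m ⊗ t`. -/
def swapSet (M N : SuperModule 𝔤) : Set (tensor M (tensor M N)).carrier :=
  {z | ∃ e d c, ∃ m ∈ M.part e, ∃ m' ∈ M.part d, ∃ t ∈ N.part c,
    z = m ⊗ₜ[ℂ] (m' ⊗ₜ[ℂ] t) - sgn (e * d) • (m' ⊗ₜ[ℂ] (m ⊗ₜ[ℂ] t))}

theorem isSub_swap : IsSub (Submodule.span ℂ (swapSet M N)) := by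
  refine isSub_span ?_ ?_
  · rintro _ ⟨e, d, c, m, hm, m', hm', t, ht, rfl⟩
    refine ⟨e + (d + c), sub_mem (tmul_mem_tensorPart hm (tmul_mem_tensorPart hm' ht))
      (Submodule.smul_mem _ _ ?_)⟩
    rw [show e + (d + c) = d + (e + c) by ring]
    exact tmul_mem_tensorPart hm' (tmul_mem_tensorPart hm ht)
  · rintro p x hx _ ⟨e, d, c, m, hm, m', hm', t, ht, rfl⟩
    have key : ∀ (e d : ZMod 2) (m m' : M.carrier), m ∈ M.part e → m' ∈ M.part d →
        (tensor M (tensor M N)).act x (m ⊗ₜ[ℂ] (m' ⊗ₜ[ℂ] t)) =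
          M.act x m ⊗ₜ[ℂ] (m' ⊗ₜ[ℂ] t) + (sgn (p * e) • (m ⊗ₜ[ℂ] (M.act x m' ⊗ₜ[ℂ] t)) +
            sgn (p * (e + d)) • (m ⊗ₜ[ℂ] (m' ⊗ₜ[ℂ] N.act x t))) := by
      intro e d m m' hm hm'
      have h1 := tensorAct_tmul (N := tensor M N) hx hm (m' ⊗ₜ[ℂ] t)
      have h2 := tensorAct_tmul (N := N) hx hm' t
      refine h1.trans ?_
      change _ + _ • (m ⊗ₜ[ℂ] (tensorAct M N x (m' ⊗ₜ[ℂ] t))) = _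
      rw [h2, TensorProduct.tmul_add, TensorProduct.tmul_smul, smul_add, smul_smul, mul_add,
        sgn_add]
    rw [map_sub, map_smul, key e d m m' hm hm', key d e m' m hm' hm]
    have g1 := Submodule.subset_span (R := ℂ) (s := swapSet M N)
      ⟨_, _, _, _, M.act_mem hx hm, _, hm', _, ht, rfl⟩
    have g2 := Submodule.subset_span (R := ℂ) (s := swapSet M N)
      ⟨_, _, _, _, hm, _, M.act_mem hx hm', _, ht, rfl⟩
    have g3 := Submodule.subset_span (R := ℂ) (s := swapSet M N)
      ⟨_, _, _, _, hm, _, hm', _, N.act_mem hx ht, rfl⟩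
    convert add_mem g1 (add_mem (Submodule.smul_mem _ (sgn (p * e)) g2)
      (Submodule.smul_mem _ (sgn (p * (e + d))) g3)) using 1
    have s1 : sgn ((e + p) * d) = sgn (e * d) * sgn (p * d) := by rw [add_mul, sgn_add]
    have s2 : sgn (e * (d + p)) = sgn (e * d) * sgn (p * e) := by
      rw [mul_add, sgn_add, mul_comm e p]
    have s3 : sgn (p * (d + e)) = sgn (p * (e + d)) := by rw [add_comm]
    have s4 := sgn_mul_self (p * e)
    rw [s1, s2, s3]
    have s5 : sgn (e * d) • (M.act x m' ⊗ₜ[ℂ] (m ⊗ₜ[ℂ] t)) =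
      sgn (p * e) • (sgn (e * d) * sgn (p * e)) • (M.act x m' ⊗ₜ[ℂ] (m ⊗ₜ[ℂ] t)) := by
      rw [smul_smul, mul_left_comm, s4, mul_one]
    rw [smul_add, smul_sub, ← s5]
    module

theorem isSub_tensor {R : Submodule ℂ N.carrier} (hR : IsSub R) :
    IsSub (M := tensor M N) (Submodule.map₂ (TensorProduct.mk ℂ M.carrier N.carrier) ⊤ R) := by
  have h0 : Submodule.map₂ (TensorProduct.mk ℂ M.carrier N.carrier) ⊤ R =
      Submodule.span ℂ {z | ∃ e d, ∃ m ∈ M.part e, ∃ t ∈ N.part d, t ∈ R ∧ z = m ⊗ₜ[ℂ] t} := by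
    apply le_antisymm
    · rw [Submodule.map₂_le]
      intro m _ t ht
      change m ⊗ₜ[ℂ] t ∈ _
      rw [← proj_add_proj (M := M.toSuperSpace) m, ← proj_add_proj (M := N.toSuperSpace) t,
        TensorProduct.add_tmul, TensorProduct.tmul_add, TensorProduct.tmul_add]
      have : ∀ a b, M.proj a m ⊗ₜ[ℂ] N.proj b t ∈ Submodule.span ℂ
          {z | ∃ e d, ∃ m ∈ M.part e, ∃ t ∈ N.part d, t ∈ R ∧ z = m ⊗ₜ[ℂ] t} := fun a b =>
        Submodule.subset_span ⟨a, b, _, SuperSpace.proj_mem _ _, _, SuperSpace.proj_mem _ _,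
          hR.proj_mem b t ht, rfl⟩
      exact add_mem (add_mem (this _ _) (this _ _)) (add_mem (this _ _) (this _ _))
    · rw [Submodule.span_le]
      rintro _ ⟨e, d, m, _, t, _, ht, rfl⟩
      exact Submodule.apply_mem_map₂ (TensorProduct.mk ℂ M.carrier N.carrier) trivial ht
  rw [h0]
  refine isSub_span ?_ ?_
  · rintro _ ⟨e, d, m, hm, t, ht, _, rfl⟩
    exact ⟨e + d, tmul_mem_tensorPart hm ht⟩
  · rintro p x hx _ ⟨e, d, m, hm, t, ht, htR, rfl⟩
    change tensorAct M N x (m ⊗ₜ[ℂ] t) ∈ _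
    rw [tensorAct_tmul hx hm]
    refine add_mem (Submodule.subset_span ⟨_, _, _, M.act_mem hx hm, _, ht, htR, rfl⟩)
      (Submodule.smul_mem _ _ (Submodule.subset_span
        ⟨_, _, _, hm, _, N.act_mem hx ht, hR.act_mem p x hx t htR, rfl⟩))

end Quotient

variable {𝔤 : LieSuperalgebra} (M : SuperModule 𝔤)

/-- Tensor powers: `M^(⊗ 0) = ℂ` and `M^(⊗ (k+1)) = M ⊗ M^(⊗ k)`. -/
noncomputable def tpow : ℕ → SuperModule 𝔤
  | 0 => unit
  | k + 1 => tensor M (tpow k)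

/-- The element `v₁ ⊗ ⋯ ⊗ v_k` of the tensor power. -/
noncomputable def tprod : (k : ℕ) → (Fin k → M.carrier) → (tpow M k).carrier
  | 0, _ => (1 : ℂ)
  | k + 1, v => v 0 ⊗ₜ[ℂ] tprod k fun i => v i.succ

/-- The component of degree `k` of the two-sided ideal of the tensor superalgebra of `M`
generated by the elements `m ⊗ m' - (-1)^(|m||m'|) m' ⊗ m`. -/
noncomputable def symRel : (k : ℕ) → Submodule ℂ (tpow M k).carrier
  | 0 => ⊥
  | 1 => ⊥
  | k + 2 =>
    (Submodule.span ℂ (swapSet M (tpow M k)) ⊔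
      Submodule.map₂ (TensorProduct.mk ℂ M.carrier (tpow M (k + 1)).carrier) ⊤ (symRel (k + 1)) :
      Submodule ℂ (tensor M (tpow M (k + 1))).carrier)

theorem isSub_symRel : ∀ k : ℕ, IsSub (symRel M k)
  | 0 => isSub_bot
  | 1 => isSub_bot
  | k + 2 => isSub_sup (M := tensor M (tpow M (k + 1))) isSub_swap
      (isSub_tensor (isSub_symRel (k + 1)))

/-- The supersymmetric power `S^k(M)`. -/
noncomputable def symPow (k : ℕ) : SuperModule 𝔤 := quot (tpow M k) (symRel M k) (isSub_symRel M k)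

/-- The product `v₁ v₂ ⋯ v_k` in `S^k(M)`. -/
noncomputable def symProd {k : ℕ} (v : Fin k → M.carrier) : (symPow M k).carrier :=
  (symRel M k).mkQ (tprod M k v)

end SuperModule

/-! ### The Lie superalgebra `q(n)` -/

/-- The matrix with block rows `(A B)` and `(B A)`. -/
def qMatrix (n : ℕ) : (Matrix (Fin n) (Fin n) ℂ × Matrix (Fin n) (Fin n) ℂ) →ₗ[ℂ]
    Matrix (Fin n ⊕ Fin n) (Fin n ⊕ Fin n) ℂ where
  toFun x := Matrix.fromBlocks x.1 x.2 x.2 x.1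
  map_add' x y := by rw [Matrix.fromBlocks_add]; rfl
  map_smul' c x := by rw [Matrix.fromBlocks_smul]; rfl

/-- The graded commutator on `q(n)`; the pair `(A, B)` stands for the matrix `qMatrix n (A, B)`. -/
noncomputable def qBracket (n : ℕ) :
    (Matrix (Fin n) (Fin n) ℂ × Matrix (Fin n) (Fin n) ℂ) →ₗ[ℂ]
    (Matrix (Fin n) (Fin n) ℂ × Matrix (Fin n) (Fin n) ℂ) →ₗ[ℂ]
    (Matrix (Fin n) (Fin n) ℂ × Matrix (Fin n) (Fin n) ℂ) :=
  LinearMap.mk₂ ℂ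
    (fun x y => ((x.1 * y.1 - y.1 * x.1) + (x.2 * y.2 + y.2 * x.2),
      (x.1 * y.2 - y.2 * x.1) + (x.2 * y.1 - y.1 * x.2)))
    (fun x x' y => by ext1 <;> simp <;> noncomm_ring)
    (fun c x y => by ext1 <;> simp <;> module)
    (fun x y y' => by ext1 <;> simp <;> noncomm_ring)
    (fun c x y => by ext1 <;> simp <;> module)

theorem qBracket_apply (n : ℕ) (x y : Matrix (Fin n) (Fin n) ℂ × Matrix (Fin n) (Fin n) ℂ) :
    qBracket n x y = ((x.1 * y.1 - y.1 * x.1) + (x.2 * y.2 + y.2 * x.2),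
      (x.1 * y.2 - y.2 * x.1) + (x.2 * y.1 - y.1 * x.2)) := rfl

/-- The Lie superalgebra `q(n)`. The pair `(A, B)` stands for the matrix `qMatrix n (A, B)`;
the bracket is the graded commutator of these matrices, see `qLie_bracket`. -/
noncomputable def qLie (n : ℕ) : LieSuperalgebra where
  carrier := Matrix (Fin n) (Fin n) ℂ × Matrix (Fin n) (Fin n) ℂ
  part p := if p = 0 then Submodule.prod ⊤ ⊥ else Submodule.prod ⊥ ⊤
  isCompl := by
    simp only [if_true, one_ne_zero, if_false]
    constructor
    · rw [Submodule.disjoint_def]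
      rintro ⟨a, b⟩ ⟨_, h⟩ ⟨h', _⟩
      exact Prod.ext h' h
    · rw [codisjoint_iff, Submodule.prod_sup_prod]
      simp
  bracket := qBracket n
  bracket_mem := by
    rintro p q ⟨a, b⟩ ⟨a', b'⟩ hx hy
    rcases parity_cases p with rfl | rfl <;> rcases parity_cases q with rfl | rfl <;>
      simp_all [show (1 : ZMod 2) + 1 = 0 by decide, qBracket_apply]
  bracket_skew := by
    rintro p q ⟨a, b⟩ ⟨a', b'⟩ hx hy
    rcases parity_cases p with rfl | rfl <;> rcases parity_cases q with rfl | rfl <;>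
      simp_all [add_comm, qBracket_apply]
  jacobi := by
    rintro p q ⟨a, b⟩ ⟨a', b'⟩ ⟨a'', b''⟩ hx hy
    rcases parity_cases p with rfl | rfl <;> rcases parity_cases q with rfl | rfl <;>
      simp_all [qBracket_apply] <;> constructor <;> noncomm_ring

theorem qLie_cases {n : ℕ} {p : ZMod 2} {a b : Matrix (Fin n) (Fin n) ℂ}
    (h : (a, b) ∈ (if p = 0 then Submodule.prod ⊤ ⊥ else Submodule.prod ⊥ ⊤ :
      Submodule ℂ (Matrix (Fin n) (Fin n) ℂ × Matrix (Fin n) (Fin n) ℂ))) :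
    (p = 0 ∧ b = 0) ∨ (p = 1 ∧ a = 0) := by
  rcases parity_cases p with rfl | rfl <;> simp_all

theorem qLie_bracket (n : ℕ) {p q : ZMod 2} {x y : (qLie n).carrier} (hx : x ∈ (qLie n).part p)
    (hy : y ∈ (qLie n).part q) :
    qMatrix n ((qLie n).bracket x y) =
      qMatrix n x * qMatrix n y - sgn (p * q) • (qMatrix n y * qMatrix n x) := by
  obtain ⟨a, b⟩ := x
  obtain ⟨a', b'⟩ := y
  change qMatrix n (qBracket n (a, b) (a', b')) = _
  rw [qBracket_apply]
  rcases qLie_cases hx with ⟨rfl, rfl⟩ | ⟨rfl, rfl⟩ <;>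
  rcases qLie_cases hy with ⟨rfl, rfl⟩ | ⟨rfl, rfl⟩ <;>
    simp [qMatrix, Matrix.fromBlocks_multiply, sub_eq_add_neg, Matrix.fromBlocks_neg,
      Matrix.fromBlocks_add]

/-- The natural supermodule `V_n` of `q(n)`, with basis `v_i` (`Sum.inl i`, even) and
`v_(i bar)` (`Sum.inr i`, odd), on which `q(n)` acts by matrix multiplication. -/
noncomputable def qNatural (n : ℕ) : SuperModule (qLie n) where
  carrier := Fin n ⊕ Fin n → ℂ
  part p := if p = 0 then LinearMap.ker (LinearMap.funLeft ℂ ℂ Sum.inr)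
    else LinearMap.ker (LinearMap.funLeft ℂ ℂ Sum.inl)
  isCompl := by
    simp only [if_true, one_ne_zero, if_false]
    constructor
    · rw [Submodule.disjoint_def]
      intro f h0 h1
      ext i
      rcases i with i | i
      · exact congrFun h1 i
      · exact congrFun h0 i
    · rw [codisjoint_iff, Submodule.eq_top_iff']
      intro f
      refine Submodule.mem_sup.2 ⟨Sum.elim (fun i => f (Sum.inl i)) 0, ?_,
        Sum.elim 0 (fun i => f (Sum.inr i)), ?_, ?_⟩
      · ext i; rfl
      · ext i; rfl
      · ext i; rcases i with i | i <;> simp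
  act := Matrix.toLin'.toLinearMap ∘ₗ qMatrix n
  act_mem := by
    rintro p ⟨a, b⟩ hx e m hm
    have h : Matrix.toLin' (qMatrix n (a, b)) m =
        Sum.elim (a.mulVec (m ∘ Sum.inl) + b.mulVec (m ∘ Sum.inr))
          (b.mulVec (m ∘ Sum.inl) + a.mulVec (m ∘ Sum.inr)) := by
      rw [Matrix.toLin'_apply]
      exact Matrix.fromBlocks_mulVec _ _ _ _ _
    change Matrix.toLin' (qMatrix n (a, b)) m ∈ _
    rw [h]
    rcases qLie_cases hx with ⟨rfl, rfl⟩ | ⟨rfl, rfl⟩ <;> rcases parity_cases e with rfl | rfl <;>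
      simp_all [LinearMap.funLeft, show (1 : ZMod 2) + 1 = 0 by decide]
  act_bracket := by
    intro p q x y hx hy m
    change Matrix.toLin' (qMatrix n ((qLie n).bracket x y)) m = _
    rw [qLie_bracket n hx hy, map_sub, map_smul, Matrix.toLin'_mul, Matrix.toLin'_mul]
    rfl

/-- The odd operator `c` on `V_n` with `c(v_i) = √-1 v_(i bar)` and
`c(v_(i bar)) = -√-1 v_i`. -/
noncomputable def cliffordC (n : ℕ) : (Fin n ⊕ Fin n → ℂ) →ₗ[ℂ] (Fin n ⊕ Fin n → ℂ) where
  toFun f := Sum.elim (fun i => -Complex.I * f (Sum.inr i)) (fun i => Complex.I * f (Sum.inl i))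
  map_add' f g := by
    ext i
    rcases i with i | i <;> exact mul_add _ _ _
  map_smul' c f := by
    ext i
    rcases i with i | i <;> exact mul_left_comm _ _ _

/-! ### The category generated by the supersymmetric powers -/

/-- The class of tensor products of the `S^p(V_n)`, `p ≥ 0`, including the empty product. -/
inductive TensorGenerated (n : ℕ) : SuperModule (qLie n) → Prop
  | sym (p : ℕ) : TensorGenerated n (SuperModule.symPow (qNatural n) p)
  | unit : TensorGenerated n SuperModule.unit
  | tensor {M N : SuperModule (qLie n)} : TensorGenerated n M → TensorGenerated n N →
      TensorGenerated n (SuperModule.tensor M N)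

/-- The full subcategory on the objects with property `P`. -/
def FullSub.{u} {C : Type u} (P : C → Prop) : Type u := {X : C // P X}

namespace FullSub

universe v u

variable {C : Type u} [Category.{v} C] (P : C → Prop)

instance : Category.{v} (FullSub P) where
  Hom X Y := X.1 ⟶ Y.1
  id X := 𝟙 X.1
  comp f g := CategoryStruct.comp (obj := C) f g
  id_comp f := Category.id_comp (obj := C) f
  comp_id f := Category.comp_id (obj := C) f
  assoc f g h := Category.assoc (obj := C) f g h

instance [Preadditive C] : Preadditive (FullSub P) where
  homGroup X Y := inferInstanceAs (AddCommGroup (X.1 ⟶ Y.1))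
  add_comp X Y Z f f' g := Preadditive.add_comp X.1 Y.1 Z.1 f f' g
  comp_add X Y Z f g g' := Preadditive.comp_add X.1 Y.1 Z.1 f g g'

instance [Preadditive C] [Linear ℂ C] : Linear ℂ (FullSub P) where
  homModule X Y := inferInstanceAs (Module ℂ (X.1 ⟶ Y.1))
  smul_comp X Y Z r f g := Linear.smul_comp X.1 Y.1 Z.1 r f g
  comp_smul X Y Z f r g := Linear.comp_smul X.1 Y.1 Z.1 f r g

/-- An isomorphism of `C`, as an isomorphism of the full subcategory. -/
def isoMk {X Y : FullSub P} (i : X.1 ≅ Y.1) : X ≅ Y where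
  hom := i.hom
  inv := i.inv
  hom_inv_id := i.hom_inv_id
  inv_hom_id := i.inv_hom_id

/-- A full subcategory that contains the unit and is closed under tensor products is a monoidal
supercategory. -/
abbrev monoidalSupercategory [Preadditive C] [Linear ℂ C] [MonoidalSupercategory C]
    (hunit : P tensorUnit) (htensor : ∀ {X Y : C}, P X → P Y → P (tensorObj X Y)) :
    MonoidalSupercategory (FullSub P) where
  homPart X Y := homPart X.1 Y.1
  isCompl_homPart X Y := isCompl_homPart X.1 Y.1
  id_mem X := id_mem X.1
  comp_mem {X Y Z _ _ _ _} hf hg := comp_mem (X := X.1) (Y := Y.1) (Z := Z.1) hf hg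
  tensorObj X Y := ⟨tensorObj X.1 Y.1, htensor X.2 Y.2⟩
  tensorUnit := ⟨tensorUnit, hunit⟩
  tensorHom {X Y X' Y'} := tensorHom (X := X.1) (Y := Y.1) (X' := X'.1) (Y' := Y'.1)
  tensorHom_mem {X Y X' Y' _ _ _ _} hf hg :=
    tensorHom_mem (X := X.1) (Y := Y.1) (X' := X'.1) (Y' := Y'.1) hf hg
  tensorHom_id X Y := tensorHom_id X.1 Y.1
  tensorHom_comp {X Y Z X' Y' Z' _ _} h f k g hg hh := tensorHom_comp (X := X.1) (Y := Y.1)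
    (Z := Z.1) (X' := X'.1) (Y' := Y'.1) (Z' := Z'.1) h f k g hg hh
  associator X Y Z := isoMk P (associator X.1 Y.1 Z.1)
  leftUnitor X := isoMk P (leftUnitor X.1)
  rightUnitor X := isoMk P (rightUnitor X.1)
  associator_mem X Y Z := associator_mem X.1 Y.1 Z.1
  leftUnitor_mem X := leftUnitor_mem X.1
  rightUnitor_mem X := rightUnitor_mem X.1
  associator_naturality {X Y Z X' Y' Z'} f g h := associator_naturality (X := X.1) (Y := Y.1)
    (Z := Z.1) (X' := X'.1) (Y' := Y'.1) (Z' := Z'.1) f g h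
  leftUnitor_naturality {X Y} f := leftUnitor_naturality (X := X.1) (Y := Y.1) f
  rightUnitor_naturality {X Y} f := rightUnitor_naturality (X := X.1) (Y := Y.1) f
  pentagon W X Y Z := pentagon W.1 X.1 Y.1 Z.1
  triangle X Y := triangle X.1 Y.1

end FullSub

/-- The full monoidal subsupercategory `q(n)-Mod_S` of `q(n)`-supermodules tensor generated by
the `S^p(V_n)`, `p ≥ 0`. -/
abbrev QModS (n : ℕ) : Type 1 := FullSub (TensorGenerated n)

namespace QModS

noncomputable instance (n : ℕ) : MonoidalSupercategory (QModS n) :=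
  FullSub.monoidalSupercategory (TensorGenerated n) .unit .tensor

variable {n : ℕ}

/-- The linear map underlying a morphism. -/
def toLin {X Y : QModS n} (f : X ⟶ Y) : X.1.carrier →ₗ[ℂ] Y.1.carrier :=
  f.1

/-- The object `S^k(V_n)`. -/
noncomputable def sym (n k : ℕ) : QModS n := ⟨SuperModule.symPow (qNatural n) k, .sym k⟩

/-- The product `v₁ v₂ ⋯ v_k` in `S^k(V_n)`. -/
noncomputable def prod {k : ℕ} (v : Fin k → Fin n ⊕ Fin n → ℂ) : (sym n k).1.carrier :=
  SuperModule.symProd (qNatural n) v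

/-- The object `S^(a₁)(V_n) ⊗ ⋯ ⊗ S^(a_t)(V_n)`, bracketed to the right. -/
noncomputable def symTensor (n : ℕ) : List ℕ → QModS n
  | [] => tensorUnit
  | [k] => sym n k
  | k :: l :: a => tensorObj (sym n k) (symTensor n (l :: a))

/-- The canonical rebracketing map
`(S^(a₁) ⊗ ⋯ ⊗ S^(a_s)) ⊗ (S^(b₁) ⊗ ⋯ ⊗ S^(b_t)) → S^(a₁) ⊗ ⋯ ⊗ S^(a_s) ⊗ S^(b₁) ⊗ ⋯ ⊗ S^(b_t)`. -/
noncomputable def rebracket (n : ℕ) : (a b : List ℕ) →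
    (tensorObj (symTensor n a) (symTensor n b) ⟶ symTensor n (a ++ b))
  | [], b => (leftUnitor (symTensor n b)).hom
  | [k], [] => (rightUnitor (sym n k)).hom
  | [k], l :: b => 𝟙 (tensorObj (sym n k) (symTensor n (l :: b)))
  | k :: l :: a, b =>
    (MonoidalSupercategory.associator (sym n k) (symTensor n (l :: a)) (symTensor n b)).hom ≫
      tensorHom (𝟙 (sym n k)) (rebracket n (l :: a) b)

end QModS

/-! ### Upward webs of type Q -/

/-- Expressions for (linear combinations of) webs from the word `↑_(a₁) ⋯ ↑_(a_s)` to the word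
`↑_(b₁) ⋯ ↑_(b_t)`, where words are encoded by the lists of their labels. `comp f g` stands for
`g` stacked on top of `f`, `tensor f g` for `f` to the left of `g`. The expressions
`erase : ↑_0 → 𝟙` and `create : 𝟙 → ↑_0` erase and insert an edge labelled by zero. -/
inductive WebExpr : List ℕ → List ℕ → Type
  | id (a : List ℕ) : WebExpr a a
  | comp {a b c : List ℕ} : WebExpr a b → WebExpr b c → WebExpr a c
  | tensor {a b c d : List ℕ} : WebExpr a b → WebExpr c d → WebExpr (a ++ c) (b ++ d)
  | zero (a b : List ℕ) : WebExpr a b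
  | add {a b : List ℕ} : WebExpr a b → WebExpr a b → WebExpr a b
  | smul {a b : List ℕ} : ℂ → WebExpr a b → WebExpr a b
  | dot (k : ℕ) : WebExpr [k] [k]
  | merge (k l m : ℕ) (h : k + l = m) : WebExpr [k, l] [m]
  | split (k l m : ℕ) (h : k + l = m) : WebExpr [m] [k, l]
  | erase : WebExpr [0] []
  | create : WebExpr [] [0]

namespace WebExpr

/-- The identity of `a`, viewed as an expression from `a` to `b = a`. -/
def cast {a b : List ℕ} (h : a = b) : WebExpr a b := h ▸ id a

/-- The difference of two expressions. -/
def sub {a b : List ℕ} (f g : WebExpr a b) : WebExpr a b := add f (smul (-1) g)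

/-- `HasParity p f`: the expression `f` is homogeneous of parity `p`. Dots are odd, all other
generators are even. -/
inductive HasParity : ZMod 2 → {a b : List ℕ} → WebExpr a b → Prop
  | id (a : List ℕ) : HasParity 0 (id a)
  | comp {p q : ZMod 2} {a b c : List ℕ} {f : WebExpr a b} {g : WebExpr b c} :
      HasParity p f → HasParity q g → HasParity (p + q) (comp f g)
  | tensor {p q : ZMod 2} {a b c d : List ℕ} {f : WebExpr a b} {g : WebExpr c d} :
      HasParity p f → HasParity q g → HasParity (p + q) (tensor f g)
  | zero (p : ZMod 2) (a b : List ℕ) : HasParity p (zero a b)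
  | add {p : ZMod 2} {a b : List ℕ} {f g : WebExpr a b} :
      HasParity p f → HasParity p g → HasParity p (add f g)
  | smul {p : ZMod 2} {a b : List ℕ} (c : ℂ) {f : WebExpr a b} :
      HasParity p f → HasParity p (smul c f)
  | dot (k : ℕ) : HasParity 1 (dot k)
  | merge (k l m : ℕ) (h : k + l = m) : HasParity 0 (merge k l m h)
  | split (k l m : ℕ) (h : k + l = m) : HasParity 0 (split k l m h)
  | erase : HasParity 0 erase
  | create : HasParity 0 create

/-- The ladder `↑_k ↑_(l+1) → ↑_(k+1) ↑_l` with one rung of label `1`, pointing left and carrying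
the decoration `x` (the identity of `↑_1` or a dot). -/
def ladderLeft (x : WebExpr [1] [1]) (k l : ℕ) : WebExpr [k, l + 1] [k + 1, l] :=
  comp (b := [k, 1, l]) (tensor (id [k]) (split 1 l (l + 1) (Nat.add_comm 1 l)))
    (comp (b := [k, 1, l]) (tensor (id [k]) (tensor x (id [l])))
      (tensor (merge k 1 (k + 1) rfl) (id [l])))

/-- The ladder `↑_(k+1) ↑_l → ↑_k ↑_(l+1)` with one rung of label `1`, pointing right and carrying
the decoration `x` (the identity of `↑_1` or a dot). -/
def ladderRight (x : WebExpr [1] [1]) (k l : ℕ) : WebExpr [k + 1, l] [k, l + 1] :=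
  comp (b := [k, 1, l]) (tensor (split k 1 (k + 1) rfl) (id [l]))
    (comp (b := [k, 1, l]) (tensor (id [k]) (tensor x (id [l])))
      (tensor (id [k]) (merge 1 l (l + 1) (Nat.add_comm 1 l))))

/-- A rung `x` pointing right below a rung `y` pointing left on `↑_k ↑_l`; it is zero if it has
an edge with a negative label. -/
def ladderRightLeft (x y : WebExpr [1] [1]) : (k l : ℕ) → WebExpr [k, l] [k, l]
  | 0, l => zero [0, l] [0, l]
  | k + 1, l => comp (ladderRight x k l) (ladderLeft y k l)

/-- A rung `x` pointing left below a rung `y` pointing right on `↑_k ↑_l`; it is zero if it has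
an edge with a negative label. -/
def ladderLeftRight (x y : WebExpr [1] [1]) : (k l : ℕ) → WebExpr [k, l] [k, l]
  | k, 0 => zero [k, 0] [k, 0]
  | k, l + 1 => comp (ladderLeft x k l) (ladderRight y k l)

/-- Three uprights, two rungs pointing left: first `x` between the uprights 2 and 3, above it `y`
between the uprights 1 and 2. -/
def left₂₁ (x y : WebExpr [1] [1]) (h k l : ℕ) : WebExpr [h, k, l + 1] [h + 1, k, l] :=
  comp (b := [h, k + 1, l]) (tensor (id [h]) (ladderLeft x k l)) (tensor (ladderLeft y h k) (id [l]))

/-- Three uprights, two rungs pointing left: first `x` between the uprights 1 and 2, above it `y`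
between the uprights 2 and 3; zero if there is an edge with a negative label. -/
def left₁₂ (x y : WebExpr [1] [1]) : (h k l : ℕ) → WebExpr [h, k, l + 1] [h + 1, k, l]
  | h, 0, l => zero [h, 0, l + 1] [h + 1, 0, l]
  | h, k + 1, l =>
    comp (b := [h + 1, k, l + 1]) (tensor (ladderLeft x h k) (id [l + 1])) (tensor (id [h + 1]) (ladderLeft y k l))

/-- Three uprights, two rungs pointing right: first `x` between the uprights 1 and 2, above it `y`
between the uprights 2 and 3. -/
def right₁₂ (x y : WebExpr [1] [1]) (h k l : ℕ) : WebExpr [h + 1, k, l] [h, k, l + 1] :=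
  comp (b := [h, k + 1, l]) (tensor (ladderRight x h k) (id [l])) (tensor (id [h]) (ladderRight y k l))

/-- Three uprights, two rungs pointing right: first `x` between the uprights 2 and 3, above it `y`
between the uprights 1 and 2; zero if there is an edge with a negative label. -/
def right₂₁ (x y : WebExpr [1] [1]) : (h k l : ℕ) → WebExpr [h + 1, k, l] [h, k, l + 1]
  | h, 0, l => zero [h + 1, 0, l] [h, 0, l + 1]
  | h, k + 1, l =>
    comp (b := [h + 1, k, l + 1]) (tensor (id [h + 1]) (ladderRight x k l)) (tensor (ladderRight y h k) (id [l + 1]))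

/-- The merge of two edges of label `1` followed by the split into two edges of label `1`. -/
def dumbbell : WebExpr [1, 1] [1, 1] := comp (merge 1 1 2 rfl) (split 1 1 2 rfl)

/-- Two dots next to each other: first the one on the right, above it the one on the left. -/
def twoDots : WebExpr [1, 1] [1, 1] :=
  comp (b := [1, 1]) (tensor (id [1]) (dot 1)) (tensor (dot 1) (id [1]))

/-- The defining relations of the category of upward webs of type Q. -/
inductive BasicRel : {a b : List ℕ} → WebExpr a b → WebExpr a b → Prop
  -- associativity of merges and of splits
  | merge_assoc (h k l r s t : ℕ) (h₁ : h + k = r) (h₂ : r + l = t) (h₃ : k + l = s)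
      (h₄ : h + s = t) :
      @BasicRel [h, k, l] [t] (comp (tensor (merge h k r h₁) (id [l])) (merge r l t h₂))
        (comp (tensor (id [h]) (merge k l s h₃)) (merge h s t h₄))
  | split_assoc (h k l r s t : ℕ) (h₁ : h + k = r) (h₂ : r + l = t) (h₃ : k + l = s)
      (h₄ : h + s = t) :
      @BasicRel [t] [h, k, l] (comp (split r l t h₂) (tensor (split h k r h₁) (id [l])))
        (comp (split h s t h₄) (tensor (id [h]) (split k l s h₃)))
  -- digon removal
  | digon (k l m : ℕ) (h : k + l = m) :
      BasicRel (comp (split k l m h) (merge k l m h)) (smul (Nat.choose m l : ℂ) (id [m]))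
  -- dot collision
  | dot_dot (k : ℕ) : BasicRel (comp (dot k) (dot k)) (smul (k : ℂ) (id [k]))
  -- dots past merges and splits
  | dot_merge (k l m : ℕ) (h : k + l = m) :
      BasicRel (comp (merge k l m h) (dot m))
        (comp (add (tensor (dot k) (id [l])) (tensor (id [k]) (dot l))) (merge k l m h))
  | dot_split (k l m : ℕ) (h : k + l = m) :
      BasicRel (comp (dot m) (split k l m h))
        (comp (split k l m h) (add (tensor (dot k) (id [l])) (tensor (id [k]) (dot l))))
  -- dumbbell relation
  | dumbbell :
      BasicRel (sub dumbbell (comp twoDots (comp dumbbell twoDots))) (smul 2 (id [1, 1]))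
  -- square switch
  | square (k l : ℕ) :
      BasicRel (sub (ladderRightLeft (id [1]) (id [1]) k l) (ladderLeftRight (id [1]) (id [1]) k l))
        (smul ((k : ℂ) - l) (id [k, l]))
  -- square switch with dots
  | square_dot_upper (k l : ℕ) :
      BasicRel (sub (ladderRightLeft (id [1]) (dot 1) k l) (ladderLeftRight (dot 1) (id [1]) k l))
        (sub (tensor (dot k) (id [l])) (tensor (id [k]) (dot l)))
  | square_dot_lower (k l : ℕ) :
      BasicRel (sub (ladderRightLeft (dot 1) (id [1]) k l) (ladderLeftRight (id [1]) (dot 1) k l))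
        (sub (tensor (dot k) (id [l])) (tensor (id [k]) (dot l)))
  -- double rungs
  | double_left_one (h k l : ℕ) :
      BasicRel (sub (left₂₁ (id [1]) (id [1]) h k l) (left₁₂ (id [1]) (id [1]) h k l))
        (add (left₂₁ (dot 1) (dot 1) h k l) (left₁₂ (dot 1) (dot 1) h k l))
  | double_left_two (h k l : ℕ) :
      BasicRel (sub (left₂₁ (dot 1) (id [1]) h k l) (left₁₂ (id [1]) (dot 1) h k l))
        (sub (left₂₁ (id [1]) (dot 1) h k l) (left₁₂ (dot 1) (id [1]) h k l))
  | double_right_one (h k l : ℕ) :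
      BasicRel (sub (right₁₂ (id [1]) (id [1]) h k l) (right₂₁ (id [1]) (id [1]) h k l))
        (add (right₁₂ (dot 1) (dot 1) h k l) (right₂₁ (dot 1) (dot 1) h k l))
  | double_right_two (h k l : ℕ) :
      BasicRel (sub (right₁₂ (dot 1) (id [1]) h k l) (right₂₁ (id [1]) (dot 1) h k l))
        (sub (right₁₂ (id [1]) (dot 1) h k l) (right₂₁ (dot 1) (id [1]) h k l))
  -- edges labelled by zero can be omitted
  | create_erase : BasicRel (comp create erase) (id [])
  | erase_create : BasicRel (comp erase create) (id [0])
  | merge_zero_left (l : ℕ) (h : 0 + l = l) :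
      @BasicRel [l] [l] (comp (tensor create (id [l])) (merge 0 l l h)) (id [l])
  | merge_zero_right (k : ℕ) (h : k + 0 = k) :
      @BasicRel [k] [k] (comp (tensor (id [k]) create) (merge k 0 k h)) (id [k])
  | split_zero_left (l : ℕ) (h : 0 + l = l) :
      @BasicRel [l] [l] (comp (split 0 l l h) (tensor erase (id [l]))) (id [l])
  | split_zero_right (k : ℕ) (h : k + 0 = k) :
      @BasicRel [k] [k] (comp (split k 0 k h) (tensor (id [k]) erase)) (id [k])
  | dot_zero : BasicRel (dot 0) (zero [0] [0])

/-- The congruence on expressions generated by the axioms of a strict monoidal supercategory and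
by the defining relations of upward webs of type Q. -/
inductive Rel : {a b : List ℕ} → WebExpr a b → WebExpr a b → Prop
  | basic {a b : List ℕ} {f g : WebExpr a b} : BasicRel f g → Rel f g
  -- congruence
  | refl {a b : List ℕ} (f : WebExpr a b) : Rel f f
  | symm {a b : List ℕ} {f g : WebExpr a b} : Rel f g → Rel g f
  | trans {a b : List ℕ} {f g h : WebExpr a b} : Rel f g → Rel g h → Rel f h
  | comp_congr {a b c : List ℕ} {f f' : WebExpr a b} {g g' : WebExpr b c} :
      Rel f f' → Rel g g' → Rel (comp f g) (comp f' g')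
  | tensor_congr {a b c d : List ℕ} {f f' : WebExpr a b} {g g' : WebExpr c d} :
      Rel f f' → Rel g g' → Rel (tensor f g) (tensor f' g')
  | add_congr {a b : List ℕ} {f f' g g' : WebExpr a b} :
      Rel f f' → Rel g g' → Rel (add f g) (add f' g')
  | smul_congr {a b : List ℕ} (c : ℂ) {f f' : WebExpr a b} :
      Rel f f' → Rel (smul c f) (smul c f')
  -- vector space axioms
  | add_assoc {a b : List ℕ} (f g h : WebExpr a b) : Rel (add (add f g) h) (add f (add g h))
  | add_comm {a b : List ℕ} (f g : WebExpr a b) : Rel (add f g) (add g f)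
  | zero_add {a b : List ℕ} (f : WebExpr a b) : Rel (add (zero a b) f) f
  | one_smul {a b : List ℕ} (f : WebExpr a b) : Rel (smul 1 f) f
  | zero_smul {a b : List ℕ} (f : WebExpr a b) : Rel (smul 0 f) (zero a b)
  | mul_smul {a b : List ℕ} (c d : ℂ) (f : WebExpr a b) :
      Rel (smul (c * d) f) (smul c (smul d f))
  | smul_add {a b : List ℕ} (c : ℂ) (f g : WebExpr a b) :
      Rel (smul c (add f g)) (add (smul c f) (smul c g))
  | add_smul {a b : List ℕ} (c d : ℂ) (f : WebExpr a b) :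
      Rel (smul (c + d) f) (add (smul c f) (smul d f))
  -- category axioms
  | id_comp {a b : List ℕ} (f : WebExpr a b) : Rel (comp (id a) f) f
  | comp_id {a b : List ℕ} (f : WebExpr a b) : Rel (comp f (id b)) f
  | comp_assoc {a b c d : List ℕ} (f : WebExpr a b) (g : WebExpr b c) (h : WebExpr c d) :
      Rel (comp (comp f g) h) (comp f (comp g h))
  | add_comp {a b c : List ℕ} (f f' : WebExpr a b) (g : WebExpr b c) :
      Rel (comp (add f f') g) (add (comp f g) (comp f' g))
  | comp_add {a b c : List ℕ} (f : WebExpr a b) (g g' : WebExpr b c) :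
      Rel (comp f (add g g')) (add (comp f g) (comp f g'))
  | smul_comp {a b c : List ℕ} (r : ℂ) (f : WebExpr a b) (g : WebExpr b c) :
      Rel (comp (smul r f) g) (smul r (comp f g))
  | comp_smul {a b c : List ℕ} (r : ℂ) (f : WebExpr a b) (g : WebExpr b c) :
      Rel (comp f (smul r g)) (smul r (comp f g))
  -- axioms of the tensor product
  | add_tensor {a b c d : List ℕ} (f f' : WebExpr a b) (g : WebExpr c d) :
      Rel (tensor (add f f') g) (add (tensor f g) (tensor f' g))
  | tensor_add {a b c d : List ℕ} (f : WebExpr a b) (g g' : WebExpr c d) :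
      Rel (tensor f (add g g')) (add (tensor f g) (tensor f g'))
  | smul_tensor {a b c d : List ℕ} (r : ℂ) (f : WebExpr a b) (g : WebExpr c d) :
      Rel (tensor (smul r f) g) (smul r (tensor f g))
  | tensor_smul {a b c d : List ℕ} (r : ℂ) (f : WebExpr a b) (g : WebExpr c d) :
      Rel (tensor f (smul r g)) (smul r (tensor f g))
  | tensor_id (a b : List ℕ) : Rel (tensor (id a) (id b)) (id (a ++ b))
  | interchange {p q : ZMod 2} {a b c a' b' c' : List ℕ} (h : WebExpr a b) (f : WebExpr b c)
      (k : WebExpr a' b') (g : WebExpr b' c') : HasParity p g → HasParity q h →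
      Rel (comp (tensor h k) (tensor f g)) (smul (sgn (p * q)) (tensor (comp h f) (comp k g)))
  | tensor_assoc {a b c a' b' c' : List ℕ} (f : WebExpr a a') (g : WebExpr b b')
      (h : WebExpr c c') :
      Rel (comp (tensor (tensor f g) h) (cast (List.append_assoc a' b' c')))
        (comp (cast (List.append_assoc a b c)) (tensor f (tensor g h)))
  | id_tensor {a b : List ℕ} (f : WebExpr a b) : Rel (tensor (id []) f) f
  | tensor_id_nil {a b : List ℕ} (f : WebExpr a b) :
      Rel (comp (tensor f (id [])) (cast (List.append_nil b))) (comp (cast (List.append_nil a)) f)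

/-- The morphisms of the category of upward webs: expressions modulo relations. -/
def setoid (a b : List ℕ) : Setoid (WebExpr a b) where
  r := Rel
  iseqv := ⟨Rel.refl, Rel.symm, Rel.trans⟩

end WebExpr

/-- The objects of the monoidal supercategory `q-Web_↑` of upward webs of type Q: the words
`↑_(a₁) ⋯ ↑_(a_t)`, encoded by the lists of their labels. -/
def WebUp : Type := List ℕ

/-- The space of morphisms between two words. -/
def WebHom (a b : List ℕ) : Type := Quotient (WebExpr.setoid a b)

namespace WebHom

open WebExpr

variable {a b c d a' b' c' : List ℕ}

/-- The morphism given by an expression. -/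
def mk (f : WebExpr a b) : WebHom a b := Quotient.mk (setoid a b) f

theorem sound {f g : WebExpr a b} (h : Rel f g) : mk f = mk g := Quotient.sound h

theorem ind {C : WebHom a b → Prop} (h : ∀ f, C (mk f)) (x : WebHom a b) : C x :=
  Quotient.ind h x

instance : Add (WebHom a b) :=
  ⟨Quotient.map₂ WebExpr.add fun _ _ h _ _ h' => Rel.add_congr h h'⟩

instance : Zero (WebHom a b) := ⟨mk (WebExpr.zero a b)⟩

instance : SMul ℂ (WebHom a b) :=
  ⟨fun r => Quotient.map (WebExpr.smul r) fun _ _ h => Rel.smul_congr r h⟩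

instance : Neg (WebHom a b) := ⟨fun x => (-1 : ℂ) • x⟩

theorem mk_add (f g : WebExpr a b) : mk (WebExpr.add f g) = mk f + mk g := rfl

theorem mk_smul (r : ℂ) (f : WebExpr a b) : mk (WebExpr.smul r f) = r • mk f := rfl

theorem mk_zero : mk (WebExpr.zero a b) = 0 := rfl

instance : AddCommGroup (WebHom a b) where
  add_assoc x y z := by
    induction x using ind; induction y using ind; induction z using ind
    exact sound (Rel.add_assoc _ _ _)
  add_comm x y := by
    induction x using ind; induction y using ind
    exact sound (Rel.add_comm _ _)
  zero_add x := by
    induction x using ind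
    exact sound (Rel.zero_add _)
  add_zero x := by
    induction x using ind
    exact sound (Rel.trans (Rel.add_comm _ _) (Rel.zero_add _))
  neg_add_cancel x := by
    induction x using ind with
    | h f =>
      have h1 := Rel.add_smul (-1) 1 f
      rw [neg_add_cancel] at h1
      exact sound (Rel.trans (Rel.add_congr (Rel.refl _) (Rel.symm (Rel.one_smul f)))
        (Rel.trans (Rel.symm h1) (Rel.zero_smul f)))
  nsmul := nsmulRec
  zsmul := zsmulRec

instance : Module ℂ (WebHom a b) where
  one_smul x := by
    induction x using ind
    exact sound (Rel.one_smul _)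
  mul_smul r s x := by
    induction x using ind
    exact sound (Rel.mul_smul _ _ _)
  smul_add r x y := by
    induction x using ind; induction y using ind
    exact sound (Rel.smul_add _ _ _)
  add_smul r s x := by
    induction x using ind
    exact sound (Rel.add_smul _ _ _)
  zero_smul x := by
    induction x using ind
    exact sound (Rel.zero_smul _)
  smul_zero r := by
    have h := sound (Rel.smul_congr r (Rel.zero_smul (WebExpr.zero a b)))
    refine h.symm.trans ((sound (Rel.mul_smul r 0 _)).symm.trans ?_)
    rw [mul_zero]
    exact sound (Rel.zero_smul _)

theorem mk_sub (f g : WebExpr a b) : mk (WebExpr.sub f g) = mk f - mk g := by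
  rw [WebExpr.sub, mk_add, mk_smul, neg_one_smul, sub_eq_add_neg]

/-- Composition. -/
def comp : WebHom a b → WebHom b c → WebHom a c :=
  Quotient.map₂ WebExpr.comp fun _ _ h _ _ h' => Rel.comp_congr h h'

/-- The tensor product of morphisms. -/
def tensor : WebHom a b → WebHom c d → WebHom (a ++ c) (b ++ d) :=
  Quotient.map₂ WebExpr.tensor fun _ _ h _ _ h' => Rel.tensor_congr h h'

theorem mk_comp (f : WebExpr a b) (g : WebExpr b c) :
    mk (WebExpr.comp f g) = comp (mk f) (mk g) := rfl

theorem mk_tensor (f : WebExpr a b) (g : WebExpr c d) :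
    mk (WebExpr.tensor f g) = tensor (mk f) (mk g) := rfl

theorem add_comp (x x' : WebHom a b) (y : WebHom b c) :
    comp (x + x') y = comp x y + comp x' y := by
  induction x using ind; induction x' using ind; induction y using ind
  exact sound (Rel.add_comp _ _ _)

theorem comp_add (x : WebHom a b) (y y' : WebHom b c) :
    comp x (y + y') = comp x y + comp x y' := by
  induction x using ind; induction y using ind; induction y' using ind
  exact sound (Rel.comp_add _ _ _)

theorem smul_comp (r : ℂ) (x : WebHom a b) (y : WebHom b c) :
    comp (r • x) y = r • comp x y := by
  induction x using ind; induction y using ind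
  exact sound (Rel.smul_comp _ _ _)

theorem comp_smul (r : ℂ) (x : WebHom a b) (y : WebHom b c) :
    comp x (r • y) = r • comp x y := by
  induction x using ind; induction y using ind
  exact sound (Rel.comp_smul _ _ _)

theorem add_tensor (x x' : WebHom a b) (y : WebHom c d) :
    tensor (x + x') y = tensor x y + tensor x' y := by
  induction x using ind; induction x' using ind; induction y using ind
  exact sound (Rel.add_tensor _ _ _)

theorem tensor_add (x : WebHom a b) (y y' : WebHom c d) :
    tensor x (y + y') = tensor x y + tensor x y' := by
  induction x using ind; induction y using ind; induction y' using ind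
  exact sound (Rel.tensor_add _ _ _)

theorem smul_tensor (r : ℂ) (x : WebHom a b) (y : WebHom c d) :
    tensor (r • x) y = r • tensor x y := by
  induction x using ind; induction y using ind
  exact sound (Rel.smul_tensor _ _ _)

theorem tensor_smul (r : ℂ) (x : WebHom a b) (y : WebHom c d) :
    tensor x (r • y) = r • tensor x y := by
  induction x using ind; induction y using ind
  exact sound (Rel.tensor_smul _ _ _)

/-- The morphisms of parity `p`. -/
def part (a b : List ℕ) (p : ZMod 2) : Submodule ℂ (WebHom a b) where
  carrier := {x | ∃ f : WebExpr a b, HasParity p f ∧ mk f = x}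
  add_mem' := by
    rintro _ _ ⟨f, hf, rfl⟩ ⟨g, hg, rfl⟩
    exact ⟨_, .add hf hg, rfl⟩
  zero_mem' := ⟨_, .zero p a b, rfl⟩
  smul_mem' := by
    rintro r _ ⟨f, hf, rfl⟩
    exact ⟨_, .smul r hf, rfl⟩

theorem comp_mem_part {p q : ZMod 2} {x : WebHom a b} {y : WebHom b c} (hx : x ∈ part a b p)
    (hy : y ∈ part b c q) : comp x y ∈ part a c (p + q) := by
  obtain ⟨f, hf, rfl⟩ := hx
  obtain ⟨g, hg, rfl⟩ := hy
  exact ⟨_, .comp hf hg, rfl⟩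

theorem tensor_mem_part {p q : ZMod 2} {x : WebHom a b} {y : WebHom c d} (hx : x ∈ part a b p)
    (hy : y ∈ part c d q) : tensor x y ∈ part (a ++ c) (b ++ d) (p + q) := by
  obtain ⟨f, hf, rfl⟩ := hx
  obtain ⟨g, hg, rfl⟩ := hy
  exact ⟨_, .tensor hf hg, rfl⟩

theorem part_le (p : ZMod 2) : part a b p ≤ part a b 0 ⊔ part a b 1 := by
  rcases parity_cases p with rfl | rfl
  · exact le_sup_left
  · exact le_sup_right

theorem mem_sup_part (f : WebExpr a b) : mk f ∈ part a b 0 ⊔ part a b 1 := by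
  induction f with
  | id a => exact part_le 0 ⟨_, .id a, rfl⟩
  | comp f g hf hg =>
    rw [mk_comp]
    obtain ⟨x, hx, x', hx', e⟩ := Submodule.mem_sup.1 hf
    obtain ⟨y, hy, y', hy', e'⟩ := Submodule.mem_sup.1 hg
    rw [← e, ← e', add_comp, comp_add, comp_add]
    exact add_mem (add_mem (part_le _ (comp_mem_part hx hy)) (part_le _ (comp_mem_part hx hy')))
      (add_mem (part_le _ (comp_mem_part hx' hy)) (part_le _ (comp_mem_part hx' hy')))
  | tensor f g hf hg =>
    rw [mk_tensor]
    obtain ⟨x, hx, x', hx', e⟩ := Submodule.mem_sup.1 hf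
    obtain ⟨y, hy, y', hy', e'⟩ := Submodule.mem_sup.1 hg
    rw [← e, ← e', add_tensor, tensor_add, tensor_add]
    exact add_mem
      (add_mem (part_le _ (tensor_mem_part hx hy)) (part_le _ (tensor_mem_part hx hy')))
      (add_mem (part_le _ (tensor_mem_part hx' hy)) (part_le _ (tensor_mem_part hx' hy')))
  | zero a b => exact zero_mem _
  | add f g hf hg => exact add_mem hf hg
  | smul r f hf => exact Submodule.smul_mem _ r hf
  | dot k => exact part_le 1 ⟨_, .dot k, rfl⟩
  | merge k l m h => exact part_le 0 ⟨_, .merge k l m h, rfl⟩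
  | split k l m h => exact part_le 0 ⟨_, .split k l m h, rfl⟩
  | erase => exact part_le 0 ⟨_, .erase, rfl⟩
  | create => exact part_le 0 ⟨_, .create, rfl⟩

end WebHom

namespace WebExpr

theorem HasParity.of_eq {p q : ZMod 2} {a b : List ℕ} {f : WebExpr a b} (hf : HasParity p f)
    (h : p = q) : HasParity q f := h ▸ hf

theorem HasParity.comp' {p q r : ZMod 2} {a b c : List ℕ} {f : WebExpr a b} {g : WebExpr b c}
    (hf : HasParity p f) (hg : HasParity q g) (h : p + q = r) : HasParity r (WebExpr.comp f g) :=
  (HasParity.comp hf hg).of_eq h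

theorem HasParity.tensor' {p q r : ZMod 2} {a b c d : List ℕ} {f : WebExpr a b}
    {g : WebExpr c d} (hf : HasParity p f) (hg : HasParity q g) (h : p + q = r) :
    HasParity r (WebExpr.tensor f g) :=
  (HasParity.tensor hf hg).of_eq h

theorem HasParity.id_tensor {p : ZMod 2} {c d : List ℕ} (a : List ℕ) {g : WebExpr c d}
    (hg : HasParity p g) : HasParity p (WebExpr.tensor (WebExpr.id a) g) :=
  (HasParity.id a).tensor' hg (zero_add p)

theorem HasParity.tensor_id {p : ZMod 2} {c d : List ℕ} (a : List ℕ) {g : WebExpr c d}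
    (hg : HasParity p g) : HasParity p (WebExpr.tensor g (WebExpr.id a)) :=
  hg.tensor' (HasParity.id a) (add_zero p)

theorem HasParity.sub {p : ZMod 2} {a b : List ℕ} {f g : WebExpr a b} (hf : HasParity p f)
    (hg : HasParity p g) : HasParity p (WebExpr.sub f g) := hf.add (hg.smul _)

theorem HasParity.cast {a b : List ℕ} (h : a = b) : HasParity 0 (WebExpr.cast h) := by
  subst h; exact HasParity.id a

theorem HasParity.ladderLeft {p : ZMod 2} {x : WebExpr [1] [1]} (hx : HasParity p x) (k l : ℕ) :
    HasParity p (ladderLeft x k l) :=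
  ((HasParity.split _ _ _ _).id_tensor _).comp' (((hx.tensor_id _).id_tensor _).comp'
    ((HasParity.merge _ _ _ _).tensor_id _) (add_zero p)) (zero_add p)

theorem HasParity.ladderRight {p : ZMod 2} {x : WebExpr [1] [1]} (hx : HasParity p x) (k l : ℕ) :
    HasParity p (ladderRight x k l) :=
  ((HasParity.split _ _ _ _).tensor_id _).comp' (((hx.tensor_id _).id_tensor _).comp'
    ((HasParity.merge _ _ _ _).id_tensor _) (add_zero p)) (zero_add p)

theorem HasParity.ladderRightLeft {p q r : ZMod 2} {x y : WebExpr [1] [1]} (hx : HasParity p x)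
    (hy : HasParity q y) (h : p + q = r) : ∀ k l : ℕ, HasParity r (ladderRightLeft x y k l)
  | 0, _ => .zero r _ _
  | k + 1, l => (hx.ladderRight k l).comp' (hy.ladderLeft k l) h

theorem HasParity.ladderLeftRight {p q r : ZMod 2} {x y : WebExpr [1] [1]} (hx : HasParity p x)
    (hy : HasParity q y) (h : p + q = r) : ∀ k l : ℕ, HasParity r (ladderLeftRight x y k l)
  | _, 0 => .zero r _ _
  | k, l + 1 => (hx.ladderLeft k l).comp' (hy.ladderRight k l) h

theorem HasParity.left₂₁ {p q r : ZMod 2} {x y : WebExpr [1] [1]} (hx : HasParity p x)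
    (hy : HasParity q y) (e : p + q = r) (h k l : ℕ) : HasParity r (left₂₁ x y h k l) :=
  ((hx.ladderLeft k l).id_tensor [h]).comp' ((hy.ladderLeft h k).tensor_id [l]) e

theorem HasParity.left₁₂ {p q r : ZMod 2} {x y : WebExpr [1] [1]} (hx : HasParity p x)
    (hy : HasParity q y) (e : p + q = r) : ∀ h k l : ℕ, HasParity r (left₁₂ x y h k l)
  | _, 0, _ => .zero r _ _
  | h, k + 1, l =>
    ((hx.ladderLeft h k).tensor_id [l + 1]).comp' ((hy.ladderLeft k l).id_tensor [h + 1]) e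

theorem HasParity.right₁₂ {p q r : ZMod 2} {x y : WebExpr [1] [1]} (hx : HasParity p x)
    (hy : HasParity q y) (e : p + q = r) (h k l : ℕ) : HasParity r (right₁₂ x y h k l) :=
  ((hx.ladderRight h k).tensor_id [l]).comp' ((hy.ladderRight k l).id_tensor [h]) e

theorem HasParity.right₂₁ {p q r : ZMod 2} {x y : WebExpr [1] [1]} (hx : HasParity p x)
    (hy : HasParity q y) (e : p + q = r) : ∀ h k l : ℕ, HasParity r (right₂₁ x y h k l)
  | _, 0, _ => .zero r _ _
  | h, k + 1, l =>
    ((hx.ladderRight k l).id_tensor [h + 1]).comp' ((hy.ladderRight h k).tensor_id [l + 1]) e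

theorem HasParity.dumbbell : HasParity 0 dumbbell :=
  (HasParity.merge _ _ _ _).comp' (HasParity.split _ _ _ _) (add_zero 0)

theorem HasParity.twoDots : HasParity 0 twoDots :=
  ((HasParity.dot 1).id_tensor [1]).comp' ((HasParity.dot 1).tensor_id [1]) (by decide)

/-- Both sides of each defining relation are homogeneous of the same parity. -/
theorem BasicRel.homogeneous {a b : List ℕ} {f g : WebExpr a b} (h : BasicRel f g) :
    ∃ p, HasParity p f ∧ HasParity p g := by
  have e : HasParity 0 (WebExpr.id [1]) := .id _
  have d : HasParity 1 (WebExpr.dot 1) := .dot 1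
  have e0 : (0 : ZMod 2) + 0 = 0 := by decide
  have e1 : (0 : ZMod 2) + 1 = 1 := by decide
  have e2 : (1 : ZMod 2) + 0 = 1 := by decide
  have e3 : (1 : ZMod 2) + 1 = 0 := by decide
  cases h with
  | merge_assoc =>
    exact ⟨0, ((HasParity.merge _ _ _ _).tensor_id _).comp' (.merge _ _ _ _) e0,
      ((HasParity.merge _ _ _ _).id_tensor _).comp' (.merge _ _ _ _) e0⟩
  | split_assoc =>
    exact ⟨0, (HasParity.split _ _ _ _).comp' ((HasParity.split _ _ _ _).tensor_id _) e0,
      (HasParity.split _ _ _ _).comp' ((HasParity.split _ _ _ _).id_tensor _) e0⟩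
  | digon => exact ⟨0, (HasParity.split _ _ _ _).comp' (.merge _ _ _ _) e0, .smul _ (.id _)⟩
  | dot_dot => exact ⟨0, (HasParity.dot _).comp' (.dot _) e3, .smul _ (.id _)⟩
  | dot_merge =>
    exact ⟨1, (HasParity.merge _ _ _ _).comp' (.dot _) e1,
      (HasParity.add ((HasParity.dot _).tensor_id _) ((HasParity.dot _).id_tensor _)).comp'
        (.merge _ _ _ _) e2⟩
  | dot_split =>
    exact ⟨1, (HasParity.dot _).comp' (.split _ _ _ _) e2, (HasParity.split _ _ _ _).comp'
      (.add ((HasParity.dot _).tensor_id _) ((HasParity.dot _).id_tensor _)) e1⟩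
  | dumbbell =>
    exact ⟨0, .sub .dumbbell (HasParity.twoDots.comp' (HasParity.dumbbell.comp' .twoDots e0) e0),
      .smul _ (.id _)⟩
  | square k l =>
    exact ⟨0, .sub (e.ladderRightLeft e e0 k l) (e.ladderLeftRight e e0 k l), .smul _ (.id _)⟩
  | square_dot_upper k l =>
    exact ⟨1, .sub (e.ladderRightLeft d e1 k l) (d.ladderLeftRight e e2 k l),
      .sub ((HasParity.dot _).tensor_id _) ((HasParity.dot _).id_tensor _)⟩
  | square_dot_lower k l =>
    exact ⟨1, .sub (d.ladderRightLeft e e2 k l) (e.ladderLeftRight d e1 k l),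
      .sub ((HasParity.dot _).tensor_id _) ((HasParity.dot _).id_tensor _)⟩
  | double_left_one h k l =>
    exact ⟨0, .sub (e.left₂₁ e e0 h k l) (e.left₁₂ e e0 h k l),
      .add (d.left₂₁ d e3 h k l) (d.left₁₂ d e3 h k l)⟩
  | double_left_two h k l =>
    exact ⟨1, .sub (d.left₂₁ e e2 h k l) (e.left₁₂ d e1 h k l),
      .sub (e.left₂₁ d e1 h k l) (d.left₁₂ e e2 h k l)⟩
  | double_right_one h k l =>
    exact ⟨0, .sub (e.right₁₂ e e0 h k l) (e.right₂₁ e e0 h k l),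
      .add (d.right₁₂ d e3 h k l) (d.right₂₁ d e3 h k l)⟩
  | double_right_two h k l =>
    exact ⟨1, .sub (d.right₁₂ e e2 h k l) (e.right₂₁ d e1 h k l),
      .sub (e.right₁₂ d e1 h k l) (d.right₂₁ e e2 h k l)⟩
  | create_erase => exact ⟨0, HasParity.create.comp' .erase e0, .id _⟩
  | erase_create => exact ⟨0, HasParity.erase.comp' .create e0, .id _⟩
  | merge_zero_left =>
    exact ⟨0, (HasParity.create.tensor_id _).comp' (.merge _ _ _ _) e0, .id _⟩
  | merge_zero_right =>
    exact ⟨0, (HasParity.create.id_tensor _).comp' (.merge _ _ _ _) e0, .id _⟩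
  | split_zero_left =>
    exact ⟨0, (HasParity.split _ _ _ _).comp' (HasParity.erase.tensor_id _) e0, .id _⟩
  | split_zero_right =>
    exact ⟨0, (HasParity.split _ _ _ _).comp' (HasParity.erase.id_tensor _) e0, .id _⟩
  | dot_zero => exact ⟨1, .dot 0, .zero _ _ _⟩

/-- The parity involution on expressions, which changes the sign of each dot. -/
def conj : {a b : List ℕ} → WebExpr a b → WebExpr a b
  | _, _, id a => id a
  | _, _, comp f g => comp (conj f) (conj g)
  | _, _, tensor f g => tensor (conj f) (conj g)
  | _, _, zero a b => zero a b
  | _, _, add f g => add (conj f) (conj g)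
  | _, _, smul r f => smul r (conj f)
  | _, _, dot k => smul (-1) (dot k)
  | _, _, merge k l m h => merge k l m h
  | _, _, split k l m h => split k l m h
  | _, _, erase => erase
  | _, _, create => create

theorem conj_parity {p : ZMod 2} {a b : List ℕ} {f : WebExpr a b} (hf : HasParity p f) :
    HasParity p (conj f) := by
  induction hf with
  | id a => exact .id a
  | comp _ _ hf hg => exact .comp hf hg
  | tensor _ _ hf hg => exact .tensor hf hg
  | zero p a b => exact .zero p a b
  | add _ _ hf hg => exact .add hf hg
  | smul r _ hf => exact .smul r hf
  | dot k => exact .smul _ (.dot k)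
  | merge k l m h => exact .merge k l m h
  | split k l m h => exact .split k l m h
  | erase => exact .erase
  | create => exact .create

theorem conj_cast {a b : List ℕ} (h : a = b) : conj (cast h) = cast h := by
  subst h; rfl

end WebExpr

namespace WebHom

open WebExpr

variable {a b c d : List ℕ}

theorem mk_conj {p : ZMod 2} {f : WebExpr a b} (hf : HasParity p f) :
    mk (conj f) = sgn p • mk f := by
  induction hf with
  | id a => rw [sgn_zero, one_smul]; rfl
  | comp _ _ hf hg =>
    rw [WebExpr.conj, mk_comp, hf, hg, smul_comp, comp_smul, smul_smul, ← sgn_add, mk_comp]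
  | tensor _ _ hf hg =>
    rw [WebExpr.conj, mk_tensor, hf, hg, smul_tensor, tensor_smul, smul_smul, ← sgn_add, mk_tensor]
  | zero p a b => rw [mk_zero, smul_zero]; rfl
  | add _ _ hf hg => rw [WebExpr.conj, mk_add, hf, hg, mk_add, smul_add]
  | smul r _ hf => rw [WebExpr.conj, mk_smul, hf, mk_smul, smul_comm]
  | dot k => rw [WebExpr.conj, mk_smul, sgn_one]
  | merge k l m h => rw [sgn_zero, one_smul]; rfl
  | split k l m h => rw [sgn_zero, one_smul]; rfl
  | erase => rw [sgn_zero, one_smul]; rfl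
  | create => rw [sgn_zero, one_smul]; rfl

theorem rel_conj {f g : WebExpr a b} (h : Rel f g) : Rel (conj f) (conj g) := by
  induction h with
  | basic h =>
    obtain ⟨p, hf, hg⟩ := h.homogeneous
    apply Quotient.exact (s := setoid _ _)
    change mk _ = mk _
    rw [mk_conj hf, mk_conj hg, sound (Rel.basic h)]
  | refl f => exact .refl _
  | symm _ h => exact .symm h
  | trans _ _ h h' => exact .trans h h'
  | comp_congr _ _ h h' => exact .comp_congr h h'
  | tensor_congr _ _ h h' => exact .tensor_congr h h'
  | add_congr _ _ h h' => exact .add_congr h h'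
  | smul_congr r _ h => exact .smul_congr r h
  | add_assoc f g h => exact .add_assoc _ _ _
  | add_comm f g => exact .add_comm _ _
  | zero_add f => exact .zero_add _
  | one_smul f => exact .one_smul _
  | zero_smul f => exact .zero_smul _
  | mul_smul r s f => exact .mul_smul _ _ _
  | smul_add r f g => exact .smul_add _ _ _
  | add_smul r s f => exact .add_smul _ _ _
  | id_comp f => exact .id_comp _
  | comp_id f => exact .comp_id _
  | comp_assoc f g h => exact .comp_assoc _ _ _
  | add_comp f f' g => exact .add_comp _ _ _
  | comp_add f g g' => exact .comp_add _ _ _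
  | smul_comp r f g => exact .smul_comp _ _ _
  | comp_smul r f g => exact .comp_smul _ _ _
  | add_tensor f f' g => exact .add_tensor _ _ _
  | tensor_add f g g' => exact .tensor_add _ _ _
  | smul_tensor r f g => exact .smul_tensor _ _ _
  | tensor_smul r f g => exact .tensor_smul _ _ _
  | tensor_id a b => exact .tensor_id a b
  | interchange h f k g hg hh => exact .interchange _ _ _ _ (conj_parity hg) (conj_parity hh)
  | tensor_assoc f g h =>
    simp only [conj, conj_cast]
    exact .tensor_assoc _ _ _
  | id_tensor f => exact .id_tensor _
  | tensor_id_nil f =>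
    simp only [conj, conj_cast]
    exact .tensor_id_nil _

theorem part_isCompl : IsCompl (part a b 0) (part a b 1) := by
  constructor
  · rw [Submodule.disjoint_def]
    rintro _ ⟨f, hf, rfl⟩ ⟨g, hg, hgf⟩
    have h : mk (conj g) = mk (conj f) := sound (rel_conj (Quotient.exact (s := setoid _ _) hgf))
    rw [mk_conj hg, mk_conj hf, hgf, sgn_zero, sgn_one, one_smul, neg_one_smul] at h
    have h2 : (2 : ℂ) • mk f = 0 := by
      rw [two_smul]
      nth_rewrite 1 [← h]
      exact neg_add_cancel _
    exact (smul_eq_zero.1 h2).resolve_left two_ne_zero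
  · rw [codisjoint_iff, Submodule.eq_top_iff']
    intro x
    induction x using ind
    exact mem_sup_part _

/-- The additive structure on `WebHom a b`. -/
abbrev group (a b : List ℕ) : AddCommGroup (WebHom a b) := inferInstance

/-- The vector space structure on `WebHom a b`. -/
abbrev vect (a b : List ℕ) : Module ℂ (WebHom a b) := inferInstance

end WebHom

namespace WebUp

open WebExpr

instance : Category WebUp where
  Hom a b := WebHom a b
  id a := WebHom.mk (WebExpr.id a)
  comp f g := WebHom.comp f g
  id_comp {a b} f := by
    induction f using WebHom.ind (a := a) (b := b)
    exact WebHom.sound (Rel.id_comp _)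
  comp_id {a b} f := by
    induction f using WebHom.ind (a := a) (b := b)
    exact WebHom.sound (Rel.comp_id _)
  assoc {a b c d} f g h := by
    induction f using WebHom.ind (a := a) (b := b)
    induction g using WebHom.ind (a := b) (b := c)
    induction h using WebHom.ind (a := c) (b := d)
    exact WebHom.sound (Rel.comp_assoc _ _ _)

instance : Preadditive WebUp where
  homGroup a b := WebHom.group a b
  add_comp _ _ _ f f' g := WebHom.add_comp f f' g
  comp_add _ _ _ f g g' := WebHom.comp_add f g g'

instance : Linear ℂ WebUp where
  homModule a b := WebHom.vect a b
  smul_comp _ _ _ r f g := WebHom.smul_comp r f g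
  comp_smul _ _ _ f r g := WebHom.comp_smul r f g

/-- The morphism of `q-Web_↑` given by an expression. -/
def ofExpr {a b : List ℕ} (f : WebExpr a b) : (show WebUp from a) ⟶ (show WebUp from b) :=
  WebHom.mk f

theorem ofExpr_cast {a b : List ℕ} (h : a = b) :
    ofExpr (WebExpr.cast h) = eqToHom (C := WebUp) h := by
  subst h; rfl

instance : Supercategory WebUp where
  homPart a b p := WebHom.part a b p
  isCompl_homPart _ _ := WebHom.part_isCompl
  id_mem a := ⟨_, .id a, rfl⟩
  comp_mem hf hg := WebHom.comp_mem_part hf hg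

theorem eqToHom_mem {a b : WebUp} (h : a = b) : eqToHom h ∈ homPart a b 0 := by
  subst h; exact id_mem a

/-- The concatenation of words. -/
def append (a b : WebUp) : WebUp := List.append a b

/-- The tensor product of morphisms. -/
def tensorHom {a b c d : WebUp} : (a ⟶ b) →ₗ[ℂ] (c ⟶ d) →ₗ[ℂ] (append a c ⟶ append b d) :=
  LinearMap.mk₂ ℂ (fun f g => WebHom.tensor f g)
    (fun f f' g => WebHom.add_tensor f f' g) (fun r f g => WebHom.smul_tensor r f g)
    (fun f g g' => WebHom.tensor_add f g g') (fun r f g => WebHom.tensor_smul r f g)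

theorem tensorHom_id (a b : WebUp) : tensorHom (𝟙 a) (𝟙 b) = 𝟙 (append a b) :=
  WebHom.sound (Rel.tensor_id a b)

theorem tensorHom_eqToHom {a b : WebUp} (h : a = b) (c : WebUp) :
    tensorHom (eqToHom h) (𝟙 c) = eqToHom (by rw [h]) := by
  subst h; exact tensorHom_id _ _

theorem tensorHom_id_eqToHom {a b : WebUp} (h : a = b) (c : WebUp) :
    tensorHom (𝟙 c) (eqToHom h) = eqToHom (by rw [h]) := by
  subst h; exact tensorHom_id _ _

theorem append_assoc (a b c : WebUp) : append (append a b) c = append a (append b c) :=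
  List.append_assoc a b c

theorem nil_append (a : WebUp) : append ([] : List ℕ) a = a := rfl

theorem append_nil (a : WebUp) : append a ([] : List ℕ) = a := List.append_nil a

/-- Upward webs of type Q form a (strict) monoidal supercategory. -/
instance : MonoidalSupercategory WebUp where
  tensorObj := append
  tensorUnit := ([] : List ℕ)
  tensorHom := tensorHom
  tensorHom_mem hf hg := WebHom.tensor_mem_part hf hg
  tensorHom_id := tensorHom_id
  tensorHom_comp {a b c a' b' c' p q} h f k g hg hh := by
    obtain ⟨g, hg, rfl⟩ := hg
    obtain ⟨h, hh, rfl⟩ := hh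
    induction f using WebHom.ind (a := b) (b := c)
    induction k using WebHom.ind (a := a') (b := b')
    exact WebHom.sound (Rel.interchange _ _ _ _ hg hh)
  associator a b c := eqToIso (append_assoc a b c)
  leftUnitor a := eqToIso (nil_append a)
  rightUnitor a := eqToIso (append_nil a)
  associator_mem a b c := eqToHom_mem (append_assoc a b c)
  leftUnitor_mem a := eqToHom_mem (nil_append a)
  rightUnitor_mem a := eqToHom_mem (append_nil a)
  associator_naturality {a b c a' b' c'} f g h := by
    induction f using WebHom.ind (a := a) (b := a')
    induction g using WebHom.ind (a := b) (b := b')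
    induction h using WebHom.ind (a := c) (b := c')
    rw [eqToIso.hom, eqToIso.hom, ← ofExpr_cast (append_assoc a b c),
      ← ofExpr_cast (append_assoc a' b' c')]
    exact WebHom.sound (Rel.tensor_assoc _ _ _)
  leftUnitor_naturality {a b} f := by
    refine (Category.comp_id (X := a) (Y := b) _).trans
      (Eq.trans ?_ (Category.id_comp (X := a) (Y := b) _).symm)
    induction f using WebHom.ind (a := a) (b := b)
    exact WebHom.sound (Rel.id_tensor _)
  rightUnitor_naturality {a b} f := by
    induction f using WebHom.ind (a := a) (b := b)
    rw [eqToIso.hom, eqToIso.hom, ← ofExpr_cast (append_nil a), ← ofExpr_cast (append_nil b)]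
    exact WebHom.sound (Rel.tensor_id_nil _)
  pentagon a b c d := by
    simp only [eqToIso.hom, tensorHom_eqToHom, tensorHom_id_eqToHom, eqToHom_trans]
  triangle a b := by
    simp only [eqToIso.hom, tensorHom_eqToHom, tensorHom_id_eqToHom, eqToHom_trans]

/-- The dot on an edge of label `k`. -/
def dot (k : ℕ) : (show WebUp from [k]) ⟶ (show WebUp from [k]) := ofExpr (.dot k)

/-- The merge of edges of labels `k` and `l`. -/
def merge (k l : ℕ) : (show WebUp from [k, l]) ⟶ (show WebUp from [k + l]) :=
  ofExpr (.merge k l (k + l) rfl)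

/-- The split into edges of labels `k` and `l`. -/
def split (k l : ℕ) : (show WebUp from [k + l]) ⟶ (show WebUp from [k, l]) :=
  ofExpr (.split k l (k + l) rfl)

/-- The inclusion of an edge of label `0`. -/
def create : (show WebUp from []) ⟶ (show WebUp from [0]) := ofExpr .create

end WebUp

/-! The supersymmetric powers are the graded pieces of the symmetric superalgebra `S(V)`, a
supercommutative Hopf superalgebra. Merges are the components of its multiplication, splits are the
components of its comultiplication, and the dot is the odd superderivation extending `c`. The
defining relations of webs are then identities in this Hopf superalgebra.

Everything is controlled by left multiplication by vectors. A positive power `S^(k+1)` is spanned by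
the `v x` with `v` a vector and `x` in `S^k`, subject only to the supercommutation of vectors
(`symLift` is this universal property). The structure maps are determined by their values on `1` and
by the recursions `(v a) b = v (a b)`, `Δ(v x) = (v ⊗ 1 + 1 ⊗ v) Δ(x)` and `D(v x) = z(v) x ± v
D(x)`, which are `merge_lmul`, `split_lmul` and `IsDer`. Associativity, coassociativity, digon
removal (by Pascal's rule), dot collision (from `c² = 1`) and the passage of dots through merges and
splits follow by induction on the degree. Equivariance comes for free: an element of the Lie
superalgebra acts by a superderivation, and superderivations pass through products and coproducts;
moreover `c` supercommutes with the action of `q(n)`.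

The rung relations come from computing what splits off a product `b u` when `u` has degree one:
either `u` itself, or a letter of `b`. In the supercommutator of two opposite rungs decorated by `x`
and `y` the terms of the second kind cancel, and the rest is a derivation on each strand, extending
`y ∘ x` on the left strand and `x ∘ y` on the right one (`rung_square`). With `x` and `y` equal to
`1` or `c`, not both odd, this gives `k - l` or the difference of the two dots. In the same way the
supercommutator of two rungs on neighbouring pairs of strands depends only on the composite of the
decorations (`commLeft_congr`, `commRight_congr`); since `c ∘ c = 1 ∘ 1` and `c ∘ 1 = 1 ∘ c`, the
double rung relations follow. On `V ⊗ V` the dumbbell is the identity plus the super swap;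
sandwiching it between two copies of `c ⊗ c` negates the identity and keeps the swap, so the
difference is `2`.

A word goes to a tensor product bracketed to the right, and the structure isomorphisms are
rebracketings. Their coherence is checked on elements, where they become concatenation of tensors.
Evaluation `ev` is defined by recursion on expressions and respects both the axioms of a strict
monoidal supercategory and the defining relations (`ev_rel`), so it descends to webs. The explicit
formulas arise by unrolling the recursions along a product of vectors; for splits, subsets are
sorted by whether they contain the first index.

Labels are natural numbers, so in degree zero `k - 1` means `0`. At each such place the maps in
question are shown to vanish there, in agreement with the convention that a web with a negative
label is zero. -/

namespace SuperModule

open SuperSpace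

/-! ### Multiplication by vectors and the universal property of symmetric powers -/

section SymPow

variable {𝔤 : LieSuperalgebra} (M : SuperModule 𝔤)

/-- The projection from the tensor power to the symmetric power. -/
noncomputable def symMk (k : ℕ) : (tpow M k).carrier →ₗ[ℂ] (symPow M k).carrier :=
  (symRel M k).mkQ

theorem symMk_surjective (k : ℕ) : Function.Surjective (symMk M k) :=
  Submodule.mkQ_surjective _

/-- The relations form a left ideal: from degree two on the definition of `symRel` contains `M ⊗
symRel`, and in degree zero the only relation is `0`. Hence left multiplication by a vector descends
to the quotients. -/
theorem tmul_mem_symRel (k : ℕ) (v : M.carrier) {t : (tpow M k).carrier} (ht : t ∈ symRel M k) :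
    (v ⊗ₜ[ℂ] t : M.carrier ⊗[ℂ] (tpow M k).carrier) ∈ symRel M (k + 1) := by
  cases k with
  | zero =>
    have h : t = 0 := ht
    rw [h, TensorProduct.tmul_zero]
    exact zero_mem _
  | succ k =>
    exact Submodule.mem_sup_right
      (Submodule.apply_mem_map₂ (TensorProduct.mk ℂ M.carrier (tpow M (k + 1)).carrier) trivial ht)

/-- The product `v x` of a vector `v` with `x ∈ S^k(M)`. -/
noncomputable def lmul {k : ℕ} :
    M.carrier →ₗ[ℂ] (symPow M k).carrier →ₗ[ℂ] (symPow M (k + 1)).carrier :=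
  LinearMap.flip ((symRel M k).liftQ (LinearMap.flip
    ((TensorProduct.mk ℂ M.carrier (tpow M k).carrier).compr₂ (symMk M (k + 1)))) (by
      intro t ht
      rw [LinearMap.mem_ker]
      ext v
      exact (Submodule.Quotient.mk_eq_zero _).2 (tmul_mem_symRel M k v ht)))

/-- The unit `1 ∈ S^0(M)`. -/
noncomputable def symOne : (symPow M 0).carrier := symMk M 0 (1 : ℂ)

variable {M}

theorem symProd_zero (v : Fin 0 → M.carrier) : symProd M v = symOne M := rfl

theorem symProd_succ {k : ℕ} (v : Fin (k + 1) → M.carrier) :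
    symProd M v = lmul M (v 0) (symProd M fun i => v i.succ) := rfl

theorem symMk_mem {k : ℕ} {p : ZMod 2} {t : (tpow M k).carrier} (ht : t ∈ (tpow M k).part p) :
    symMk M k t ∈ (symPow M k).part p := ⟨t, ht, rfl⟩

theorem symOne_mem : symOne M ∈ (symPow M 0).part 0 := by
  refine symMk_mem ?_
  change (1 : ℂ) ∈ (if (0 : ZMod 2) = 0 then (⊤ : Submodule ℂ ℂ) else ⊥)
  simp

theorem exists_smul_symOne (x : (symPow M 0).carrier) : ∃ c : ℂ, x = c • symOne M := by
  obtain ⟨c, rfl⟩ := symMk_surjective M 0 x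
  have h : ∀ c : ℂ, symMk M 0 (c * 1 : ℂ) = c • symOne M := fun c =>
    LinearMap.map_smul (symMk M 0) c _
  exact ⟨c, (congrArg (symMk M 0) (mul_one (M := ℂ) c).symm).trans (h c)⟩

theorem lmul_mem {k : ℕ} {p q r : ZMod 2} {v : M.carrier} {x : (symPow M k).carrier}
    (hv : v ∈ M.part p) (hx : x ∈ (symPow M k).part q) (h : p + q = r) :
    lmul M v x ∈ (symPow M (k + 1)).part r := by
  obtain ⟨t, ht, rfl⟩ := hx
  rw [← h]
  exact symMk_mem (tmul_mem_tensorPart hv ht)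

theorem lmul_linPart {k : ℕ} {p : ZMod 2} {v : M.carrier} (hv : v ∈ M.part p) :
    lmul M v ∈ linPart (symPow M k).toSuperSpace (symPow M (k + 1)).toSuperSpace p :=
  fun _ _ hx => lmul_mem hv hx (add_comm _ _)

/-- `S^0(M)` is spanned by the even unit, so an odd element is zero. This is the base case of the
inductions on the degree that also track parities. -/
theorem symPart_zero_cases {p : ZMod 2} {x : (symPow M 0).carrier} (hx : x ∈ (symPow M 0).part p) :
    (∃ c : ℂ, x = c • symOne M) ∧ (p = 0 ∨ x = 0) := by
  refine ⟨exists_smul_symOne x, ?_⟩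
  rcases parity_cases p with rfl | rfl
  · exact Or.inl rfl
  · right
    obtain ⟨c, rfl⟩ := exists_smul_symOne x
    have h := Submodule.smul_mem _ c (symOne_mem (M := M))
    exact Submodule.disjoint_def.1 (symPow M 0).isCompl.disjoint _ h hx

/-- The homogeneous parts of the quotient are the images of those of `M ⊗ M^(⊗ k)`, which are
spanned by pure homogeneous tensors. This is the basic induction step for statements about symmetric
powers. -/
theorem symPart_induction {k : ℕ} {r : ZMod 2} {C : (symPow M (k + 1)).carrier → Prop}
    {x : (symPow M (k + 1)).carrier} (hx : x ∈ (symPow M (k + 1)).part r) (hzero : C 0)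
    (hadd : ∀ x y, C x → C y → C (x + y))
    (hmul : ∀ p q, p + q = r → ∀ v ∈ M.part p, ∀ y ∈ (symPow M k).part q, C (lmul M v y)) :
    C x := by
  obtain ⟨t, ht, rfl⟩ := hx
  refine tensorPart_induction (M := M.toSuperSpace) (N := (tpow M k).toSuperSpace)
    (C := fun t => C (symMk M (k + 1) t)) ht ?_ ?_ ?_
  · exact (congrArg C (map_zero (symMk M (k + 1)))).mpr hzero
  · intro x y hx hy
    exact (congrArg C (map_add (symMk M (k + 1)) x y)).mpr (hadd _ _ hx hy)
  · intro e d h v hv t ht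
    exact hmul e d h v hv _ (symMk_mem ht)

theorem sym_succ_ext {k : ℕ} {X : Type*} [AddCommGroup X] [Module ℂ X]
    {f g : (symPow M (k + 1)).carrier →ₗ[ℂ] X}
    (h : ∀ p, ∀ v ∈ M.part p, ∀ q, ∀ x ∈ (symPow M k).part q,
      f (lmul M v x) = g (lmul M v x)) : f = g := by
  refine lin_ext (M := (symPow M (k + 1)).toSuperSpace) fun r x hx => ?_
  refine symPart_induction (C := fun x => f x = g x) hx ?_ ?_ ?_
  · rw [map_zero, map_zero]
  · intro x y hx hy; rw [map_add, map_add, hx, hy]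
  · intro p q _ v hv y hy; exact h p v hv q y hy

theorem sym_zero_ext {X : Type*} [AddCommGroup X] [Module ℂ X]
    {f g : (symPow M 0).carrier →ₗ[ℂ] X} (h : f (symOne M) = g (symOne M)) : f = g := by
  ext x
  obtain ⟨c, rfl⟩ := exists_smul_symOne x
  rw [map_smul, map_smul, h]

theorem swap_mem_symRel {k : ℕ} {p q r : ZMod 2} {v w : M.carrier} (hv : v ∈ M.part p)
    (hw : w ∈ M.part q) {t : (tpow M k).carrier} (ht : t ∈ (tpow M k).part r) :
    (v ⊗ₜ[ℂ] (w ⊗ₜ[ℂ] t) - sgn (p * q) • (w ⊗ₜ[ℂ] (v ⊗ₜ[ℂ] t)) :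
      (tensor M (tensor M (tpow M k))).carrier) ∈ symRel M (k + 2) := by
  have h : (Submodule.span ℂ (swapSet M (tpow M k)) :
      Submodule ℂ (tensor M (tensor M (tpow M k))).carrier) ≤ symRel M (k + 2) := le_sup_left
  refine h (Submodule.subset_span (s := swapSet M (tpow M k)) ?_)
  exact ⟨p, q, r, v, hv, w, hw, t, ht, rfl⟩

/-- Vectors supercommute in the symmetric powers. -/
theorem lmul_lmul {k : ℕ} {p q : ZMod 2} {v w : M.carrier} (hv : v ∈ M.part p) (hw : w ∈ M.part q)
    (x : (symPow M k).carrier) :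
    lmul M v (lmul M w x) = sgn (p * q) • lmul M w (lmul M v x) := by
  induction x using SuperSpace.hom_induction (M := (symPow M k).toSuperSpace) with
  | hadd x y hx hy => simp only [map_add, hx, hy, smul_add]
  | hom r x hx =>
    obtain ⟨t, ht, rfl⟩ := hx
    have h : ∀ (c : ℂ) (z : (tpow M (k + 1 + 1)).carrier),
        symMk M (k + 1 + 1) (c • z) = c • symMk M (k + 1 + 1) z := fun c z => map_smul _ c z
    refine Eq.trans ?_ (h (sgn (p * q)) _)
    exact (Submodule.Quotient.eq (symRel M (k + 2))).2 (swap_mem_symRel hv hw ht)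

/-- The tensor power carries the Leibniz action and the projection is equivariant. Together with
`act_symOne` this makes each homogeneous `x` act by a superderivation. -/
theorem act_lmul {k : ℕ} {p e : ZMod 2} {x : 𝔤.carrier} (hx : x ∈ 𝔤.part p) {v : M.carrier}
    (hv : v ∈ M.part e) (y : (symPow M k).carrier) :
    (symPow M (k + 1)).act x (lmul M v y) =
      lmul M (M.act x v) y + sgn (p * e) • lmul M v ((symPow M k).act x y) := by
  obtain ⟨t, rfl⟩ := symMk_surjective M k y
  change symMk M (k + 1) (tensorAct M (tpow M k) x (v ⊗ₜ[ℂ] t)) = _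
  rw [tensorAct_tmul hx hv]
  refine (LinearMap.map_add (symMk M (k + 1)) _ _).trans ?_
  exact congrArg _ (LinearMap.map_smul (symMk M (k + 1)) _ _)

theorem act_symOne (x : 𝔤.carrier) : (symPow M 0).act x (symOne M) = 0 := by
  change symMk M 0 (0 : ℂ) = 0
  exact map_zero _

section Lift

variable {X : Type*} [AddCommGroup X] [Module ℂ X] (ρ : M.carrier →ₗ[ℂ] X →ₗ[ℂ] X) (x₀ : X)

/-- The map `v₁ ⊗ ⋯ ⊗ v_k ↦ ρ(v₁) ⋯ ρ(v_k) x₀`. -/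
noncomputable def tpowLift : (k : ℕ) → (tpow M k).carrier →ₗ[ℂ] X
  | 0 => LinearMap.toSpanSingleton ℂ X x₀
  | k + 1 => TensorProduct.lift (ρ.compl₂ (tpowLift k))

/-- Swap relations die because the operators `ρ v` supercommute. A relation `v ⊗ t`, with `t` a
relation of lower degree, is sent to `ρ v` applied to zero. -/
theorem symRel_le_ker (hρ : ∀ p q, ∀ v ∈ M.part p, ∀ w ∈ M.part q, ∀ x,
      ρ v (ρ w x) = sgn (p * q) • ρ w (ρ v x)) :
    ∀ k, symRel M k ≤ LinearMap.ker (tpowLift ρ x₀ k)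
  | 0 => bot_le
  | 1 => bot_le
  | k + 2 => by
    refine sup_le (Submodule.span_le.2 ?_) (Submodule.map₂_le.2 ?_)
    · rintro _ ⟨e, d, c, m, hm, m', hm', t, _, rfl⟩
      refine (LinearMap.map_sub (tpowLift ρ x₀ (k + 2)) _ _).trans (sub_eq_zero.2 ?_)
      refine Eq.trans ?_ (LinearMap.map_smul (tpowLift ρ x₀ (k + 2)) _ _).symm
      exact hρ e d m hm m' hm' (tpowLift ρ x₀ k t)
    · intro v _ t ht
      have h : tpowLift ρ x₀ (k + 1) t = 0 := symRel_le_ker hρ (k + 1) ht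
      change ρ v (tpowLift ρ x₀ (k + 1) t) = 0
      rw [h, map_zero]

/-- The map `v₁ ⋯ v_k ↦ ρ(v₁) ⋯ ρ(v_k) x₀` on the symmetric power, for supercommuting `ρ(v)`. -/
noncomputable def symLift (hρ : ∀ p q, ∀ v ∈ M.part p, ∀ w ∈ M.part q, ∀ x,
      ρ v (ρ w x) = sgn (p * q) • ρ w (ρ v x)) (k : ℕ) : (symPow M k).carrier →ₗ[ℂ] X :=
  (symRel M k).liftQ (tpowLift ρ x₀ k) (symRel_le_ker ρ x₀ hρ k)

variable (hρ : ∀ p q, ∀ v ∈ M.part p, ∀ w ∈ M.part q, ∀ x,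
      ρ v (ρ w x) = sgn (p * q) • ρ w (ρ v x))

theorem symLift_symOne : symLift ρ x₀ hρ 0 (symOne M) = x₀ := one_smul ℂ x₀

theorem symLift_lmul {k : ℕ} (v : M.carrier) (x : (symPow M k).carrier) :
    symLift ρ x₀ hρ (k + 1) (lmul M v x) = ρ v (symLift ρ x₀ hρ k x) := by
  obtain ⟨t, rfl⟩ := symMk_surjective M k x
  rfl

end Lift

/-! ### Merges -/

variable (M) in
/-- Multiplication by a vector, raising the degree of a family of elements. -/
noncomputable def lmulTotal : M.carrier →ₗ[ℂ] (∀ m, (symPow M m).carrier) →ₗ[ℂ]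
    (∀ m, (symPow M m).carrier) :=
  LinearMap.mk₂ ℂ (fun v φ m => match m with
      | 0 => 0
      | m + 1 => lmul M v (φ m))
    (by intro v w φ; ext m; cases m <;> simp)
    (by intro c v φ; ext m; cases m <;> simp)
    (by intro v φ ψ; ext m; cases m <;> simp)
    (by intro c v φ; ext m; cases m <;> simp)

theorem lmulTotal_zero (v : M.carrier) (φ : ∀ m, (symPow M m).carrier) :
    lmulTotal M v φ 0 = 0 := rfl

theorem lmulTotal_succ (v : M.carrier) (φ : ∀ m, (symPow M m).carrier) (m : ℕ) :
    lmulTotal M v φ (m + 1) = lmul M v (φ m) := rfl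

variable (M) in
/-- The multiplication `S^k(M) ⊗ S^l(M) → S^m(M)` for `k + l = m`, as a bilinear map. -/
noncomputable def merge (k l m : ℕ) :
    (symPow M k).carrier →ₗ[ℂ] (symPow M l).carrier →ₗ[ℂ] (symPow M m).carrier :=
  -- `symLift` needs a single space on which all operators act, whatever degree they reach; families
  -- over all degrees provide one. The start is the inclusion of degree `l` and the component `m` is
  -- read off at the end, so the result is zero unless `k + l = m`.
  LinearMap.compr₂ (symLift (X := (symPow M l).carrier →ₗ[ℂ] (∀ m, (symPow M m).carrier))
    ((LinearMap.llcomp ℂ (symPow M l).carrier (∀ m, (symPow M m).carrier)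
      (∀ m, (symPow M m).carrier)) ∘ₗ (lmulTotal M))
    (LinearMap.single ℂ (fun m => (symPow M m).carrier) l) (by
      intro p q v hv w hw x
      ext b m
      change lmulTotal M v (lmulTotal M w (x b)) m =
        sgn (p * q) • lmulTotal M w (lmulTotal M v (x b)) m
      rcases m with _ | _ | m
      · simp [lmulTotal_zero]
      · simp [lmulTotal_zero, lmulTotal_succ]
      · simp only [lmulTotal_succ]
        exact lmul_lmul hv hw _) k) (LinearMap.proj m)

theorem merge_symOne (l : ℕ) (b : (symPow M l).carrier) : merge M 0 l l (symOne M) b = b := by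
  rw [merge, LinearMap.compr₂_apply, symLift_symOne]
  simp

theorem merge_lmul (k l m : ℕ) (v : M.carrier) (a : (symPow M k).carrier)
    (b : (symPow M l).carrier) :
    merge M (k + 1) l (m + 1) (lmul M v a) b = lmul M v (merge M k l m a b) := by
  rw [merge, LinearMap.compr₂_apply, symLift_lmul]
  rfl

/-! ### Splits -/

variable (M) in
/-- The super tensor product of `S^k(M)` and `S^l(M)`. -/
noncomputable abbrev sym₂ (k l : ℕ) : SuperModule 𝔤 := tensor (symPow M k) (symPow M l)

variable (M) in
/-- Multiplication by a vector with values in degree `k`; zero if `k = 0`. -/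
noncomputable def lmulPred : (k : ℕ) →
    M.carrier →ₗ[ℂ] (symPow M (k - 1)).carrier →ₗ[ℂ] (symPow M k).carrier
  -- For `k = 0` the source is `S^0(M)` only because of truncated subtraction; the zero map treats
  -- it as the zero space `S^(-1)(M)`.
  | 0 => 0
  | _ + 1 => lmul M

theorem lmulPred_zero (v : M.carrier) : lmulPred M 0 v = 0 := rfl

theorem lmulPred_succ (k : ℕ) (v : M.carrier) : lmulPred M (k + 1) v = lmul M v := rfl

theorem lmulPred_linPart (k : ℕ) {p : ZMod 2} {v : M.carrier} (hv : v ∈ M.part p) :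
    lmulPred M k v ∈ linPart (symPow M (k - 1)).toSuperSpace (symPow M k).toSuperSpace p := by
  cases k with
  | zero => exact zero_mem _
  | succ k => exact lmul_linPart hv

/-- For `k ≥ 2` this is `lmul_lmul`; for smaller `k` each composite contains a zero factor. -/
theorem lmulPred_comp_lmulPred (k : ℕ) {p q : ZMod 2} {v w : M.carrier} (hv : v ∈ M.part p)
    (hw : w ∈ M.part q) :
    lmulPred M k v ∘ₗ lmulPred M (k - 1) w =
      sgn (p * q) • (lmulPred M k w ∘ₗ lmulPred M (k - 1) v) := by
  rcases k with _ | _ | k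
  · exact (smul_zero _).symm
  · refine LinearMap.ext fun x => ?_
    exact ((map_zero (lmul M v)).trans (smul_zero (sgn (p * q))).symm).trans
      (congrArg _ (map_zero (lmul M w)).symm)
  · exact LinearMap.ext fun x => lmul_lmul hv hw x

section TensorMap

variable {A B C D E F : SuperSpace} {p : ZMod 2}

/-- This and the next lemma are the cases of the interchange law in which one of the two maps that
pass each other is even, so that no sign appears. -/
theorem tensorMap_id_comp (f : B →ₗ[ℂ] C) {g : E →ₗ[ℂ] F} {h : A →ₗ[ℂ] B} (k : D →ₗ[ℂ] E)
    (hg : g ∈ linPart E F 0) (hh : h ∈ linPart A B p) :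
    tensorMap f g ∘ₗ tensorMap h k = tensorMap (f ∘ₗ h) (g ∘ₗ k) := by
  rw [tensorMap_comp f k hg hh, zero_mul, sgn_zero, one_smul]

theorem tensorMap_comp_id (f : B →ₗ[ℂ] C) {g : E →ₗ[ℂ] F} {h : A →ₗ[ℂ] B} (k : D →ₗ[ℂ] E)
    (hg : g ∈ linPart E F p) (hh : h ∈ linPart A B 0) :
    tensorMap f g ∘ₗ tensorMap h k = tensorMap (f ∘ₗ h) (g ∘ₗ k) := by
  rw [tensorMap_comp f k hg hh, mul_zero, sgn_zero, one_smul]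

theorem tensorMap_zero_left (g : E →ₗ[ℂ] F) : tensorMap (0 : A →ₗ[ℂ] B) g = 0 := by
  have h := tensorMap_smul_left 0 (0 : A →ₗ[ℂ] B) g
  rwa [zero_smul, zero_smul] at h

theorem tensorMap_zero_right (f : A →ₗ[ℂ] B) : tensorMap f (0 : E →ₗ[ℂ] F) = 0 := by
  have h := tensorMap_smul_right 0 f (0 : E →ₗ[ℂ] F)
  rwa [zero_smul, zero_smul] at h

end TensorMap

variable (M) in
/-- Multiplication by a vector on families of elements of the `S^k(M) ⊗ S^l(M)`. -/
noncomputable def lmulTotal₂ : M.carrier →ₗ[ℂ] (∀ k l, (sym₂ M k l).carrier) →ₗ[ℂ]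
    (∀ k l, (sym₂ M k l).carrier) :=
  -- This is left multiplication by the primitive element `v ⊗ 1 + 1 ⊗ v`; each summand reaches
  -- bidegree `(k, l)` from one degree lower in one of the factors.
  LinearMap.mk₂ ℂ (fun v φ k l => tensorMap (lmulPred M k v) LinearMap.id (φ (k - 1) l) +
      tensorMap LinearMap.id (lmulPred M l v) (φ k (l - 1)))
    (by
      intro v w φ; ext k l
      simp only [map_add, tensorMap_add_left, tensorMap_add_right, LinearMap.add_apply,
        Pi.add_apply]
      abel)
    (by
      intro c v φ; ext k l
      simp only [map_smul, tensorMap_smul_left, tensorMap_smul_right, LinearMap.smul_apply,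
        Pi.smul_apply, smul_add])
    (by intro v φ ψ; ext k l; simp only [map_add, Pi.add_apply]; abel)
    (by intro c v φ; ext k l; simp only [map_smul, Pi.smul_apply, smul_add])

theorem lmulTotal₂_apply (v : M.carrier) (φ : ∀ k l, (sym₂ M k l).carrier) (k l : ℕ) :
    lmulTotal₂ M v φ k l = tensorMap (lmulPred M k v) LinearMap.id (φ (k - 1) l) +
      tensorMap LinearMap.id (lmulPred M l v) (φ k (l - 1)) := rfl

/-- The terms in which both vectors act on the same factor supercommute there. For the mixed terms,
`(v ⊗ 1)(1 ⊗ w) = v ⊗ w` while `(1 ⊗ w)(v ⊗ 1) = (-1)^(|v||w|) v ⊗ w`. So the elements `v ⊗ 1 + 1 ⊗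
v` supercommute, and the universal property yields the comultiplication. -/
theorem lmulTotal₂_comm {p q : ZMod 2} {v w : M.carrier} (hv : v ∈ M.part p)
    (hw : w ∈ M.part q) (φ : ∀ k l, (sym₂ M k l).carrier) :
    lmulTotal₂ M v (lmulTotal₂ M w φ) = sgn (p * q) • lmulTotal₂ M w (lmulTotal₂ M v φ) := by
  ext k l
  rw [Pi.smul_apply, Pi.smul_apply]
  simp only [lmulTotal₂_apply, map_add, smul_add]
  simp only [← LinearMap.comp_apply]
  rw [tensorMap_id_comp _ _ linPart_id (lmulPred_linPart _ hw),
    tensorMap_id_comp _ _ linPart_id linPart_id,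
    tensorMap_comp _ _ (lmulPred_linPart _ hv) (lmulPred_linPart _ hw),
    tensorMap_comp_id _ _ (lmulPred_linPart _ hv) linPart_id,
    tensorMap_id_comp _ _ linPart_id (lmulPred_linPart _ hv),
    tensorMap_id_comp _ _ linPart_id linPart_id,
    tensorMap_comp _ _ (lmulPred_linPart _ hw) (lmulPred_linPart _ hv),
    tensorMap_comp_id _ _ (lmulPred_linPart _ hw) linPart_id,
    lmulPred_comp_lmulPred k hv hw, lmulPred_comp_lmulPred l hv hw, tensorMap_smul_left,
    tensorMap_smul_right]
  simp only [LinearMap.smul_apply, smul_smul, mul_comm q p, sgn_mul_self, one_smul,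
    LinearMap.comp_id, LinearMap.id_comp]
  abel

variable (M) in
/-- The family whose only nonzero element is `1 ⊗ 1` in `S^0(M) ⊗ S^0(M)`. -/
noncomputable def symOne₂ : ∀ k l, (sym₂ M k l).carrier
  | 0, 0 => symOne M ⊗ₜ[ℂ] symOne M
  | _, _ => 0

variable (M) in
/-- The comultiplication `S^m(M) → S^k(M) ⊗ S^l(M)` for `k + l = m`. -/
noncomputable def split (k l m : ℕ) : (symPow M m).carrier →ₗ[ℂ] (sym₂ M k l).carrier :=
  (LinearMap.proj l ∘ₗ LinearMap.proj k) ∘ₗ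
    symLift (lmulTotal₂ M) (symOne₂ M) (fun _ _ _ hv _ hw φ => lmulTotal₂_comm hv hw φ) m

theorem split_symOne : split M 0 0 0 (symOne M) = symOne M ⊗ₜ[ℂ] symOne M := by
  rw [split, LinearMap.comp_apply, symLift_symOne]
  rfl

/-- The recursion `Δ(v x) = (v ⊗ 1 + 1 ⊗ v) Δ(x)`. With the value on the unit it determines all
splits, and the identities between splits are deduced from it. -/
theorem split_lmul (k l m : ℕ) (v : M.carrier) (x : (symPow M m).carrier) :
    split M k l (m + 1) (lmul M v x) =
      tensorMap (lmulPred M k v) LinearMap.id (split M (k - 1) l m x) +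
        tensorMap LinearMap.id (lmulPred M l v) (split M k (l - 1) m x) := by
  rw [split, LinearMap.comp_apply, symLift_lmul]
  rfl

end SymPow

end SuperModule

namespace SuperModule

open SuperSpace

section Bialgebra

variable {𝔤 : LieSuperalgebra} {M : SuperModule 𝔤}

variable (M) in
/-- A vector, as an element of `S^1(M)`. -/
noncomputable def vec : M.carrier →ₗ[ℂ] (symPow M 1).carrier := (lmul M).flip (symOne M)

theorem vec_apply (v : M.carrier) : vec M v = lmul M v (symOne M) := rfl

theorem vec_mem {p : ZMod 2} {v : M.carrier} (hv : v ∈ M.part p) : vec M v ∈ (symPow M 1).part p :=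
  lmul_mem hv symOne_mem (add_zero p)

/-- Since `S^0(M)` is spanned by the unit, `S^1(M)` is `M` itself; whatever travels along a rung of
label `1` is a vector. -/
theorem exists_vec {p : ZMod 2} {x : (symPow M 1).carrier} (hx : x ∈ (symPow M 1).part p) :
    ∃ v ∈ M.part p, x = vec M v := by
  refine symPart_induction (k := 0) (C := fun x => ∃ v ∈ M.part p, x = vec M v) hx
    ⟨0, zero_mem _, (map_zero _).symm⟩ ?_ ?_
  · rintro _ _ ⟨v, hv, rfl⟩ ⟨w, hw, rfl⟩
    exact ⟨v + w, add_mem hv hw, (map_add _ _ _).symm⟩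
  · intro r s hrs v hv y hy
    obtain ⟨⟨c, rfl⟩, rfl | h⟩ := symPart_zero_cases hy
    · rw [add_zero] at hrs
      subst hrs
      exact ⟨c • v, Submodule.smul_mem _ c hv, by rw [map_smul, map_smul, vec_apply]⟩
    · exact ⟨0, zero_mem _, by rw [h, map_zero, map_zero]⟩

/-! ### Merges -/

theorem merge_symOne_right (k : ℕ) (a : (symPow M k).carrier) : merge M k 0 k a (symOne M) = a := by
  induction k with
  | zero =>
    obtain ⟨c, rfl⟩ := exists_smul_symOne a
    rw [map_smul, LinearMap.smul_apply, merge_symOne]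
  | succ k ih =>
    have h : (merge M (k + 1) 0 (k + 1)).flip (symOne M) = LinearMap.id :=
      sym_succ_ext fun p v _ q x _ => by
        rw [LinearMap.flip_apply, merge_lmul, ih, LinearMap.id_apply]
    exact LinearMap.congr_fun h a

theorem merge_vec (l : ℕ) (v : M.carrier) (b : (symPow M l).carrier) :
    merge M 1 l (l + 1) (vec M v) b = lmul M v b := by
  rw [vec_apply, merge_lmul, merge_symOne]

/-- A product lies in degree `k + l`, so asking for another degree gives zero. This and the next
lemma allow parities of products to be computed with no condition on the labels. -/
theorem merge_symOne_ne {l m : ℕ} (h : l ≠ m) : merge M 0 l m (symOne M) = 0 := by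
  ext b
  rw [merge, LinearMap.compr₂_apply, symLift_symOne]
  simp [h.symm]

theorem merge_lmul_zero (k l : ℕ) (v : M.carrier) (a : (symPow M k).carrier) :
    merge M (k + 1) l 0 (lmul M v a) = 0 := by
  ext b
  rw [merge, LinearMap.compr₂_apply, symLift_lmul]
  rfl

theorem merge_mem {k l m : ℕ} {p q r : ZMod 2} {a : (symPow M k).carrier}
    {b : (symPow M l).carrier} (ha : a ∈ (symPow M k).part p) (hb : b ∈ (symPow M l).part q)
    (hr : p + q = r) : merge M k l m a b ∈ (symPow M m).part r := by
  induction k generalizing m p r with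
  | zero =>
    obtain ⟨⟨c, rfl⟩, rfl | h⟩ := symPart_zero_cases ha
    · rw [zero_add] at hr
      subst hr
      rw [map_smul, LinearMap.smul_apply]
      by_cases h : l = m
      · subst h
        rw [merge_symOne]
        exact Submodule.smul_mem _ c hb
      · rw [merge_symOne_ne h]
        exact Submodule.smul_mem _ c (zero_mem _)
    · rw [h, map_zero, LinearMap.zero_apply]; exact zero_mem _
  | succ k ih =>
    refine symPart_induction (C := fun a => merge M (k + 1) l m a b ∈ _) ha ?_ ?_ ?_
    · rw [map_zero, LinearMap.zero_apply]; exact zero_mem _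
    · intro x y hx hy; rw [map_add, LinearMap.add_apply]; exact add_mem hx hy
    · intro e d hed v hv y hy
      cases m with
      | zero => rw [merge_lmul_zero]; exact zero_mem _
      | succ m =>
        rw [merge_lmul]
        exact lmul_mem hv (ih hy rfl) (by rw [← hr, ← hed]; ring)

/-- A vector can be moved to the front of a product. -/
theorem merge_lmul_right {k l m : ℕ} (h : k + l = m) {p q : ZMod 2} {a : (symPow M k).carrier}
    (ha : a ∈ (symPow M k).part p) {v : M.carrier} (hv : v ∈ M.part q) (b : (symPow M l).carrier) :
    merge M k (l + 1) (m + 1) a (lmul M v b) = sgn (p * q) • lmul M v (merge M k l m a b) := by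
  induction k generalizing m p with
  | zero =>
    rw [zero_add] at h
    subst h
    obtain ⟨⟨c, rfl⟩, rfl | h⟩ := symPart_zero_cases ha
    · rw [zero_mul, sgn_zero, one_smul]
      simp only [map_smul, LinearMap.smul_apply, merge_symOne]
    · rw [h]; simp
  | succ k ih =>
    obtain ⟨m, rfl⟩ : ∃ m', m = m' + 1 := ⟨k + l, by omega⟩
    refine symPart_induction (C := fun a => merge M (k + 1) (l + 1) (m + 1 + 1) a (lmul M v b) =
      sgn (p * q) • lmul M v (merge M (k + 1) l (m + 1) a b)) ha ?_ ?_ ?_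
    · simp
    · intro x y hx hy; simp only [map_add, LinearMap.add_apply, hx, hy, smul_add]
    · intro e d hed w hw y hy
      rw [merge_lmul, merge_lmul, ih (by omega) hy, map_smul, lmul_lmul hw hv, smul_smul,
        ← sgn_add, ← hed]
      congr 2
      ring

theorem merge_vec_right (k : ℕ) {p q : ZMod 2} {a : (symPow M k).carrier}
    (ha : a ∈ (symPow M k).part p) {v : M.carrier} (hv : v ∈ M.part q) :
    merge M k 1 (k + 1) a (vec M v) = sgn (p * q) • lmul M v a := by
  rw [vec_apply, merge_lmul_right (l := 0) (add_zero k) ha hv, merge_symOne_right]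

/-- `merge_lmul` takes the first vector of `a` out of both sides, so induction on the degree of `a`
leaves the case of a scalar. -/
theorem merge_assoc {h k l r s t : ℕ} (h₁ : h + k = r) (h₂ : r + l = t) (h₃ : k + l = s)
    (h₄ : h + s = t) (a : (symPow M h).carrier) (b : (symPow M k).carrier)
    (c : (symPow M l).carrier) :
    merge M r l t (merge M h k r a b) c = merge M h s t a (merge M k l s b c) := by
  induction h generalizing r t with
  | zero =>
    rw [zero_add] at h₁ h₄
    subst h₁ h₄
    obtain ⟨x, rfl⟩ := exists_smul_symOne a
    simp only [map_smul, LinearMap.smul_apply, merge_symOne]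
  | succ h ih =>
    obtain ⟨r, rfl⟩ : ∃ r', r = r' + 1 := ⟨h + k, by omega⟩
    obtain ⟨t, rfl⟩ : ∃ t', t = t' + 1 := ⟨r + l, by omega⟩
    have e : ((merge M (r + 1) l (t + 1)).flip c) ∘ₗ ((merge M (h + 1) k (r + 1)).flip b) =
        (merge M (h + 1) s (t + 1)).flip (merge M k l s b c) :=
      sym_succ_ext fun p v _ q x _ => by
        simp only [LinearMap.comp_apply, LinearMap.flip_apply, merge_lmul]
        rw [ih (by omega) (by omega) (by omega)]
    exact LinearMap.congr_fun e a

variable (M) in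
/-- The multiplication `S^k(M) ⊗ S^l(M) → S^m(M)` for `k + l = m`. -/
noncomputable def mergeLin (k l m : ℕ) : (sym₂ M k l).carrier →ₗ[ℂ] (symPow M m).carrier :=
  TensorProduct.lift (merge M k l m)

theorem mergeLin_tmul (k l m : ℕ) (a : (symPow M k).carrier) (b : (symPow M l).carrier) :
    mergeLin M k l m (a ⊗ₜ[ℂ] b) = merge M k l m a b := rfl

theorem mergeLin_linPart (k l m : ℕ) :
    mergeLin M k l m ∈ linPart (sym₂ M k l).toSuperSpace (symPow M m).toSuperSpace 0 := by
  intro e x hx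
  rw [add_zero]
  refine tensorPart_induction (M := (symPow M k).toSuperSpace) (N := (symPow M l).toSuperSpace)
    (C := fun x => mergeLin M k l m x ∈ (symPow M m).part e) hx ?_ ?_ ?_
  · rw [map_zero]; exact zero_mem _
  · intro x y hx hy; rw [map_add]; exact add_mem hx hy
  · intro p q hpq a ha b hb
    exact merge_mem ha hb hpq

theorem mergeLin_comp_lmul_left (k l m : ℕ) (v : M.carrier) :
    mergeLin M (k + 1) l (m + 1) ∘ₗ tensorMap (lmul M v) LinearMap.id =
      lmul M v ∘ₗ mergeLin M k l m := by
  refine tmul_ext (M := (symPow M k).toSuperSpace) (N := (symPow M l).toSuperSpace)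
    fun e d a ha b hb => ?_
  rw [LinearMap.comp_apply, tensorMap_tmul _ linPart_id ha, zero_mul, sgn_zero, one_smul]
  exact merge_lmul k l m v a b

theorem mergeLin_comp_lmul_right {k l m : ℕ} (h : k + l = m) {p : ZMod 2} {v : M.carrier}
    (hv : v ∈ M.part p) :
    mergeLin M k (l + 1) (m + 1) ∘ₗ tensorMap LinearMap.id (lmul M v) =
      lmul M v ∘ₗ mergeLin M k l m := by
  refine tmul_ext (M := (symPow M k).toSuperSpace) (N := (symPow M l).toSuperSpace)
    fun e d a ha b hb => ?_
  rw [LinearMap.comp_apply, tensorMap_tmul _ (lmul_linPart hv) ha, map_smul, LinearMap.id_apply,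
    mergeLin_tmul, merge_lmul_right h ha hv, smul_smul, mul_comm e p, sgn_mul_self, one_smul]
  rfl

/-! ### Splits -/

/-- In the recursion both summands insert `v` and raise the parity by `|v|`. No condition on the
labels is needed, since unmatched components vanish. -/
theorem split_linPart (k l m : ℕ) :
    split M k l m ∈ linPart (symPow M m).toSuperSpace (sym₂ M k l).toSuperSpace 0 := by
  induction m generalizing k l with
  | zero =>
    intro e x hx
    obtain ⟨⟨c, rfl⟩, rfl | h⟩ := symPart_zero_cases hx
    · rw [map_smul]
      refine Submodule.smul_mem _ c ?_
      rw [split, LinearMap.comp_apply, symLift_symOne]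
      rcases k with _ | k <;> rcases l with _ | l
      · exact tmul_mem_tensorPart symOne_mem symOne_mem
      all_goals exact zero_mem _
    · rw [h, map_zero]; exact zero_mem _
  | succ m ih =>
    intro e x hx
    refine symPart_induction (C := fun x => split M k l (m + 1) x ∈ (sym₂ M k l).part (e + 0))
      hx ?_ ?_ ?_
    · rw [map_zero]; exact zero_mem _
    · intro x y hx hy; rw [map_add]; exact add_mem hx hy
    · intro p q hpq v hv y hy
      rw [split_lmul]
      have h₁ := tensorMap_mem (lmulPred_linPart k hv) (linPart_id (M := (symPow M l).toSuperSpace))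
        _ _ (ih (k - 1) l _ _ hy)
      have h₂ := tensorMap_mem (linPart_id (M := (symPow M k).toSuperSpace)) (lmulPred_linPart l hv)
        _ _ (ih k (l - 1) _ _ hy)
      rw [show q + 0 + (p + 0) = e + 0 by rw [← hpq]; ring] at h₁
      rw [show q + 0 + (0 + p) = e + 0 by rw [← hpq]; ring] at h₂
      exact add_mem h₁ h₂

/-- A product with a vector never lies in degree zero, so only `1 ⊗ v` contributes to the recursion,
and it passes the even unit without a sign. The mirror image follows for `split_zero_right`. -/
theorem split_zero_left (m : ℕ) (x : (symPow M m).carrier) :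
    split M 0 m m x = symOne M ⊗ₜ[ℂ] x := by
  induction m with
  | zero =>
    obtain ⟨c, rfl⟩ := exists_smul_symOne x
    rw [map_smul, split_symOne, TensorProduct.tmul_smul]
  | succ m ih =>
    have h : split M 0 (m + 1) (m + 1) = TensorProduct.mk ℂ _ _ (symOne M) :=
      sym_succ_ext fun p v hv q y _ => by
        rw [split_lmul, lmulPred_zero, tensorMap_zero_left, lmulPred_succ, LinearMap.zero_apply,
          zero_add]
        refine (congrArg _ (ih y)).trans ?_
        rw [tensorMap_tmul _ (lmul_linPart hv) symOne_mem, mul_zero, sgn_zero, one_smul]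
        rfl
    exact LinearMap.congr_fun h x

theorem split_zero_right (m : ℕ) (x : (symPow M m).carrier) :
    split M m 0 m x = x ⊗ₜ[ℂ] symOne M := by
  induction m with
  | zero =>
    obtain ⟨c, rfl⟩ := exists_smul_symOne x
    rw [map_smul, split_symOne, TensorProduct.smul_tmul']
  | succ m ih =>
    have h : split M (m + 1) 0 (m + 1) = (TensorProduct.mk ℂ _ _).flip (symOne M) :=
      sym_succ_ext fun p v hv q y hy => by
        rw [split_lmul, lmulPred_zero, tensorMap_zero_right, lmulPred_succ, LinearMap.zero_apply,
          add_zero]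
        refine (congrArg _ (ih y)).trans ?_
        rw [tensorMap_tmul _ linPart_id hy, zero_mul, sgn_zero, one_smul]
        rfl
    exact LinearMap.congr_fun h x

theorem split_comp_lmul (k l m : ℕ) (v : M.carrier) :
    split M k l (m + 1) ∘ₗ lmul M v =
      tensorMap (lmulPred M k v) LinearMap.id ∘ₗ split M (k - 1) l m +
        tensorMap LinearMap.id (lmulPred M l v) ∘ₗ split M k (l - 1) m :=
  LinearMap.ext fun x => split_lmul k l m v x

/-- The recursion in a form that can be applied below another split, where `m` may be zero; in that
case every term vanishes. -/
theorem split_comp_lmulPred {k l m : ℕ} (h : k + l = m) (v : M.carrier) :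
    split M k l m ∘ₗ lmulPred M m v =
      tensorMap (lmulPred M k v) LinearMap.id ∘ₗ split M (k - 1) l (m - 1) +
        tensorMap LinearMap.id (lmulPred M l v) ∘ₗ split M k (l - 1) (m - 1) := by
  cases m with
  | zero =>
    obtain ⟨rfl, rfl⟩ : k = 0 ∧ l = 0 := by omega
    rw [lmulPred_zero, tensorMap_zero_left, tensorMap_zero_right, LinearMap.zero_comp, add_zero]
    exact LinearMap.comp_zero _
  | succ m => exact split_comp_lmul k l m v

/-- Digon removal. -/
theorem mergeLin_split {k l m : ℕ} (h : k + l = m) :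
    mergeLin M k l m ∘ₗ split M k l m = (Nat.choose m l : ℂ) • LinearMap.id := by
  induction m generalizing k l with
  | zero =>
    obtain ⟨rfl, rfl⟩ : k = 0 ∧ l = 0 := by omega
    refine sym_zero_ext ?_
    rw [LinearMap.comp_apply, split_symOne, mergeLin_tmul, merge_symOne]
    simp
  | succ m ih =>
    -- If a label is zero the split is `1 ⊗ x` or `x ⊗ 1` and the merge returns `x`. Otherwise both
    -- terms of the recursion have genuine labels and the induction hypothesis applies to each.
    rcases k with _ | k
    · obtain rfl : l = m + 1 := by omega
      ext x
      rw [LinearMap.comp_apply, split_zero_left, mergeLin_tmul, merge_symOne]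
      simp
    rcases l with _ | l
    · obtain rfl : k = m := by omega
      ext x
      rw [LinearMap.comp_apply, split_zero_right, mergeLin_tmul, merge_symOne_right]
      simp
    refine sym_succ_ext fun p v hv q x _ => ?_
    have h₁ := LinearMap.congr_fun (mergeLin_comp_lmul_left k (l + 1) m v) (split M k (l + 1) m x)
    have h₂ := LinearMap.congr_fun (mergeLin_comp_lmul_right (k := k + 1) (l := l) (m := m)
      (by omega) hv) (split M (k + 1) l m x)
    have h₃ := LinearMap.congr_fun (ih (k := k) (l := l + 1) (by omega)) x
    have h₄ := LinearMap.congr_fun (ih (k := k + 1) (l := l) (by omega)) x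
    rw [LinearMap.comp_apply, split_lmul, map_add]
    refine (congrArg₂ (· + ·) h₁ h₂).trans ?_
    simp only [LinearMap.comp_apply, LinearMap.smul_apply, LinearMap.id_apply] at h₃ h₄ ⊢
    -- Pascal's rule: the first vector goes to the left factor in `choose m (l + 1)` ways and to the
    -- right factor in `choose m l` ways.
    rw [h₃, h₄, map_smul, map_smul, ← add_smul, Nat.choose_succ_succ]
    push_cast
    rw [add_comm (Nat.choose m l : ℂ)]

end Bialgebra

end SuperModule

namespace SuperModule

open SuperSpace

/-! ### Coassociativity, superderivations and equivariance -/

section Derivations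

variable {𝔤 : LieSuperalgebra} {M : SuperModule 𝔤}

/-- Coassociativity of splits. -/
theorem split_assoc {h k l r s t : ℕ} (h₁ : h + k = r) (h₂ : r + l = t) (h₃ : k + l = s)
    (h₄ : h + s = t) :
    (assoc (symPow M h).toSuperSpace (symPow M k).toSuperSpace (symPow M l).toSuperSpace).toLinearMap
        ∘ₗ tensorMap (split M h k r) LinearMap.id ∘ₗ split M r l t =
      tensorMap LinearMap.id (split M k l s) ∘ₗ split M h s t := by
  induction t generalizing h k l r s with
  | zero =>
    obtain ⟨rfl, rfl, rfl, rfl, rfl⟩ : h = 0 ∧ k = 0 ∧ l = 0 ∧ r = 0 ∧ s = 0 := by omega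
    refine sym_zero_ext ?_
    rw [LinearMap.comp_apply, LinearMap.comp_apply, LinearMap.comp_apply, split_symOne,
      tensorMap_tmul _ linPart_id symOne_mem, tensorMap_tmul _ (split_linPart _ _ _) symOne_mem,
      split_symOne, zero_mul, sgn_zero, one_smul, one_smul]
    rfl
  | succ t ih =>
    have hid : ∀ N : SuperSpace, (LinearMap.id : N →ₗ[ℂ] N) ∈ linPart N N 0 := fun _ => linPart_id
    refine sym_succ_ext fun p v hv q x _ => ?_
    suffices e : (assoc (symPow M h).toSuperSpace (symPow M k).toSuperSpace
          (symPow M l).toSuperSpace).toLinearMap ∘ₗ tensorMap (split M h k r) LinearMap.id ∘ₗ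
          (split M r l (t + 1) ∘ₗ SuperModule.lmul M v) =
        tensorMap LinearMap.id (split M k l s) ∘ₗ split M h s (t + 1) ∘ₗ SuperModule.lmul M v from
      LinearMap.congr_fun e x
    have P₁ := lmulPred_linPart h hv
    have P₂ := lmulPred_linPart k hv
    have P₃ := lmulPred_linPart l hv
    have P₄ := lmulPred_linPart r hv
    have P₅ := lmulPred_linPart s hv
    -- The induction hypothesis under an outer multiplication by `v`. For `h = 0` the truncated
    -- degrees no longer add up and the hypothesis is not available, but then the outer
    -- multiplication is zero. The same guard works for `k` and `l` in `i₂` and `i₃`.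
    have i₁ : tensorMap (lmulPred M h v) LinearMap.id ∘ₗ ((assoc (symPow M (h - 1)).toSuperSpace
          (symPow M k).toSuperSpace (symPow M l).toSuperSpace).toLinearMap ∘ₗ
          tensorMap (split M (h - 1) k (r - 1)) LinearMap.id ∘ₗ split M (r - 1) l t) =
        tensorMap (lmulPred M h v) LinearMap.id ∘ₗ
          (tensorMap LinearMap.id (split M k l s) ∘ₗ split M (h - 1) s t) := by
      rcases h with _ | h
      · rw [lmulPred_zero, tensorMap_zero_left, LinearMap.zero_comp, LinearMap.zero_comp]
      · exact congrArg _ (ih (by omega) (by omega) (by omega) (by omega))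
    have i₂ : tensorMap LinearMap.id (tensorMap (lmulPred M k v) LinearMap.id) ∘ₗ
          ((assoc (symPow M h).toSuperSpace
          (symPow M (k - 1)).toSuperSpace (symPow M l).toSuperSpace).toLinearMap ∘ₗ
          tensorMap (split M h (k - 1) (r - 1)) LinearMap.id ∘ₗ split M (r - 1) l t) =
        tensorMap LinearMap.id (tensorMap (lmulPred M k v) LinearMap.id) ∘ₗ
          (tensorMap LinearMap.id (split M (k - 1) l (s - 1)) ∘ₗ split M h (s - 1) t) := by
      rcases k with _ | k
      · rw [lmulPred_zero, tensorMap_zero_left, tensorMap_zero_right, LinearMap.zero_comp,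
          LinearMap.zero_comp]
      · exact congrArg _ (ih (by omega) (by omega) (by omega) (by omega))
    have i₃ : tensorMap LinearMap.id (tensorMap LinearMap.id (lmulPred M l v)) ∘ₗ
          ((assoc (symPow M h).toSuperSpace
          (symPow M k).toSuperSpace (symPow M (l - 1)).toSuperSpace).toLinearMap ∘ₗ
          tensorMap (split M h k r) LinearMap.id ∘ₗ split M r (l - 1) t) =
        tensorMap LinearMap.id (tensorMap LinearMap.id (lmulPred M l v)) ∘ₗ
          (tensorMap LinearMap.id (split M k (l - 1) (s - 1)) ∘ₗ split M h (s - 1) t) := by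
      rcases l with _ | l
      · rw [lmulPred_zero, tensorMap_zero_right, tensorMap_zero_right, LinearMap.zero_comp,
          LinearMap.zero_comp]
      · exact congrArg _ (ih (by omega) (by omega) (by omega) (by omega))
    -- Both sides expand into three terms, according to which of the three factors receives `v`. The
    -- equations `a₁`–`a₃` and `b₁`–`b₃` move this multiplication to the outside, where `i₁`–`i₃`
    -- apply.
    rw [split_comp_lmul, split_comp_lmul, LinearMap.comp_add, LinearMap.comp_add,
      LinearMap.comp_add]
    simp only [← LinearMap.comp_assoc]
    rw [LinearMap.comp_assoc (tensorMap (lmulPred M r v) LinearMap.id),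
      tensorMap_id_comp _ _ (hid _) P₄, split_comp_lmulPred h₁,
      LinearMap.comp_assoc (tensorMap LinearMap.id (lmulPred M l v)),
      tensorMap_id_comp _ _ (hid _) (hid _), tensorMap_id_comp _ _ (split_linPart _ _ _) P₁,
      tensorMap_comp_id _ _ (split_linPart _ _ _) (hid _), split_comp_lmulPred h₃]
    have a₁ : (assoc (symPow M h).toSuperSpace (symPow M k).toSuperSpace
          (symPow M l).toSuperSpace).toLinearMap ∘ₗ
          tensorMap (tensorMap (lmulPred M h v) LinearMap.id ∘ₗ split M (h - 1) k (r - 1))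
            (LinearMap.id ∘ₗ LinearMap.id) =
        tensorMap (lmulPred M h v) LinearMap.id ∘ₗ (assoc (symPow M (h - 1)).toSuperSpace
          (symPow M k).toSuperSpace (symPow M l).toSuperSpace).toLinearMap ∘ₗ
          tensorMap (split M (h - 1) k (r - 1)) LinearMap.id := by
      rw [← tensorMap_id_comp _ _ (hid _) (split_linPart _ _ _), ← LinearMap.comp_assoc,
        assoc_tensorMap, tensorMap_id, LinearMap.comp_assoc]
    have a₂ : (assoc (symPow M h).toSuperSpace (symPow M k).toSuperSpace
          (symPow M l).toSuperSpace).toLinearMap ∘ₗ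
          tensorMap (tensorMap LinearMap.id (lmulPred M k v) ∘ₗ split M h (k - 1) (r - 1))
            (LinearMap.id ∘ₗ LinearMap.id) =
        tensorMap LinearMap.id (tensorMap (lmulPred M k v) LinearMap.id) ∘ₗ
          (assoc (symPow M h).toSuperSpace (symPow M (k - 1)).toSuperSpace
            (symPow M l).toSuperSpace).toLinearMap ∘ₗ
          tensorMap (split M h (k - 1) (r - 1)) LinearMap.id := by
      rw [← tensorMap_id_comp _ _ (hid _) (split_linPart _ _ _), ← LinearMap.comp_assoc,
        assoc_tensorMap, LinearMap.comp_assoc]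
    have a₃ : (assoc (symPow M h).toSuperSpace (symPow M k).toSuperSpace
          (symPow M l).toSuperSpace).toLinearMap ∘ₗ
          tensorMap (split M h k r ∘ₗ LinearMap.id) (LinearMap.id ∘ₗ lmulPred M l v) =
        tensorMap LinearMap.id (tensorMap LinearMap.id (lmulPred M l v)) ∘ₗ
          (assoc (symPow M h).toSuperSpace (symPow M k).toSuperSpace
            (symPow M (l - 1)).toSuperSpace).toLinearMap ∘ₗ
          tensorMap (split M h k r) LinearMap.id := by
      rw [← LinearMap.comp_assoc, ← assoc_tensorMap, tensorMap_id, LinearMap.comp_assoc,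
        tensorMap_comp_id _ _ P₃ (split_linPart _ _ _)]
      rfl
    have b₁ : tensorMap (LinearMap.id ∘ₗ lmulPred M h v) (split M k l s ∘ₗ LinearMap.id) =
        tensorMap (lmulPred M h v) LinearMap.id ∘ₗ tensorMap LinearMap.id (split M k l s) := by
      rw [tensorMap_id_comp _ _ (hid _) (hid _)]
      rfl
    have b₂ : tensorMap (LinearMap.id ∘ₗ LinearMap.id : (symPow M h).carrier →ₗ[ℂ] _)
          (tensorMap (lmulPred M k v) LinearMap.id ∘ₗ split M (k - 1) l (s - 1)) =
        tensorMap LinearMap.id (tensorMap (lmulPred M k v) LinearMap.id) ∘ₗ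
          tensorMap LinearMap.id (split M (k - 1) l (s - 1)) := by
      rw [tensorMap_comp_id _ _ (tensorMap_mem P₂ (hid _)) (hid _)]
    have b₃ : tensorMap (LinearMap.id ∘ₗ LinearMap.id : (symPow M h).carrier →ₗ[ℂ] _)
          (tensorMap LinearMap.id (lmulPred M l v) ∘ₗ split M k (l - 1) (s - 1)) =
        tensorMap LinearMap.id (tensorMap LinearMap.id (lmulPred M l v)) ∘ₗ
          tensorMap LinearMap.id (split M k (l - 1) (s - 1)) := by
      rw [tensorMap_comp_id _ _ (tensorMap_mem (hid _) P₃) (hid _)]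
    rw [tensorMap_add_left, tensorMap_add_right, LinearMap.comp_add, LinearMap.add_comp,
      LinearMap.add_comp, a₁, a₂, a₃, b₁, b₂, b₃]
    simp only [LinearMap.comp_assoc]
    rw [i₁, i₂, i₃, add_assoc]

/-- The family of maps `D` is the superderivation of parity `p` that extends `z`. -/
structure IsDer (p : ZMod 2) (z : M.carrier →ₗ[ℂ] M.carrier)
    (D : ∀ k, (symPow M k).carrier →ₗ[ℂ] (symPow M k).carrier) : Prop where
  zero : D 0 = 0
  lmul : ∀ (k : ℕ) (q : ZMod 2), ∀ v ∈ M.part q, ∀ x : (symPow M k).carrier,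
    D (k + 1) (lmul M v x) = SuperModule.lmul M (z v) x + sgn (p * q) • SuperModule.lmul M v (D k x)

theorem isDer_act {p : ZMod 2} {x : 𝔤.carrier} (hx : x ∈ 𝔤.part p) :
    IsDer p (M.act x) (fun k => (symPow M k).act x) where
  zero := sym_zero_ext (act_symOne x)
  lmul _ _ _ hv y := act_lmul hx hv y

theorem isDer_id : IsDer 0 (LinearMap.id : M.carrier →ₗ[ℂ] M.carrier)
    (fun k => (k : ℂ) • LinearMap.id) where
  zero := by simp
  lmul k q v hv x := by
    simp only [LinearMap.smul_apply, LinearMap.id_apply, map_smul, zero_mul, sgn_zero, one_smul]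
    push_cast
    rw [add_smul, one_smul]
    exact add_comm _ _

namespace IsDer

variable {p : ZMod 2} {z : M.carrier →ₗ[ℂ] M.carrier}
  {D : ∀ k, (symPow M k).carrier →ₗ[ℂ] (symPow M k).carrier}

/-- A superderivation kills `1` and is prescribed on vectors, so the Leibniz rule fixes it in all
degrees. Derivations given by different formulas are identified in this way. -/
theorem unique (hD : IsDer p z D)
    {D' : ∀ k, (symPow M k).carrier →ₗ[ℂ] (symPow M k).carrier} (hD' : IsDer p z D') (k : ℕ) :
    D k = D' k := by
  induction k with
  | zero => rw [hD.zero, hD'.zero]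
  | succ k ih =>
    exact sym_succ_ext fun q v hv _ x _ => by rw [hD.lmul k q v hv, hD'.lmul k q v hv, ih]

theorem linPart (hD : IsDer p z D) (hz : z ∈ linPart M.toSuperSpace M.toSuperSpace p) (k : ℕ) :
    D k ∈ SuperSpace.linPart (symPow M k).toSuperSpace (symPow M k).toSuperSpace p := by
  induction k with
  | zero => rw [hD.zero]; exact zero_mem _
  | succ k ih =>
    intro e x hx
    refine symPart_induction (C := fun x => D (k + 1) x ∈ (symPow M (k + 1)).part (e + p)) hx ?_ ?_ ?_
    · rw [map_zero]; exact zero_mem _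
    · intro x y hx hy; rw [map_add]; exact add_mem hx hy
    · intro q r hqr v hv y hy
      rw [hD.lmul k q v hv]
      refine add_mem (lmul_mem (hz q v hv) hy (by rw [← hqr]; ring))
        (Submodule.smul_mem _ _ (lmul_mem hv (ih r y hy) (by rw [← hqr]; ring)))

theorem comp_lmul (hD : IsDer p z D) (k : ℕ) {q : ZMod 2} {v : M.carrier} (hv : v ∈ M.part q) :
    D (k + 1) ∘ₗ SuperModule.lmul M v =
      SuperModule.lmul M (z v) + sgn (p * q) • (SuperModule.lmul M v ∘ₗ D k) :=
  LinearMap.ext fun x => hD.lmul k q v hv x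

theorem comp_lmulPred (hD : IsDer p z D) (k : ℕ) {q : ZMod 2} {v : M.carrier} (hv : v ∈ M.part q) :
    D k ∘ₗ lmulPred M k v = lmulPred M k (z v) + sgn (p * q) • (lmulPred M k v ∘ₗ D (k - 1)) := by
  cases k with
  | zero =>
    rw [hD.zero, LinearMap.zero_comp, lmulPred_zero, lmulPred_zero, LinearMap.zero_comp, smul_zero,
      add_zero]
  | succ k => exact hD.comp_lmul k hv

/-- The Leibniz rule for a vector extends to a product of any length by moving `D` past one vector
of `a` at a time; the signs accumulate to `(-1)^(|D||a|)`. -/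
theorem merge_apply (hD : IsDer p z D) {k l m : ℕ} (h : k + l = m) {q : ZMod 2} {a : (symPow M k).carrier}
    (ha : a ∈ (symPow M k).part q) (b : (symPow M l).carrier) :
    D m (merge M k l m a b) = merge M k l m (D k a) b + sgn (p * q) • merge M k l m a (D l b) := by
  induction k generalizing m q with
  | zero =>
    rw [zero_add] at h
    subst h
    rw [hD.zero]
    obtain ⟨⟨c, rfl⟩, rfl | h⟩ := symPart_zero_cases ha
    · simp [merge_symOne]
    · simp [h]
  | succ k ih =>
    obtain ⟨m, rfl⟩ : ∃ m', m = m' + 1 := ⟨k + l, by omega⟩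
    refine symPart_induction (C := fun a => D (m + 1) (merge M (k + 1) l (m + 1) a b) =
      merge M (k + 1) l (m + 1) (D (k + 1) a) b +
        sgn (p * q) • merge M (k + 1) l (m + 1) a (D l b)) ha ?_ ?_ ?_
    · simp
    · intro x y hx hy
      simp only [map_add, LinearMap.add_apply, hx, hy, smul_add]
      abel
    · intro e d hed v hv y hy
      rw [merge_lmul, hD.lmul m e v hv, ih (by omega) hy, hD.lmul k e v hv, ← hed,
        mul_add, sgn_add]
      simp only [map_add, map_smul, LinearMap.add_apply, LinearMap.smul_apply, merge_lmul, smul_add,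
        smul_smul, add_assoc]

theorem comp_mergeLin (hD : IsDer p z D)
    (hz : z ∈ SuperSpace.linPart M.toSuperSpace M.toSuperSpace p) {k l m : ℕ} (h : k + l = m) :
    D m ∘ₗ mergeLin M k l m = mergeLin M k l m ∘ₗ
      (tensorMap (D k) LinearMap.id + tensorMap LinearMap.id (D l)) := by
  refine tmul_ext (M := (symPow M k).toSuperSpace) (N := (symPow M l).toSuperSpace)
    fun e d a ha b hb => ?_
  rw [LinearMap.comp_apply, mergeLin_tmul, hD.merge_apply h ha, LinearMap.comp_apply,
    LinearMap.add_apply, tensorMap_tmul _ linPart_id ha, tensorMap_tmul _ (hD.linPart hz l) ha,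
    zero_mul, sgn_zero, one_smul, map_add, map_smul]
  rfl

/-- A superderivation is also a coderivation: the supercommutator of `D ⊗ 1 + 1 ⊗ D` with `v ⊗ 1 + 1
⊗ v` is `z(v) ⊗ 1 + 1 ⊗ z(v)`, so both sides obey the same recursion in the degree. -/
theorem split_comp (hD : IsDer p z D)
    (hz : z ∈ SuperSpace.linPart M.toSuperSpace M.toSuperSpace p) {k l m : ℕ} (h : k + l = m) :
    split M k l m ∘ₗ D m =
      (tensorMap (D k) LinearMap.id + tensorMap LinearMap.id (D l)) ∘ₗ split M k l m := by
  induction m generalizing k l with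
  | zero =>
    obtain ⟨rfl, rfl⟩ : k = 0 ∧ l = 0 := by omega
    rw [hD.zero, tensorMap_zero_left, tensorMap_zero_right, add_zero, LinearMap.zero_comp,
      LinearMap.comp_zero]
  | succ m ih =>
    have hid : ∀ N : SuperSpace, (LinearMap.id : N →ₗ[ℂ] N) ∈ SuperSpace.linPart N N 0 :=
      fun _ => linPart_id
    have hDp := hD.linPart hz
    refine sym_succ_ext fun q v hv _ x _ => ?_
    suffices e : split M k l (m + 1) ∘ₗ (D (m + 1) ∘ₗ SuperModule.lmul M v) =
        (tensorMap (D k) LinearMap.id + tensorMap LinearMap.id (D l)) ∘ₗ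
          (split M k l (m + 1) ∘ₗ SuperModule.lmul M v) from LinearMap.congr_fun e x
    have P₁ := lmulPred_linPart k hv
    have P₂ := lmulPred_linPart l hv
    have i₁ : tensorMap (lmulPred M k v) LinearMap.id ∘ₗ (split M (k - 1) l m ∘ₗ D m) =
        tensorMap (lmulPred M k v) LinearMap.id ∘ₗ
          ((tensorMap (D (k - 1)) LinearMap.id + tensorMap LinearMap.id (D l)) ∘ₗ
            split M (k - 1) l m) := by
      rcases k with _ | k
      · rw [lmulPred_zero, tensorMap_zero_left, LinearMap.zero_comp, LinearMap.zero_comp]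
      · exact congrArg _ (ih (by omega))
    have i₂ : tensorMap LinearMap.id (lmulPred M l v) ∘ₗ (split M k (l - 1) m ∘ₗ D m) =
        tensorMap LinearMap.id (lmulPred M l v) ∘ₗ
          ((tensorMap (D k) LinearMap.id + tensorMap LinearMap.id (D (l - 1))) ∘ₗ
            split M k (l - 1) m) := by
      rcases l with _ | l
      · rw [lmulPred_zero, tensorMap_zero_right, LinearMap.zero_comp, LinearMap.zero_comp]
      · exact congrArg _ (ih (by omega))
    have hs := sgn_mul_self (p * q)
    rw [hD.comp_lmul m hv, LinearMap.comp_add, LinearMap.comp_smul, split_comp_lmul,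
      split_comp_lmul, ← LinearMap.comp_assoc (D m), split_comp_lmul, LinearMap.add_comp]
    simp only [LinearMap.comp_assoc]
    rw [i₁, i₂]
    simp only [LinearMap.comp_add, LinearMap.add_comp, ← LinearMap.comp_assoc]
    rw [tensorMap_id_comp _ _ (hid _) (hDp _), tensorMap_id_comp _ _ (hid _) (hid _),
      tensorMap_comp _ _ P₂ (hDp _), tensorMap_comp_id _ _ P₂ (hid _),
      tensorMap_id_comp _ _ (hid _) P₁, tensorMap_id_comp _ _ (hid _) (hid _),
      tensorMap_comp _ _ (hDp _) P₁, tensorMap_comp_id _ _ (hDp _) (hid _),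
      hD.comp_lmulPred k hv, hD.comp_lmulPred l hv]
    simp only [tensorMap_add_left, tensorMap_add_right, tensorMap_smul_left, tensorMap_smul_right,
      LinearMap.comp_id, LinearMap.id_comp, LinearMap.add_comp, smul_add, LinearMap.smul_comp,
      smul_smul, mul_comm q p, hs, one_smul]
    abel

/-- An odd superderivation that extends an involution squares to the degree. -/
theorem comp_self {D : ∀ k, (symPow M k).carrier →ₗ[ℂ] (symPow M k).carrier} (hD : IsDer 1 z D)
    (hz : z ∈ SuperSpace.linPart M.toSuperSpace M.toSuperSpace 1) (hzz : ∀ v, z (z v) = v) (k : ℕ) :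
    D k ∘ₗ D k = (k : ℂ) • LinearMap.id := by
  induction k with
  | zero => simp [hD.zero]
  | succ k ih =>
    refine sym_succ_ext fun q v hv _ x _ => ?_
    have h := LinearMap.congr_fun ih x
    simp only [LinearMap.comp_apply, LinearMap.smul_apply, LinearMap.id_apply] at h ⊢
    -- The two mixed terms `± z(v) D(x)` cancel, because `v` and `z(v)` have opposite parities and
    -- `D` is odd. The term `z(z(v)) x = v x` raises the count by one.
    rw [hD.lmul k q v hv, map_add, map_smul, hD.lmul k _ _ (hz q v hv), hD.lmul k q v hv, hzz, h]
    simp only [map_smul, smul_add, smul_smul, mul_add, one_mul, sgn_add, sgn_one]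
    have hs := sgn_mul_self q
    push_cast
    rw [← mul_assoc (sgn q), hs]
    module

end IsDer

/-- Every homogeneous element of the Lie superalgebra acts by a superderivation, so equivariance of
merges is the Leibniz rule. For splits, in the next lemma, it is the coderivation property. -/
theorem mergeLin_mem_homPart {k l m : ℕ} (h : k + l = m) :
    mergeLin M k l m ∈ homPart (sym₂ M k l) (symPow M m) 0 := by
  refine ⟨mergeLin_linPart k l m, fun r x hx => ?_⟩
  rw [zero_mul, sgn_zero, one_smul, (isDer_act hx).comp_mergeLin (act_linPart hx) h]
  rfl

theorem split_mem_homPart {k l m : ℕ} (h : k + l = m) :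
    split M k l m ∈ homPart (symPow M m) (sym₂ M k l) 0 := by
  refine ⟨split_linPart k l m, fun r x hx => ?_⟩
  rw [zero_mul, sgn_zero, one_smul, (isDer_act hx).split_comp (act_linPart hx) h]
  rfl

end Derivations

end SuperModule

namespace SuperModule

open SuperSpace

/-! ### Splitting a product with a vector, and rungs on elements -/

section Rungs

/-- Supplies Sweedler sums `Σ x' ⊗ x''` with homogeneous terms, on which super signs can be
evaluated term by term. -/
theorem tensorPart_exists_sum {M N : SuperSpace} {p : ZMod 2} {x : M ⊗[ℂ] N}
    (hx : x ∈ tensorPart M N p) :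
    ∃ (ι : Type) (_ : Fintype ι) (e d : ι → ZMod 2) (m : ι → M) (n : ι → N),
      (∀ i, e i + d i = p) ∧ (∀ i, m i ∈ M.part (e i)) ∧ (∀ i, n i ∈ N.part (d i)) ∧
        x = ∑ i, m i ⊗ₜ[ℂ] n i := by
  refine tensorPart_induction (C := fun x => ∃ (ι : Type) (_ : Fintype ι) (e d : ι → ZMod 2)
    (m : ι → M) (n : ι → N), (∀ i, e i + d i = p) ∧ (∀ i, m i ∈ M.part (e i)) ∧
      (∀ i, n i ∈ N.part (d i)) ∧ x = ∑ i, m i ⊗ₜ[ℂ] n i) hx ?_ ?_ ?_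
  · exact ⟨Empty, inferInstance, Empty.elim, Empty.elim, Empty.elim, Empty.elim,
      fun i => i.elim, fun i => i.elim, fun i => i.elim, by simp⟩
  · rintro x y ⟨ι, _, e, d, m, n, h, hm, hn, rfl⟩ ⟨κ, _, e', d', m', n', h', hm', hn', rfl⟩
    refine ⟨ι ⊕ κ, inferInstance, Sum.elim e e', Sum.elim d d', Sum.elim m m', Sum.elim n n',
      ?_, ?_, ?_, by simp⟩
    · rintro (i | i); exacts [h i, h' i]
    · rintro (i | i); exacts [hm i, hm' i]
    · rintro (i | i); exacts [hn i, hn' i]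
  · intro e d h m hm n hn
    exact ⟨Unit, inferInstance, fun _ => e, fun _ => d, fun _ => m, fun _ => n, fun _ => h,
      fun _ => hm, fun _ => hn, by simp⟩

variable {𝔤 : LieSuperalgebra} {M : SuperModule 𝔤}

variable (M) in
/-- The superspace of the linear maps `S^1(M) → S^1(M)`. -/
abbrev EndOne : Type := (symPow M 1).carrier →ₗ[ℂ] (symPow M 1).carrier

/-- `EndParity p x`: the endomorphism `x` of `S^1(M)` has parity `p`. -/
abbrev EndParity (p : ZMod 2) (x : EndOne M) : Prop :=
  x ∈ linPart (symPow M 1).toSuperSpace (symPow M 1).toSuperSpace p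

/-- For the label `0` the expression `0 - 1` names `S^0` where `S^(-1) = 0` is meant. This and the
next three lemmas show that the merges and splits concerned are zero, so formulas with `k - 1` also
hold for `k = 0`. -/
theorem merge_one_pred_zero {q : ZMod 2} {u : (symPow M 1).carrier} (hu : u ∈ (symPow M 1).part q) :
    merge M 1 (0 - 1) 0 u = 0 := by
  obtain ⟨v, _, rfl⟩ := exists_vec hu
  exact merge_lmul_zero 0 0 v (symOne M)

theorem merge_pred_one_zero (a : (symPow M (0 - 1)).carrier) : merge M (0 - 1) 1 0 a = 0 := by
  obtain ⟨c, rfl⟩ := exists_smul_symOne (M := M) a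
  rw [map_smul]
  exact (congrArg _ (merge_symOne_ne one_ne_zero)).trans (smul_zero c)

theorem split_pred_one_zero : split M (0 - 1) 1 0 = 0 := by
  refine sym_zero_ext ?_
  rw [split, LinearMap.comp_apply, symLift_symOne]
  rfl

theorem split_one_pred_zero : split M 1 (0 - 1) 0 = 0 := by
  refine sym_zero_ext ?_
  rw [split, LinearMap.comp_apply, symLift_symOne]
  rfl

section SplitMerge

variable {ι : Type} [Fintype ι] {q r : ZMod 2} {e d : ι → ZMod 2}

/-- Multiplicativity of `Δ` gives `Δ(u b) = (u ⊗ 1 + 1 ⊗ u) Δ(b)`: what splits off is either `u`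
itself or a letter `w` of `b`, which `u` then has to pass. The next three lemmas treat the remaining
positions of `u` and of the strand of label `1`. -/
theorem split_one_merge_one (l : ℕ) {u : (symPow M 1).carrier} (hu : u ∈ (symPow M 1).part q)
    (b : (symPow M l).carrier) {w : ι → (symPow M 1).carrier} {b' : ι → (symPow M (l - 1)).carrier}
    (hw : ∀ i, w i ∈ (symPow M 1).part (e i)) (hb : split M 1 (l - 1) l b = ∑ i, w i ⊗ₜ[ℂ] b' i) :
    split M 1 l (l + 1) (merge M 1 l (l + 1) u b) =
      u ⊗ₜ[ℂ] b + ∑ i, sgn (q * e i) • (w i ⊗ₜ[ℂ] merge M 1 (l - 1) l u (b' i)) := by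
  obtain ⟨v, hv, rfl⟩ := exists_vec hu
  rw [merge_vec, split_lmul, lmulPred_succ]
  congr 1
  · refine (congrArg _ (split_zero_left l b)).trans ?_
    rw [tensorMap_tmul _ linPart_id symOne_mem, mul_zero, sgn_zero, one_smul]
    rfl
  · refine (congrArg _ hb).trans ?_
    rw [map_sum]
    refine Finset.sum_congr rfl fun i _ => ?_
    rw [tensorMap_tmul _ (lmulPred_linPart l hv) (hw i), LinearMap.id_apply]
    congr 2
    rcases l with _ | l
    · rw [merge_one_pred_zero (vec_mem hv)]
      rfl
    · exact (merge_vec l v (b' i)).symm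

theorem split_right_merge_one (k : ℕ) {u : (symPow M 1).carrier} (hu : u ∈ (symPow M 1).part q)
    {b : (symPow M k).carrier} (hb : b ∈ (symPow M k).part r)
    {b' : ι → (symPow M (k - 1)).carrier} {w : ι → (symPow M 1).carrier}
    (hb' : ∀ i, b' i ∈ (symPow M (k - 1)).part (e i))
    (h : split M (k - 1) 1 k b = ∑ i, b' i ⊗ₜ[ℂ] w i) :
    split M k 1 (k + 1) (merge M 1 k (k + 1) u b) =
      sgn (q * r) • (b ⊗ₜ[ℂ] u) + ∑ i, merge M 1 (k - 1) k u (b' i) ⊗ₜ[ℂ] w i := by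
  obtain ⟨v, hv, rfl⟩ := exists_vec hu
  rw [merge_vec, split_lmul, lmulPred_succ, add_comm]
  congr 1
  · refine (congrArg _ (split_zero_right k b)).trans ?_
    rw [tensorMap_tmul _ (lmul_linPart hv) hb]
    rfl
  · refine (congrArg _ h).trans ?_
    rw [map_sum]
    refine Finset.sum_congr rfl fun i _ => ?_
    rw [tensorMap_tmul _ linPart_id (hb' i), zero_mul, sgn_zero, one_smul, LinearMap.id_apply]
    congr 1
    rcases k with _ | k
    · rw [merge_one_pred_zero (vec_mem hv)]
      rfl
    · exact (merge_vec k v (b' i)).symm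

/-- Here `u` stands at the end: it is moved to the front, and then back behind each `a'`. The signs
for `a = a' w` and for `a'` combine to the sign for passing `w`. In the next lemma the same
manoeuvre makes the signs in the sum cancel altogether. -/
theorem split_right_merge_right (k : ℕ) {u : (symPow M 1).carrier} (hu : u ∈ (symPow M 1).part q)
    {a : (symPow M k).carrier} (ha : a ∈ (symPow M k).part r)
    {a' : ι → (symPow M (k - 1)).carrier} {w : ι → (symPow M 1).carrier}
    (hed : ∀ i, e i + d i = r) (ha' : ∀ i, a' i ∈ (symPow M (k - 1)).part (e i))
    (h : split M (k - 1) 1 k a = ∑ i, a' i ⊗ₜ[ℂ] w i) :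
    split M k 1 (k + 1) (merge M k 1 (k + 1) a u) =
      a ⊗ₜ[ℂ] u + ∑ i, sgn (q * d i) • (merge M (k - 1) 1 k (a' i) u ⊗ₜ[ℂ] w i) := by
  have h₂ := split_right_merge_one k hu ha ha' h
  obtain ⟨v, hv, rfl⟩ := exists_vec hu
  rw [merge_vec] at h₂
  rw [merge_vec_right k ha hv, map_smul, h₂, smul_add, smul_smul, mul_comm r q, sgn_mul_self,
    one_smul, Finset.smul_sum]
  congr 1
  refine Finset.sum_congr rfl fun i _ => ?_
  rcases k with _ | k
  · rw [merge_one_pred_zero (vec_mem hv), merge_pred_one_zero]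
    simp
  · change _ • (merge M 1 k (k + 1) (vec M v) (a' i) ⊗ₜ[ℂ] w i) =
      _ • (merge M k 1 (k + 1) (a' i) (vec M v) ⊗ₜ[ℂ] w i)
    rw [merge_vec, merge_vec_right k (ha' i) hv, ← TensorProduct.smul_tmul', smul_smul,
      ← sgn_add, ← hed i, mul_comm (e i) q, mul_add, add_comm (q * e i)]

theorem split_one_merge_right (k : ℕ) {u : (symPow M 1).carrier} (hu : u ∈ (symPow M 1).part q)
    {b : (symPow M k).carrier} (hb : b ∈ (symPow M k).part r)
    {w : ι → (symPow M 1).carrier} {b' : ι → (symPow M (k - 1)).carrier}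
    (hed : ∀ i, e i + d i = r) (hw : ∀ i, w i ∈ (symPow M 1).part (e i))
    (hb' : ∀ i, b' i ∈ (symPow M (k - 1)).part (d i))
    (h : split M 1 (k - 1) k b = ∑ i, w i ⊗ₜ[ℂ] b' i) :
    split M 1 k (k + 1) (merge M k 1 (k + 1) b u) =
      sgn (q * r) • (u ⊗ₜ[ℂ] b) + ∑ i, w i ⊗ₜ[ℂ] merge M (k - 1) 1 k (b' i) u := by
  have h₂ := split_one_merge_one k hu b hw h
  obtain ⟨v, hv, rfl⟩ := exists_vec hu
  rw [merge_vec] at h₂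
  rw [merge_vec_right k hb hv, map_smul, h₂, smul_add, mul_comm r q, Finset.smul_sum]
  congr 1
  refine Finset.sum_congr rfl fun i _ => ?_
  rcases k with _ | k
  · rw [merge_one_pred_zero (vec_mem hv), merge_pred_one_zero]
    simp
  · change _ • _ • (w i ⊗ₜ[ℂ] merge M 1 k (k + 1) (vec M v) (b' i)) =
      w i ⊗ₜ[ℂ] merge M k 1 (k + 1) (b' i) (vec M v)
    rw [merge_vec, merge_vec_right k (hb' i) hv, TensorProduct.tmul_smul, smul_smul,
      ← sgn_add, ← hed i, mul_comm (d i) q]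
    congr 2
    -- Exponents of signs live in `ZMod 2`; two of them often agree only modulo multiples of `2`,
    -- which `linear_combination` discards with this equation.
    have h2 : (2 : ZMod 2) = 0 := rfl
    linear_combination (q * e i) * h2

end SplitMerge

/-- `a ⊗ w ⊗ b ↦ a x(w) ⊗ b`. -/
noncomputable def absorbLeft (x : EndOne M) (k k' l : ℕ) :
    (tensor (symPow M k) (sym₂ M 1 l)).carrier →ₗ[ℂ] (sym₂ M k' l).carrier :=
  tensorMap (mergeLin M k 1 k') LinearMap.id ∘ₗ
    (assoc (symPow M k).toSuperSpace (symPow M 1).toSuperSpace (symPow M l).toSuperSpace).symm ∘ₗ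
      tensorMap LinearMap.id (tensorMap x LinearMap.id)

/-- `a ⊗ w ⊗ b ↦ a ⊗ x(w) b`. -/
noncomputable def absorbRight (x : EndOne M) (k l l' : ℕ) :
    (tensor (sym₂ M k 1) (symPow M l)).carrier →ₗ[ℂ] (sym₂ M k l').carrier :=
  tensorMap LinearMap.id (mergeLin M 1 l l') ∘ₗ
    tensorMap LinearMap.id (tensorMap x LinearMap.id) ∘ₗ
      (assoc (symPow M k).toSuperSpace (symPow M 1).toSuperSpace (symPow M l).toSuperSpace)

theorem EndParity.tensor_id {p : ZMod 2} {x : EndOne M} (hx : EndParity p x) (N : SuperModule 𝔤) :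
    tensorMap x (LinearMap.id : N.carrier →ₗ[ℂ] _) ∈
      linPart (tensor (symPow M 1) N).toSuperSpace (tensor (symPow M 1) N).toSuperSpace p := by
  simpa using tensorMap_mem hx (linPart_id (M := N.toSuperSpace))

/-- The associator and the merge are even, so the only sign comes from `x` passing `a`. The same
holds for `absorbRight_tmul`. -/
theorem absorbLeft_tmul {p e d : ZMod 2} {x : EndOne M} (hx : EndParity p x) {k k' l : ℕ}
    {a : (symPow M k).carrier} (ha : a ∈ (symPow M k).part e)
    {w : (symPow M 1).carrier} (hw : w ∈ (symPow M 1).part d) (b : (symPow M l).carrier) :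
    absorbLeft x k k' l (a ⊗ₜ[ℂ] (w ⊗ₜ[ℂ] b)) =
      sgn (p * e) • (merge M k 1 k' a (x w) ⊗ₜ[ℂ] b) := by
  have h₁ := tensorMap_tmul (LinearMap.id : (symPow M k).carrier →ₗ[ℂ] _)
    (hx.tensor_id (symPow M l)) ha (w ⊗ₜ[ℂ] b)
  rw [absorbLeft, LinearMap.comp_apply, LinearMap.comp_apply, h₁, tensorMap_tmul _ linPart_id hw,
    zero_mul, sgn_zero, one_smul, map_smul, map_smul]
  congr 1
  refine (tensorMap_tmul (M := (sym₂ M k 1).toSuperSpace) (mergeLin M k 1 k') linPart_id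
    (tmul_mem_tensorPart ha (hx d w hw)) b).trans ?_
  rw [zero_mul, sgn_zero, one_smul]
  rfl

theorem absorbRight_tmul {p e d : ZMod 2} {x : EndOne M} (hx : EndParity p x) {k l l' : ℕ}
    {a : (symPow M k).carrier} (ha : a ∈ (symPow M k).part e)
    {w : (symPow M 1).carrier} (hw : w ∈ (symPow M 1).part d) (b : (symPow M l).carrier) :
    absorbRight x k l l' ((a ⊗ₜ[ℂ] w) ⊗ₜ[ℂ] b) =
      sgn (p * e) • (a ⊗ₜ[ℂ] merge M 1 l l' (x w) b) := by
  have h₁ := tensorMap_tmul (LinearMap.id : (symPow M k).carrier →ₗ[ℂ] _)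
    (hx.tensor_id (symPow M l)) ha (w ⊗ₜ[ℂ] b)
  rw [absorbRight, LinearMap.comp_apply, LinearMap.comp_apply]
  refine (congrArg _ h₁).trans ?_
  rw [tensorMap_tmul _ linPart_id hw,
    zero_mul, sgn_zero, one_smul, map_smul]
  congr 1
  refine (tensorMap_tmul (N := (sym₂ M 1 l).toSuperSpace) LinearMap.id (mergeLin_linPart 1 l l')
    ha (x w ⊗ₜ[ℂ] b)).trans ?_
  rw [zero_mul, sgn_zero, one_smul]
  rfl

/-- The rung `x` pointing left. -/
noncomputable def rungLeft (x : EndOne M) (k l k' l' : ℕ) :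
    (sym₂ M k l).carrier →ₗ[ℂ] (sym₂ M k' l').carrier :=
  absorbLeft x k k' l' ∘ₗ tensorMap LinearMap.id (split M 1 l' l)

/-- The rung `x` pointing right. -/
noncomputable def rungRight (x : EndOne M) (k l k' l' : ℕ) :
    (sym₂ M k l).carrier →ₗ[ℂ] (sym₂ M k' l').carrier :=
  absorbRight x k' l l' ∘ₗ tensorMap (split M k' 1 k) LinearMap.id

section

variable {ι : Type} [Fintype ι] {p q : ZMod 2} {e d : ι → ZMod 2} {x : EndOne M}

theorem rungLeft_tmul' {k l k' l' : ℕ} {a : (symPow M k).carrier} (ha : a ∈ (symPow M k).part q)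
    (b : (symPow M l).carrier) :
    rungLeft x k l k' l' (a ⊗ₜ[ℂ] b) = absorbLeft x k k' l' (a ⊗ₜ[ℂ] split M 1 l' l b) := by
  rw [rungLeft, LinearMap.comp_apply, tensorMap_tmul _ (split_linPart _ _ _) ha, zero_mul, sgn_zero,
    one_smul]
  rfl

theorem rungRight_tmul' {k l k' l' : ℕ} {a : (symPow M k).carrier} (ha : a ∈ (symPow M k).part q)
    (b : (symPow M l).carrier) :
    rungRight x k l k' l' (a ⊗ₜ[ℂ] b) = absorbRight x k' l l' (split M k' 1 k a ⊗ₜ[ℂ] b) := by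
  rw [rungRight, LinearMap.comp_apply, tensorMap_tmul _ linPart_id ha, zero_mul, sgn_zero, one_smul]
  rfl

/-- The presentation of the split as a sum is a parameter, so that the same presentation can be used
on both sides of a relation and the sums compared termwise. -/
theorem rungLeft_tmul (hx : EndParity p x) {k l k' l' : ℕ}
    {a : (symPow M k).carrier}
    (ha : a ∈ (symPow M k).part q) {b : (symPow M l).carrier} {w : ι → (symPow M 1).carrier}
    {b' : ι → (symPow M l').carrier} (hw : ∀ i, w i ∈ (symPow M 1).part (e i))
    (hb : split M 1 l' l b = ∑ i, w i ⊗ₜ[ℂ] b' i) :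
    rungLeft x k l k' l' (a ⊗ₜ[ℂ] b) =
      ∑ i, sgn (p * q) • (merge M k 1 k' a (x (w i)) ⊗ₜ[ℂ] b' i) := by
  rw [rungLeft_tmul' ha, hb, TensorProduct.tmul_sum, map_sum]
  exact Finset.sum_congr rfl fun i _ => absorbLeft_tmul hx ha (hw i) (b' i)

theorem rungRight_tmul (hx : EndParity p x) {k l k' l' : ℕ}
    {a : (symPow M k).carrier}
    (ha : a ∈ (symPow M k).part q) {b : (symPow M l).carrier} {a' : ι → (symPow M k').carrier}
    {w : ι → (symPow M 1).carrier} (ha' : ∀ i, a' i ∈ (symPow M k').part (e i))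
    (hw : ∀ i, w i ∈ (symPow M 1).part (d i)) (hs : split M k' 1 k a = ∑ i, a' i ⊗ₜ[ℂ] w i) :
    rungRight x k l k' l' (a ⊗ₜ[ℂ] b) =
      ∑ i, sgn (p * e i) • (a' i ⊗ₜ[ℂ] merge M 1 l l' (x (w i)) b) := by
  rw [rungRight_tmul' ha, hs, TensorProduct.sum_tmul, map_sum]
  exact Finset.sum_congr rfl fun i _ => absorbRight_tmul hx (ha' i) (hw i) b

end

end Rungs

end SuperModule

namespace SuperModule

open SuperSpace

/-! ### Square switches -/

section Switch

variable {𝔤 : LieSuperalgebra} {M : SuperModule 𝔤}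

/-- The derivation `x ↦ Σ z(x') x''`, where `x'` has degree `1`. -/
noncomputable def derLeft (z : EndOne M) (k : ℕ) :
    (symPow M k).carrier →ₗ[ℂ] (symPow M k).carrier :=
  mergeLin M 1 (k - 1) k ∘ₗ tensorMap z LinearMap.id ∘ₗ split M 1 (k - 1) k

/-- The derivation `x ↦ Σ ± x' z(x'')`, where `x''` has degree `1`. -/
noncomputable def derRight (z : EndOne M) (k : ℕ) :
    (symPow M k).carrier →ₗ[ℂ] (symPow M k).carrier :=
  mergeLin M (k - 1) 1 k ∘ₗ tensorMap LinearMap.id z ∘ₗ split M (k - 1) 1 k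

section

variable {ι : Type} [Fintype ι] {p : ZMod 2} {e : ι → ZMod 2} {z : EndOne M}

theorem derLeft_apply {k : ℕ} {b : (symPow M k).carrier} {w : ι → (symPow M 1).carrier}
    {b' : ι → (symPow M (k - 1)).carrier} (hw : ∀ i, w i ∈ (symPow M 1).part (e i))
    (hb : split M 1 (k - 1) k b = ∑ i, w i ⊗ₜ[ℂ] b' i) :
    derLeft z k b = ∑ i, merge M 1 (k - 1) k (z (w i)) (b' i) := by
  rw [derLeft, LinearMap.comp_apply, LinearMap.comp_apply, hb, map_sum, map_sum]
  refine Finset.sum_congr rfl fun i _ => ?_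
  rw [tensorMap_tmul _ linPart_id (hw i), zero_mul, sgn_zero, one_smul]
  rfl

theorem derRight_apply (hz : EndParity p z) {k : ℕ} {a : (symPow M k).carrier}
    {a' : ι → (symPow M (k - 1)).carrier} {w : ι → (symPow M 1).carrier}
    (ha' : ∀ i, a' i ∈ (symPow M (k - 1)).part (e i))
    (ha : split M (k - 1) 1 k a = ∑ i, a' i ⊗ₜ[ℂ] w i) :
    derRight z k a = ∑ i, sgn (p * e i) • merge M (k - 1) 1 k (a' i) (z (w i)) := by
  rw [derRight, LinearMap.comp_apply, LinearMap.comp_apply, ha, map_sum, map_sum]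
  refine Finset.sum_congr rfl fun i _ => ?_
  rw [tensorMap_tmul _ hz (ha' i), map_smul]
  rfl

end

theorem split_exists_sum (k l m : ℕ) {p : ZMod 2} {x : (symPow M m).carrier}
    (hx : x ∈ (symPow M m).part p) :
    ∃ (ι : Type) (_ : Fintype ι) (e d : ι → ZMod 2) (a : ι → (symPow M k).carrier)
      (b : ι → (symPow M l).carrier), (∀ i, e i + d i = p) ∧
      (∀ i, a i ∈ (symPow M k).part (e i)) ∧ (∀ i, b i ∈ (symPow M l).part (d i)) ∧
        split M k l m x = ∑ i, a i ⊗ₜ[ℂ] b i := by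
  have h := split_linPart k l m p x hx
  rw [add_zero] at h
  exact tensorPart_exists_sum h

theorem IsDer.of_homogeneous {p : ZMod 2} {z : M.carrier →ₗ[ℂ] M.carrier}
    {D : ∀ k, (symPow M k).carrier →ₗ[ℂ] (symPow M k).carrier} (h₀ : D 0 = 0)
    (h : ∀ (k : ℕ) (q r : ZMod 2), ∀ v ∈ M.part q, ∀ x ∈ (symPow M k).part r,
      D (k + 1) (SuperModule.lmul M v x) =
        SuperModule.lmul M (z v) x + sgn (p * q) • SuperModule.lmul M v (D k x)) : IsDer p z D where
  zero := h₀
  lmul k q v hv x := by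
    induction x using SuperSpace.hom_induction (M := (symPow M k).toSuperSpace) with
    | hadd x y hx hy => simp only [map_add, hx, hy, smul_add]; abel
    | hom r x hx => exact h k q r v hv x hx

/-- The letter taken out of `v x` is `v`, giving `z(v) x`, or a letter `w` of `x`, giving `± z(w) v
x''`. The signs for `v` passing `w` and for `v` returning to the front past `z(w)` combine to
`(-1)^(|z||v|)`. -/
theorem isDer_derLeft {p : ZMod 2} {z : EndOne M} (hz : EndParity p z)
    {z₀ : M.carrier →ₗ[ℂ] M.carrier} (h : ∀ v, z (vec M v) = vec M (z₀ v)) :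
    IsDer p z₀ (derLeft z) := by
  refine .of_homogeneous ?_ fun k q r v hv x hx => ?_
  · rw [derLeft, split_one_pred_zero, LinearMap.comp_zero, LinearMap.comp_zero]
  · obtain ⟨ι, _, e, d, w, b, hed, hw, hb, hs⟩ := split_exists_sum 1 (k - 1) k hx
    have h₁ := split_one_merge_one k (vec_mem hv) x hw hs
    rw [merge_vec] at h₁
    rw [derLeft_apply hw hs, derLeft, LinearMap.comp_apply, LinearMap.comp_apply]
    refine (congrArg _ (congrArg _ h₁)).trans ?_
    rw [map_add, map_add, tensorMap_tmul _ linPart_id (vec_mem hv), zero_mul, sgn_zero, one_smul, h]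
    congr 1
    · exact merge_vec k _ x
    · rw [map_sum, map_sum, map_sum, Finset.smul_sum]
      refine Finset.sum_congr rfl fun i _ => ?_
      rw [map_smul, map_smul, tensorMap_tmul _ linPart_id (hw i), zero_mul, sgn_zero, one_smul]
      rcases k with _ | k
      · rw [merge_one_pred_zero (vec_mem hv), merge_one_pred_zero (hz _ _ (hw i))]
        simp
      · have h₂ := merge_lmul_right (add_comm 1 k) (hz _ _ (hw i)) hv (b i)
        change _ • merge M 1 (k + 1) (k + 1 + 1) (z (w i)) (merge M 1 k (k + 1) (vec M v) (b i)) =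
          _ • SuperModule.lmul M v (merge M 1 k (k + 1) (z (w i)) (b i))
        rw [merge_vec, h₂, smul_smul, add_mul, sgn_add, mul_comm q, ← mul_assoc, sgn_mul_self,
          one_mul]

/-- The same with letters taken out at the end. For the letter `v` three signs occur: `v` passes
`x`, then `z` passes `x`, then `z(v)` returns to the front past `x`; they cancel, which uses the
parity of `z₀`. -/
theorem isDer_derRight {p : ZMod 2} {z : EndOne M} (hz : EndParity p z)
    {z₀ : M.carrier →ₗ[ℂ] M.carrier} (hz₀ : z₀ ∈ linPart M.toSuperSpace M.toSuperSpace p)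
    (h : ∀ v, z (vec M v) = vec M (z₀ v)) :
    IsDer p z₀ (derRight z) := by
  refine .of_homogeneous ?_ fun k q r v hv x hx => ?_
  · rw [derRight, split_pred_one_zero, LinearMap.comp_zero, LinearMap.comp_zero]
  · obtain ⟨ι, _, e, d, b, w, hed, hb, hw, hs⟩ := split_exists_sum (k - 1) 1 k hx
    have h₁ := split_right_merge_one k (vec_mem hv) hx hb hs
    rw [merge_vec] at h₁
    rw [derRight_apply hz hb hs, derRight, LinearMap.comp_apply, LinearMap.comp_apply]
    refine (congrArg _ (congrArg _ h₁)).trans ?_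
    rw [map_add, map_add, map_smul, map_smul, tensorMap_tmul _ hz hx, map_smul, h, smul_smul]
    congr 1
    · refine (congrArg _ (merge_vec_right k hx (hz₀ q v hv))).trans ?_
      rw [smul_smul, ← sgn_add, ← sgn_add]
      have h2 : (2 : ZMod 2) = 0 := rfl
      rw [show q * r + p * r + r * (q + p) = 0 by linear_combination (q * r + p * r) * h2, sgn_zero,
        one_smul]
    · rw [map_sum, map_sum, map_sum, Finset.smul_sum]
      refine Finset.sum_congr rfl fun i _ => ?_
      have h₂ := tensorMap_tmul (M := (symPow M k).toSuperSpace) LinearMap.id hz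
        (merge_mem (m := k) (vec_mem hv) (hb i) rfl) (w i)
      refine (congrArg (mergeLin M k 1 (k + 1)) h₂).trans ?_
      rw [map_smul, mergeLin_tmul]
      rcases k with _ | k
      · rw [merge_one_pred_zero (vec_mem hv), merge_pred_one_zero]
        simp
      · change _ • merge M (k + 1) 1 (k + 1 + 1) (merge M 1 k (k + 1) (vec M v) (b i)) (z (w i)) =
          _ • SuperModule.lmul M v (_ • merge M k 1 (k + 1) (b i) (z (w i)))
        rw [merge_vec, merge_lmul, map_smul, smul_smul, mul_add, sgn_add]

/-- The square switch relation: the supercommutator of two rungs of opposite directions. -/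
theorem rung_square {p q : ZMod 2} {x y : EndOne M} (hx : EndParity p x) (hy : EndParity q y)
    (k l : ℕ) :
    rungLeft y (k - 1) (l + 1) k l ∘ₗ rungRight x k l (k - 1) (l + 1) -
        sgn (p * q) • (rungRight x (k + 1) (l - 1) k l ∘ₗ rungLeft y k l (k + 1) (l - 1)) =
      tensorMap (derRight (y ∘ₗ x) k) LinearMap.id -
        sgn (p * q) • tensorMap LinearMap.id (derLeft (x ∘ₗ y) l) := by
  refine tmul_ext (M := (symPow M k).toSuperSpace) (N := (symPow M l).toSuperSpace)
    fun α β a ha b hb => ?_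
  obtain ⟨ι, _, e, d, a', w, hed, ha', hw, hs⟩ := split_exists_sum (k - 1) 1 k ha
  obtain ⟨κ, _, e', d', w', b', hed', hw', hb', hs'⟩ := split_exists_sum 1 (l - 1) l hb
  have hyx : EndParity (p + q) (y ∘ₗ x) := linPart_comp hx hy
  have hxy : EndParity (q + p) (x ∘ₗ y) := linPart_comp hy hx
  have hder : derLeft (x ∘ₗ y) l ∈ linPart (symPow M l).toSuperSpace (symPow M l).toSuperSpace (q + p) := by
    rw [derLeft]
    simpa using linPart_comp (linPart_comp (split_linPart 1 (l - 1) l)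
      (tensorMap_mem hxy linPart_id)) (mergeLin_linPart 1 (l - 1) l)
  have h2 : (2 : ZMod 2) = 0 := rfl
  -- When `x(w) b` is split, the part `x(w)` may come back, which gives the derivation on the left
  -- strand, or a letter `w'` of `b` leaves instead, which gives the double sum.
  have E₁ : rungLeft y (k - 1) (l + 1) k l (rungRight x k l (k - 1) (l + 1) (a ⊗ₜ[ℂ] b)) =
      derRight (y ∘ₗ x) k a ⊗ₜ[ℂ] b + ∑ i, ∑ j, sgn ((p + q) * e i + (d i + p) * e' j) •
        (merge M (k - 1) 1 k (a' i) (y (w' j)) ⊗ₜ[ℂ] merge M 1 (l - 1) l (x (w i)) (b' j)) := by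
    rw [rungRight_tmul hx ha ha' hw hs, derRight_apply hyx ha' hs, TensorProduct.sum_tmul, map_sum,
      ← Finset.sum_add_distrib]
    refine Finset.sum_congr rfl fun i _ => ?_
    rw [map_smul, rungLeft_tmul' (ha' i), split_one_merge_one l (hx _ _ (hw i)) b hw' hs',
      TensorProduct.tmul_add, map_add, absorbLeft_tmul hy (ha' i) (hx _ _ (hw i)),
      TensorProduct.tmul_sum, map_sum, smul_add, smul_smul, Finset.smul_sum]
    congr 1
    · rw [← TensorProduct.smul_tmul', ← sgn_add, add_mul]
      rfl
    · refine Finset.sum_congr rfl fun j _ => ?_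
      rw [TensorProduct.tmul_smul, map_smul, absorbLeft_tmul hy (ha' i) (hw' j), smul_smul,
        smul_smul, ← sgn_add, ← sgn_add]
      congr 2
      ring
  -- In the other order `a y(w')` is split: the part `y(w')` gives the derivation on the right
  -- strand, and a letter of `a` gives the double sum of `E₁` up to `(-1)^(pq)`. The double sums
  -- therefore cancel in the supercommutator.
  have E₂ : rungRight x (k + 1) (l - 1) k l (rungLeft y k l (k + 1) (l - 1) (a ⊗ₜ[ℂ] b)) =
      sgn ((p + q) * α) • (a ⊗ₜ[ℂ] derLeft (x ∘ₗ y) l b) +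
        ∑ i, ∑ j, sgn (p * q) • sgn ((p + q) * e i + (d i + p) * e' j) •
        (merge M (k - 1) 1 k (a' i) (y (w' j)) ⊗ₜ[ℂ] merge M 1 (l - 1) l (x (w i)) (b' j)) := by
    rw [rungLeft_tmul hy ha hw' hs', derLeft_apply hw' hs', TensorProduct.tmul_sum, map_sum,
      Finset.smul_sum, Finset.sum_comm, ← Finset.sum_add_distrib]
    refine Finset.sum_congr rfl fun j _ => ?_
    rw [map_smul, rungRight_tmul' (merge_mem ha (hy _ _ (hw' j)) rfl),
      split_right_merge_right k (hy _ _ (hw' j)) ha hed ha' hs, TensorProduct.add_tmul, map_add,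
      absorbRight_tmul hx ha (hy _ _ (hw' j)), TensorProduct.sum_tmul, map_sum, smul_add, smul_smul,
      Finset.smul_sum]
    congr 1
    · rw [← sgn_add, ← add_mul, add_comm q p]
      rfl
    · refine Finset.sum_congr rfl fun i _ => ?_
      rw [← TensorProduct.smul_tmul', map_smul, absorbRight_tmul hx (merge_mem (ha' i) (hy _ _ (hw' j)) rfl) (hw i),
        smul_smul, smul_smul, smul_smul, ← sgn_add, ← sgn_add, ← sgn_add, ← hed i]
      congr 2
      linear_combination (q * d i) * h2
  rw [LinearMap.sub_apply, LinearMap.smul_apply, LinearMap.comp_apply, LinearMap.comp_apply, E₁, E₂,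
    LinearMap.sub_apply, LinearMap.smul_apply, tensorMap_tmul _ linPart_id ha,
    tensorMap_tmul _ hder ha, smul_add, Finset.smul_sum, add_comm q p]
  simp only [Finset.smul_sum, smul_smul, ← mul_assoc, sgn_mul_self, one_mul, zero_mul, sgn_zero,
    one_smul, LinearMap.id_apply]
  abel

end Switch

end SuperModule

namespace SuperModule

open SuperSpace

/-! ### Double rungs and the dumbbell -/

section DoubleRungs

theorem linPart_of_tmul {M N P : SuperSpace} {p : ZMod 2} {f : M ⊗[ℂ] N →ₗ[ℂ] P}
    (h : ∀ e d, ∀ m ∈ M.part e, ∀ n ∈ N.part d, f (m ⊗ₜ n) ∈ P.part (e + d + p)) :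
    f ∈ linPart (SuperSpace.tensor M N) P p := by
  intro e x hx
  refine tensorPart_induction (C := fun x => f x ∈ P.part (e + p)) hx ?_ ?_ ?_
  · rw [map_zero]; exact zero_mem _
  · intro x y hx hy; rw [map_add]; exact add_mem hx hy
  · intro a b hab m hm n hn
    rw [← hab]
    exact h a b m hm n hn

variable {𝔤 : LieSuperalgebra} {M : SuperModule 𝔤}

theorem rungLeft_linPart {p : ZMod 2} {x : EndOne M} (hx : EndParity p x) (k l k' l' : ℕ) :
    rungLeft x k l k' l' ∈ linPart (sym₂ M k l).toSuperSpace (sym₂ M k' l').toSuperSpace p := by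
  refine linPart_of_tmul (M := (symPow M k).toSuperSpace) (N := (symPow M l).toSuperSpace)
    fun α β a ha b hb => ?_
  obtain ⟨ι, _, e, d, w, b', hed, hw, hb', hs⟩ := split_exists_sum 1 l' l hb
  rw [rungLeft_tmul hx ha hw hs]
  refine sum_mem fun i _ => Submodule.smul_mem _ _ ?_
  rw [← hed i, show α + (e i + d i) + p = α + (e i + p) + d i by ring]
  exact tmul_mem_tensorPart (merge_mem ha (hx _ _ (hw i)) rfl) (hb' i)

theorem rungRight_linPart {p : ZMod 2} {x : EndOne M} (hx : EndParity p x) (k l k' l' : ℕ) :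
    rungRight x k l k' l' ∈ linPart (sym₂ M k l).toSuperSpace (sym₂ M k' l').toSuperSpace p := by
  refine linPart_of_tmul (M := (symPow M k).toSuperSpace) (N := (symPow M l).toSuperSpace)
    fun α β a ha b hb => ?_
  obtain ⟨ι, _, e, d, a', w, hed, ha', hw, hs⟩ := split_exists_sum k' 1 k ha
  rw [rungRight_tmul hx ha ha' hw hs]
  refine sum_mem fun i _ => Submodule.smul_mem _ _ ?_
  rw [← hed i, show e i + d i + β + p = e i + (d i + p + β) by ring]
  exact tmul_mem_tensorPart (ha' i) (merge_mem (hx _ _ (hw i)) hb rfl)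

variable (M) in
/-- The tensor product of three symmetric powers. -/
noncomputable abbrev sym₃ (h k l : ℕ) : SuperModule 𝔤 := tensor (symPow M h) (sym₂ M k l)

/-- A map of two neighbouring symmetric powers, on the first two of three. -/
noncomputable def onLeft {h k h' k' : ℕ} (f : (sym₂ M h k).carrier →ₗ[ℂ] (sym₂ M h' k').carrier)
    (l : ℕ) : (sym₃ M h k l).carrier →ₗ[ℂ] (sym₃ M h' k' l).carrier :=
  (assoc (symPow M h').toSuperSpace (symPow M k').toSuperSpace
      (symPow M l).toSuperSpace).toLinearMap ∘ₗ
    tensorMap (M := (sym₂ M h k).toSuperSpace) (N := (symPow M l).toSuperSpace)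
      (M' := (sym₂ M h' k').toSuperSpace) (N' := (symPow M l).toSuperSpace) f LinearMap.id ∘ₗ
    (assoc (symPow M h).toSuperSpace (symPow M k).toSuperSpace
      (symPow M l).toSuperSpace).symm.toLinearMap

/-- A map of two neighbouring symmetric powers, on the last two of three. -/
noncomputable def onRight {k l k' l' : ℕ} (h : ℕ)
    (f : (sym₂ M k l).carrier →ₗ[ℂ] (sym₂ M k' l').carrier) :
    (sym₃ M h k l).carrier →ₗ[ℂ] (sym₃ M h k' l').carrier :=
  tensorMap (M := (symPow M h).toSuperSpace) (M' := (symPow M h).toSuperSpace)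
    (N := (sym₂ M k l).toSuperSpace) (N' := (sym₂ M k' l').toSuperSpace) LinearMap.id f

theorem onLeft_tmul {h k l h' k' : ℕ} (f : (sym₂ M h k).carrier →ₗ[ℂ] (sym₂ M h' k').carrier)
    {p q : ZMod 2} {a : (symPow M h).carrier} (ha : a ∈ (symPow M h).part p)
    {b : (symPow M k).carrier} (hb : b ∈ (symPow M k).part q) (c : (symPow M l).carrier) :
    onLeft f l (a ⊗ₜ[ℂ] (b ⊗ₜ[ℂ] c)) =
      assoc (symPow M h').toSuperSpace (symPow M k').toSuperSpace (symPow M l).toSuperSpace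
        (f (a ⊗ₜ[ℂ] b) ⊗ₜ[ℂ] c) := by
  have h₁ := tensorMap_tmul (M := (sym₂ M h k).toSuperSpace) f
    (linPart_id (M := (symPow M l).toSuperSpace)) (tmul_mem_tensorPart ha hb) c
  rw [zero_mul, sgn_zero, one_smul] at h₁
  rw [onLeft, LinearMap.comp_apply, LinearMap.comp_apply]
  exact congrArg _ h₁

theorem onRight_tmul {h k l k' l' : ℕ} {f : (sym₂ M k l).carrier →ₗ[ℂ] (sym₂ M k' l').carrier}
    {p q : ZMod 2} (hf : f ∈ linPart (sym₂ M k l).toSuperSpace (sym₂ M k' l').toSuperSpace p)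
    {a : (symPow M h).carrier} (ha : a ∈ (symPow M h).part q) (x : (sym₂ M k l).carrier) :
    onRight h f (a ⊗ₜ[ℂ] x) = sgn (p * q) • (a ⊗ₜ[ℂ] f x) := by
  rw [onRight, tensorMap_tmul (N := (sym₂ M k l).toSuperSpace) _ hf ha]
  rfl

theorem sym₃_ext {h k l : ℕ} {X : Type*} [AddCommGroup X] [Module ℂ X]
    {f g : (sym₃ M h k l).carrier →ₗ[ℂ] X}
    (H : ∀ α β γ, ∀ a ∈ (symPow M h).part α, ∀ b ∈ (symPow M k).part β, ∀ c ∈ (symPow M l).part γ,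
      f (a ⊗ₜ[ℂ] (b ⊗ₜ[ℂ] c)) = g (a ⊗ₜ[ℂ] (b ⊗ₜ[ℂ] c))) : f = g := by
  refine tmul_ext (M := (symPow M h).toSuperSpace) (N := (sym₂ M k l).toSuperSpace)
    fun α _ a ha x _ => ?_
  have e : f ∘ₗ TensorProduct.mk ℂ _ _ a = g ∘ₗ TensorProduct.mk ℂ _ _ a :=
    tmul_ext (M := (symPow M k).toSuperSpace) (N := (symPow M l).toSuperSpace)
      fun β γ b hb c hc => H α β γ a ha b hb c hc
  exact LinearMap.congr_fun e x

/-- The supercommutator of two rungs pointing left, on neighbouring pairs of strands. -/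
noncomputable def commLeft (p q : ZMod 2) (x y : EndOne M) (h k l : ℕ) :
    (sym₃ M h k (l + 1)).carrier →ₗ[ℂ] (sym₃ M (h + 1) k l).carrier :=
  onLeft (rungLeft y h (k + 1) (h + 1) k) l ∘ₗ onRight h (rungLeft x k (l + 1) (k + 1) l) -
    sgn (p * q) • (onRight (h + 1) (rungLeft x (k - 1) (l + 1) k l) ∘ₗ
      onLeft (rungLeft y h k (h + 1) (k - 1)) (l + 1))

/-- The supercommutator of two rungs pointing right, on neighbouring pairs of strands. -/
noncomputable def commRight (p q : ZMod 2) (x y : EndOne M) (h k l : ℕ) :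
    (sym₃ M (h + 1) k l).carrier →ₗ[ℂ] (sym₃ M h k (l + 1)).carrier :=
  onRight h (rungRight y (k + 1) l k (l + 1)) ∘ₗ onLeft (rungRight x (h + 1) k h (k + 1)) l -
    sgn (p * q) • (onLeft (rungRight x (h + 1) (k - 1) h k) (l + 1) ∘ₗ
      onRight (h + 1) (rungRight y k l (k - 1) (l + 1)))

/-- If `x` acts first, `y` takes from the middle strand either the letter `x(w)` that has just
arrived or a letter of `b`. The latter terms are those of the opposite order up to sign and cancel.
What survives is a letter that travels from the third strand to the first and is changed by `y ∘ x`.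
-/
theorem commLeft_tmul {p q : ZMod 2} {x y : EndOne M} (hx : EndParity p x) (hy : EndParity q y)
    (h k l : ℕ) {α β : ZMod 2} {a : (symPow M h).carrier} (ha : a ∈ (symPow M h).part α)
    {b : (symPow M k).carrier} (hb : b ∈ (symPow M k).part β) {c : (symPow M (l + 1)).carrier}
    {ι : Type} [Fintype ι] {f : ι → ZMod 2} {w : ι → (symPow M 1).carrier}
    {c' : ι → (symPow M l).carrier} (hw : ∀ i, w i ∈ (symPow M 1).part (f i))
    (hs : split M 1 l (l + 1) c = ∑ i, w i ⊗ₜ[ℂ] c' i) :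
    commLeft p q x y h k l (a ⊗ₜ[ℂ] (b ⊗ₜ[ℂ] c)) = ∑ j, sgn ((p + q) * α + f j * β) •
      (merge M h 1 (h + 1) a ((y ∘ₗ x) (w j)) ⊗ₜ[ℂ] (b ⊗ₜ[ℂ] c' j)) := by
  obtain ⟨κ, _, e, d, u, b', hed, hu, hb', hs'⟩ := split_exists_sum 1 (k - 1) k hb
  have h2 : (2 : ZMod 2) = 0 := rfl
  rw [commLeft, LinearMap.sub_apply, LinearMap.smul_apply, LinearMap.comp_apply,
    LinearMap.comp_apply, onRight_tmul (rungLeft_linPart hx _ _ _ _) ha, rungLeft_tmul hx hb hw hs,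
    onLeft_tmul _ ha hb, rungLeft_tmul hy ha hu hs', TensorProduct.sum_tmul, map_sum, map_sum,
    TensorProduct.tmul_sum, map_smul, map_sum, Finset.smul_sum, sub_eq_iff_eq_add, Finset.smul_sum]
  -- The opposite order, for one letter `u i` of `b`: this letter has already left the middle strand
  -- when `x(w j)` is absorbed there.
  have E : ∀ i, sgn (p * q) • onRight (h + 1) (rungLeft x (k - 1) (l + 1) k l)
        (assoc (symPow M (h + 1)).toSuperSpace (symPow M (k - 1)).toSuperSpace
          (symPow M (l + 1)).toSuperSpace
          ((sgn (q * α) • (merge M h 1 (h + 1) a (y (u i)) ⊗ₜ[ℂ] b' i)) ⊗ₜ[ℂ] c)) =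
      ∑ j, sgn ((p + q) * α + p * β) • (merge M h 1 (h + 1) a (y (u i)) ⊗ₜ[ℂ]
        (merge M (k - 1) 1 k (b' i) (x (w j)) ⊗ₜ[ℂ] c' j)) := by
    intro i
    rw [← TensorProduct.smul_tmul', map_smul, map_smul, assoc_tmul,
      onRight_tmul (rungLeft_linPart hx _ _ _ _) (merge_mem ha (hy _ _ (hu i)) rfl),
      rungLeft_tmul hx (hb' i) hw hs, TensorProduct.tmul_sum, Finset.smul_sum, Finset.smul_sum,
      Finset.smul_sum]
    refine Finset.sum_congr rfl fun j _ => ?_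
    rw [TensorProduct.tmul_smul, smul_smul, smul_smul, smul_smul, ← sgn_add, ← sgn_add, ← sgn_add,
      ← hed i]
    congr 2
    linear_combination (p * q) * h2
  rw [Finset.sum_congr rfl fun i _ => E i, Finset.sum_comm, ← Finset.sum_add_distrib]
  refine Finset.sum_congr rfl fun j _ => ?_
  rw [TensorProduct.tmul_smul, map_smul, onLeft_tmul _ ha (merge_mem hb (hx _ _ (hw j)) rfl),
    rungLeft_tmul' ha, split_one_merge_right k (hx _ _ (hw j)) hb hed hu hb' hs',
    TensorProduct.tmul_add, TensorProduct.tmul_smul, TensorProduct.tmul_sum, map_add, map_smul,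
    map_sum, absorbLeft_tmul hy ha (hx _ _ (hw j)), TensorProduct.add_tmul, map_add,
    TensorProduct.sum_tmul, map_sum, smul_add, smul_add, Finset.smul_sum, Finset.smul_sum, smul_smul]
  congr 1
  · have e : ∀ r : ℂ, assoc (symPow M (h + 1)).toSuperSpace (symPow M k).toSuperSpace
        (symPow M l).toSuperSpace
        ((r • (merge M h 1 (h + 1) a (y (x (w j))) ⊗ₜ[ℂ] b)) ⊗ₜ[ℂ] c' j) =
        r • (merge M h 1 (h + 1) a (y (x (w j))) ⊗ₜ[ℂ] (b ⊗ₜ[ℂ] c' j)) := by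
      intro r
      rw [← TensorProduct.smul_tmul', map_smul, assoc_tmul]
    simp only [smul_smul, ← sgn_add]
    refine (congrArg _ (e _)).trans ?_
    rw [smul_smul, ← sgn_add]
    congr 2
    linear_combination (p * β) * h2
  · refine Finset.sum_congr rfl fun i _ => ?_
    rw [absorbLeft_tmul hy ha (hu i), ← TensorProduct.smul_tmul', map_smul, smul_smul, smul_smul,
      assoc_tmul, ← sgn_add, ← sgn_add]
    congr 2
    ring

/-- The mirror argument: of the terms in which `y` takes a letter from the middle strand, only those
survive where this is the letter `x(w)` that has just come from the first strand; it has to pass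
`b`. -/
theorem commRight_tmul {p q : ZMod 2} {x y : EndOne M} (hx : EndParity p x) (hy : EndParity q y)
    (h k l : ℕ) {α β : ZMod 2} {a : (symPow M (h + 1)).carrier}
    (ha : a ∈ (symPow M (h + 1)).part α) {b : (symPow M k).carrier}
    (hb : b ∈ (symPow M k).part β) (c : (symPow M l).carrier)
    {ι : Type} [Fintype ι] {e f : ι → ZMod 2} {a' : ι → (symPow M h).carrier}
    {w : ι → (symPow M 1).carrier} (hef : ∀ i, e i + f i = α)
    (ha' : ∀ i, a' i ∈ (symPow M h).part (e i)) (hw : ∀ i, w i ∈ (symPow M 1).part (f i))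
    (hs : split M h 1 (h + 1) a = ∑ i, a' i ⊗ₜ[ℂ] w i) :
    commRight p q x y h k l (a ⊗ₜ[ℂ] (b ⊗ₜ[ℂ] c)) =
      ∑ j, sgn ((p + q) * (e j + β) + f j * β) •
        (a' j ⊗ₜ[ℂ] (b ⊗ₜ[ℂ] merge M 1 l (l + 1) ((y ∘ₗ x) (w j)) c)) := by
  obtain ⟨κ, _, e', d, b', u, hed, hb', hu, hs'⟩ := split_exists_sum (k - 1) 1 k hb
  have h2 : (2 : ZMod 2) = 0 := rfl
  rw [commRight, LinearMap.sub_apply, LinearMap.smul_apply, LinearMap.comp_apply,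
    LinearMap.comp_apply, onRight_tmul (rungRight_linPart hy _ _ _ _) ha,
    rungRight_tmul hy hb hb' hu hs', onLeft_tmul _ ha hb, rungRight_tmul hx ha ha' hw hs,
    TensorProduct.sum_tmul, map_sum, map_sum,
    TensorProduct.tmul_sum, map_smul, map_sum, Finset.smul_sum, sub_eq_iff_eq_add, Finset.smul_sum]
  have E : ∀ i, sgn (p * q) • sgn (q * α) • onLeft (rungRight x (h + 1) (k - 1) h k) (l + 1)
        (a ⊗ₜ[ℂ] (sgn (q * e' i) • (b' i ⊗ₜ[ℂ] merge M 1 l (l + 1) (y (u i)) c))) =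
      ∑ j, sgn (p * q + q * α + q * e' i + p * e j) • (a' j ⊗ₜ[ℂ]
        (merge M 1 (k - 1) k (x (w j)) (b' i) ⊗ₜ[ℂ] merge M 1 l (l + 1) (y (u i)) c)) := by
    intro i
    rw [TensorProduct.tmul_smul, map_smul, onLeft_tmul _ ha (hb' i), rungRight_tmul hx ha ha' hw hs,
      TensorProduct.sum_tmul, map_sum, Finset.smul_sum, Finset.smul_sum, Finset.smul_sum]
    refine Finset.sum_congr rfl fun j _ => ?_
    rw [← TensorProduct.smul_tmul', map_smul, assoc_tmul, smul_smul, smul_smul, smul_smul,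
      ← sgn_add, ← sgn_add, ← sgn_add]
  rw [Finset.sum_congr rfl fun i _ => E i, Finset.sum_comm, ← Finset.sum_add_distrib]
  refine Finset.sum_congr rfl fun j _ => ?_
  rw [← TensorProduct.smul_tmul', map_smul, map_smul, assoc_tmul,
    onRight_tmul (rungRight_linPart hy _ _ _ _) (ha' j),
    rungRight_tmul' (merge_mem (hx _ _ (hw j)) hb rfl),
    split_right_merge_one k (hx _ _ (hw j)) hb hb' hs',
    TensorProduct.add_tmul, ← TensorProduct.smul_tmul', TensorProduct.sum_tmul, map_add, map_smul,
    map_sum, absorbRight_tmul hy hb (hx _ _ (hw j)), TensorProduct.tmul_add,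
    TensorProduct.tmul_sum, smul_add, smul_add, Finset.smul_sum, Finset.smul_sum,
    TensorProduct.tmul_smul, TensorProduct.tmul_smul, smul_smul, smul_smul, smul_smul]
  congr 1
  · rw [← sgn_add, ← sgn_add, ← sgn_add]
    congr 2
    ring
  · refine Finset.sum_congr rfl fun i _ => ?_
    rw [absorbRight_tmul hy (merge_mem (hx _ _ (hw j)) (hb' i) rfl) (hu i),
      TensorProduct.tmul_smul, smul_smul, smul_smul, ← sgn_add, ← sgn_add, ← hef j]
    congr 2
    ring

/-- The supercommutator of two rungs pointing left depends only on their composite. -/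
theorem commLeft_congr {p q p' q' : ZMod 2} {x y x' y' : EndOne M} (hx : EndParity p x)
    (hy : EndParity q y) (hx' : EndParity p' x') (hy' : EndParity q' y') (hp : p + q = p' + q')
    (hxy : y ∘ₗ x = y' ∘ₗ x') (h k l : ℕ) :
    commLeft p q x y h k l = commLeft p' q' x' y' h k l := by
  refine sym₃_ext fun α β γ a ha b hb c hc => ?_
  obtain ⟨ι, _, e, d, w, c', hed, hw, hc', hs⟩ := split_exists_sum 1 l (l + 1) hc
  rw [commLeft_tmul hx hy h k l ha hb hw hs, commLeft_tmul hx' hy' h k l ha hb hw hs, hp, hxy]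

/-- The supercommutator of two rungs pointing right depends only on their composite. -/
theorem commRight_congr {p q p' q' : ZMod 2} {x y x' y' : EndOne M} (hx : EndParity p x)
    (hy : EndParity q y) (hx' : EndParity p' x') (hy' : EndParity q' y') (hp : p + q = p' + q')
    (hxy : y ∘ₗ x = y' ∘ₗ x') (h k l : ℕ) :
    commRight p q x y h k l = commRight p' q' x' y' h k l := by
  refine sym₃_ext fun α β γ a ha b hb c hc => ?_
  obtain ⟨ι, _, e, d, a', w, hed, ha', hw, hs⟩ := split_exists_sum h 1 (h + 1) ha
  rw [commRight_tmul hx hy h k l ha hb c hed ha' hw hs,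
    commRight_tmul hx' hy' h k l ha hb c hed ha' hw hs, hp, hxy]

/-- On `S^1(M) ⊗ S^1(M)` the dumbbell is the identity plus the super swap; this is
`split_one_merge_one` with the one-term sum `b ⊗ 1` for the split of `b`. -/
theorem split_merge_one_one {q r : ZMod 2} {u b : (symPow M 1).carrier}
    (hu : u ∈ (symPow M 1).part q) (hb : b ∈ (symPow M 1).part r) :
    split M 1 1 2 (merge M 1 1 2 u b) = u ⊗ₜ[ℂ] b + sgn (q * r) • (b ⊗ₜ[ℂ] u) := by
  have h := split_one_merge_one (ι := Unit) (e := fun _ => r) (w := fun _ => b)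
    (b' := fun _ => symOne M) 1 hu b (fun _ => hb) (by simpa using split_zero_right 1 b)
  refine h.trans ?_
  simp only [Finset.univ_unique, Finset.sum_singleton]
  rw [merge_symOne_right]

/-- The dumbbell relation. -/
theorem split_merge_conj {d : EndOne M} (hd : EndParity 1 d) (hdd : d ∘ₗ d = LinearMap.id) :
    split M 1 1 2 ∘ₗ mergeLin M 1 1 2 -
        (tensorMap d LinearMap.id ∘ₗ tensorMap LinearMap.id d) ∘ₗ
          (split M 1 1 2 ∘ₗ mergeLin M 1 1 2) ∘ₗ
            (tensorMap d LinearMap.id ∘ₗ tensorMap LinearMap.id d) =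
      (2 : ℂ) • LinearMap.id := by
  have hid := linPart_id (M := (symPow M 1).toSuperSpace)
  have hdd' : ∀ u, d (d u) = u := fun u => LinearMap.congr_fun hdd u
  have h2 : (2 : ZMod 2) = 0 := rfl
  refine tmul_ext (M := (symPow M 1).toSuperSpace) (N := (symPow M 1).toSuperSpace)
    fun q r u hu b hb => ?_
  have T : ∀ {q : ZMod 2} {u : (symPow M 1).carrier} (b), u ∈ (symPow M 1).part q →
      (tensorMap d LinearMap.id ∘ₗ tensorMap LinearMap.id d) (u ⊗ₜ[ℂ] b) =
        sgn q • (d u ⊗ₜ[ℂ] d b) := by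
    intro q u b hu
    rw [tensorMap_id_comp _ _ hid hid]
    exact (tensorMap_tmul (d ∘ₗ LinearMap.id) (g := LinearMap.id ∘ₗ d) hd hu b).trans
      (by rw [one_mul]; rfl)
  have S : ∀ {q r : ZMod 2} {u b : (symPow M 1).carrier}, u ∈ (symPow M 1).part q →
      b ∈ (symPow M 1).part r → (split M 1 1 2 ∘ₗ mergeLin M 1 1 2) (u ⊗ₜ[ℂ] b) =
        u ⊗ₜ[ℂ] b + sgn (q * r) • (b ⊗ₜ[ℂ] u) := by
    intro q r u b hu hb
    rw [LinearMap.comp_apply, mergeLin_tmul, split_merge_one_one hu hb]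
  -- Since `d` is an odd involution, `(d ⊗ d)² = -1`. Hence the sandwich between two copies of `d ⊗
  -- d` negates the identity term, while the super swap term is unchanged.
  have E : (tensorMap d LinearMap.id ∘ₗ tensorMap LinearMap.id d)
      ((split M 1 1 2 ∘ₗ mergeLin M 1 1 2)
        ((tensorMap d LinearMap.id ∘ₗ tensorMap LinearMap.id d) (u ⊗ₜ[ℂ] b))) =
      - (u ⊗ₜ[ℂ] b) + sgn (q * r) • (b ⊗ₜ[ℂ] u) := by
    rw [T b hu, map_smul, S (hd _ _ hu) (hd _ _ hb), map_smul, map_add, map_smul, T _ (hd _ _ hu),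
      T _ (hd _ _ hb), hdd', hdd', smul_add, smul_smul, smul_smul, smul_smul, ← sgn_add, ← sgn_add,
      ← sgn_add, show q + (q + 1) = 1 by linear_combination q * h2,
      show q + (q + 1) * (r + 1) + (r + 1) = q * r by linear_combination (q + r + 1) * h2,
      sgn_one, neg_one_smul]
  refine (congrArg₂ (· - ·) (S hu hb) E).trans ?_
  change _ = (2 : ℂ) • (u ⊗ₜ[ℂ] b)
  module

end DoubleRungs

end SuperModule

/-! ### Interchange with even morphisms -/

section Supercategories

universe v u

variable {C : Type u} [Category.{v} C] [Preadditive C] [Linear ℂ C]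

theorem Supercategory.hom_induction [Supercategory C] {X Y : C} {P : (X ⟶ Y) → Prop}
    (hadd : ∀ f g, P f → P g → P (f + g)) (hom : ∀ p, ∀ f ∈ homPart X Y p, P f) (f : X ⟶ Y) :
    P f := by
  have h : f ∈ homPart X Y 0 ⊔ homPart X Y 1 := by
    rw [(isCompl_homPart X Y).sup_eq_top]; trivial
  obtain ⟨a, ha, b, hb, rfl⟩ := Submodule.mem_sup.1 h
  exact hadd _ _ (hom _ _ ha) (hom _ _ hb)

/-- The inverse of an even isomorphism is even. -/
theorem Supercategory.inv_mem [Supercategory C] {X Y : C} {f : X ⟶ Y} [IsIso f]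
    (hf : f ∈ homPart X Y 0) : inv f ∈ homPart Y X 0 := by
  have h : inv f ∈ homPart Y X 0 ⊔ homPart Y X 1 := by
    rw [(isCompl_homPart Y X).sup_eq_top]; trivial
  obtain ⟨a, ha, b, hb, hab⟩ := Submodule.mem_sup.1 h
  have h₁ : f ≫ a + f ≫ b = 𝟙 X := by rw [← Preadditive.comp_add, hab, IsIso.hom_inv_id]
  -- Here `b` is the odd part of the inverse. The composite `f ≫ b` is odd, but it also equals `𝟙 X
  -- - f ≫ a` and is thus even; so it vanishes, and `b` with it.
  have h₂ : f ≫ b ∈ homPart X X 0 := by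
    rw [← eq_sub_iff_add_eq'] at h₁
    rw [h₁]
    exact sub_mem (id_mem X) (by simpa using comp_mem hf ha)
  have h₃ : f ≫ b = 0 :=
    (Submodule.disjoint_def.1 (isCompl_homPart X X).disjoint) _ h₂ (by simpa using comp_mem hf hb)
  have h₄ : b = 0 := by
    rw [← cancel_epi f, h₃, Limits.comp_zero]
  rw [← hab, h₄, add_zero]
  exact ha

variable [MonoidalSupercategory C]

/-- The interchange sign involves only `g` and `h`. If one of them is even, the sign disappears, and
by linearity the other need not be homogeneous. -/
theorem tensorHom_comp_of_even_left {X Y Z X' Y' Z' : C} {h : X ⟶ Y} (f : Y ⟶ Z) (k : X' ⟶ Y')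
    (g : Y' ⟶ Z') (hh : h ∈ homPart X Y 0) :
    tensorHom h k ≫ tensorHom f g = tensorHom (h ≫ f) (k ≫ g) := by
  induction g using Supercategory.hom_induction with
  | hadd g g' hg hg' => rw [map_add, Preadditive.comp_add, hg, hg', Preadditive.comp_add, map_add]
  | hom p g hg => rw [tensorHom_comp _ _ _ _ hg hh, mul_zero, sgn_zero, one_smul]

theorem tensorHom_comp_of_even_right {X Y Z X' Y' Z' : C} (h : X ⟶ Y) (f : Y ⟶ Z) (k : X' ⟶ Y')
    {g : Y' ⟶ Z'} (hg : g ∈ homPart Y' Z' 0) :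
    tensorHom h k ≫ tensorHom f g = tensorHom (h ≫ f) (k ≫ g) := by
  induction h using Supercategory.hom_induction with
  | hadd h h' hh hh' =>
    rw [map_add, LinearMap.add_apply, Preadditive.add_comp, hh, hh', Preadditive.add_comp, map_add,
      LinearMap.add_apply]
  | hom p h hh => rw [tensorHom_comp _ _ _ _ hg hh, zero_mul, sgn_zero, one_smul]

/-- Evenness of `f` suffices: the two signs pair `f` with `inv g` and `inv f` with `g`, and `inv f`
is even as well. -/
theorem isIso_tensorHom {X Y X' Y' : C} (f : X ⟶ Y) (g : X' ⟶ Y') [IsIso f] [IsIso g]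
    (hf : f ∈ homPart X Y 0) : IsIso (tensorHom f g) :=
  ⟨tensorHom (inv f) (inv g),
    by rw [tensorHom_comp_of_even_left _ _ _ hf, IsIso.hom_inv_id, IsIso.hom_inv_id, tensorHom_id],
    by rw [tensorHom_comp_of_even_left _ _ _ (Supercategory.inv_mem hf), IsIso.inv_hom_id,
      IsIso.inv_hom_id, tensorHom_id]⟩

end Supercategories

namespace QModS

open SuperSpace

variable {n : ℕ}

/-! ### Morphisms of supermodules as linear maps -/

section Basic

variable {X Y Z X' Y' : QModS n}

/-- The morphism with a given underlying homogeneous linear map. -/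
def ofLin {p : ZMod 2} (f : X.1.carrier →ₗ[ℂ] Y.1.carrier) (hf : f ∈ SuperModule.homPart X.1 Y.1 p) :
    X ⟶ Y :=
  ⟨f, SuperModule.homPart_le p hf⟩

theorem ofLin_mem {p : ZMod 2} (f : X.1.carrier →ₗ[ℂ] Y.1.carrier)
    (hf : f ∈ SuperModule.homPart X.1 Y.1 p) : ofLin f hf ∈ homPart X Y p := hf

theorem toLin_mem {p : ZMod 2} {f : X ⟶ Y} (hf : f ∈ homPart X Y p) :
    toLin f ∈ SuperModule.homPart X.1 Y.1 p := hf

theorem toLin_injective {f g : X ⟶ Y} (h : toLin f = toLin g) : f = g := Subtype.ext h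

theorem toLin_comp (f : X ⟶ Y) (g : Y ⟶ Z) : toLin (f ≫ g) = toLin g ∘ₗ toLin f := rfl

theorem toLin_add (f g : X ⟶ Y) : toLin (f + g) = toLin f + toLin g := rfl

theorem toLin_tensorHom (f : X ⟶ Y) (g : X' ⟶ Y') :
    toLin (tensorHom f g) = tensorMap (M := X.1.toSuperSpace) (M' := Y.1.toSuperSpace)
      (N := X'.1.toSuperSpace) (N' := Y'.1.toSuperSpace) (toLin f) (toLin g) := rfl

theorem toLin_tensorHom_tmul (f : X ⟶ Y) {g : X' ⟶ Y'} (hg : g ∈ homPart X' Y' 0)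
    (x : X.1.carrier) (x' : X'.1.carrier) :
    toLin (tensorHom f g) (x ⊗ₜ[ℂ] x') = toLin f x ⊗ₜ[ℂ] toLin g x' := by
  rw [toLin_tensorHom]
  induction x using SuperSpace.hom_induction (M := X.1.toSuperSpace) with
  | hadd x y hx hy => rw [TensorProduct.add_tmul, map_add, hx, hy, map_add, TensorProduct.add_tmul]
  | hom p x hx =>
    rw [tensorMap_tmul _ (toLin_mem hg).1 hx, zero_mul, sgn_zero, one_smul]

end Basic

/-! ### Coherence of rebracketing -/

section Rebracket

theorem rebracket_mem : ∀ a b : List ℕ, rebracket n a b ∈ homPart _ _ 0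
  | [], b => leftUnitor_mem (symTensor n b)
  | [k], [] => rightUnitor_mem (sym n k)
  | [k], l :: b => id_mem (tensorObj (sym n k) (symTensor n (l :: b)))
  | k :: l :: a, b => by
    have h := comp_mem (associator_mem (sym n k) (symTensor n (l :: a)) (symTensor n b))
      (tensorHom_mem (id_mem (sym n k)) (rebracket_mem (l :: a) b))
    rw [add_zero, add_zero] at h
    exact h

instance isIso_rebracket : ∀ a b : List ℕ, IsIso (rebracket n a b)
  | [], b => inferInstanceAs (IsIso (leftUnitor (symTensor n b)).hom)
  | [k], [] => inferInstanceAs (IsIso (rightUnitor (sym n k)).hom)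
  | [k], l :: b => inferInstanceAs (IsIso (𝟙 (tensorObj (sym n k) (symTensor n (l :: b)))))
  | k :: l :: a, b => by
    have h := isIso_rebracket (l :: a) b
    have h' := isIso_tensorHom (𝟙 (sym n k)) (rebracket n (l :: a) b) (id_mem _)
    exact inferInstanceAs (IsIso ((MonoidalSupercategory.associator (sym n k) (symTensor n (l :: a))
      (symTensor n b)).hom ≫ tensorHom (𝟙 (sym n k)) (rebracket n (l :: a) b)))

/-- The underlying vector space of `symTensor n a`. -/
abbrev El (n : ℕ) (a : List ℕ) : Type := (symTensor n a).1.carrier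

/-- Concatenation of tensors. -/
noncomputable def cat (a b : List ℕ) : El n a →ₗ[ℂ] El n b →ₗ[ℂ] El n (a ++ b) :=
  (TensorProduct.mk ℂ (El n a) (El n b)).compr₂ (toLin (rebracket n a b))

theorem cat_apply (a b : List ℕ) (x : El n a) (y : El n b) :
    cat a b x y = toLin (rebracket n a b) (x ⊗ₜ[ℂ] y) := rfl

theorem cat_nil_left (b : List ℕ) (c : ℂ) (y : El n b) : cat [] b c y = c • y := rfl

theorem cat_nil_right (k : ℕ) (x : El n [k]) (c : ℂ) : cat [k] [] x c = c • x := rfl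

theorem cat_singleton (k l : ℕ) (b : List ℕ) (x : El n [k]) (y : El n (l :: b)) :
    cat [k] (l :: b) x y = x ⊗ₜ[ℂ] y := rfl

theorem cat_cons (k l : ℕ) (a b : List ℕ) (x : El n [k]) (y : El n (l :: a)) (z : El n b) :
    cat (k :: l :: a) b (x ⊗ₜ[ℂ] y : El n (k :: l :: a)) z =
      cat [k] (l :: a ++ b) x (cat (l :: a) b y z) := by
  refine Eq.trans ?_ (cat_singleton k l (a ++ b) x (cat (l :: a) b y z)).symm
  have h : toLin (rebracket n (k :: l :: a) b) =
      toLin (tensorHom (𝟙 (sym n k)) (rebracket n (l :: a) b)) ∘ₗ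
        toLin (MonoidalSupercategory.associator (sym n k) (symTensor n (l :: a))
          (symTensor n b)).hom := by
    rw [← toLin_comp]; rfl
  rw [cat_apply]
  refine (LinearMap.congr_fun h _).trans ?_
  exact toLin_tensorHom_tmul (𝟙 (sym n k)) (rebracket_mem (l :: a) b) x (y ⊗ₜ[ℂ] z)

/-- Peels off the first factor uniformly in `a`, hiding the case distinction between words of length
one and longer words in `symTensor`. No cast is needed, because the two words agree by definition.
-/
theorem cat_cat_singleton (k : ℕ) (a b : List ℕ) (x : El n [k]) (y : El n a) (z : El n b) :
    cat (k :: a) b (cat [k] a x y) z = cat [k] (a ++ b) x (cat a b y z) := by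
  cases a with
  | nil =>
    change ℂ at y
    rw [cat_nil_right, cat_nil_left]
    exact ((LinearMap.map_smul₂ _ _ _ _)).trans (LinearMap.map_smul _ _ _).symm
  | cons l a => exact cat_cons k l a b x y z

/-- For `a = []` the second factor is a scalar and every element is already a concatenation with
`1`; otherwise the space is a tensor product, spanned by pure tensors. -/
theorem cons_induction (k : ℕ) (a : List ℕ) {P : El n (k :: a) → Prop}
    (hadd : ∀ x y, P x → P y → P (x + y)) (hcat : ∀ x y, P (cat [k] a x y)) (x : El n (k :: a)) :
    P x := by
  cases a with
  | nil =>
    have := hcat x (1 : ℂ)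
    rw [cat_nil_right, one_smul] at this
    exact this
  | cons l a =>
    change (El n [k]) ⊗[ℂ] (El n (l :: a)) at x
    induction x with
    | zero =>
      have h := hcat 0 0
      rw [map_zero] at h
      exact h
    | add x y hx hy => exact hadd _ _ hx hy
    | tmul x y => exact hcat x y

/-- The identification of the spaces attached to two equal words. -/
noncomputable def castLin {a b : List ℕ} (h : a = b) : El n a →ₗ[ℂ] El n b :=
  toLin (eqToHom (congrArg (symTensor n) h))

theorem castLin_cat {a b : List ℕ} (k : ℕ) (h : a = b) (h' : k :: a = k :: b) (x : El n [k])
    (y : El n a) : castLin h' (cat [k] a x y) = cat [k] b x (castLin h y) := by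
  subst h; rfl

/-- Induction on the first word: its first factor is peeled off on both sides until `x` is a scalar.
`castLin` accounts for the associativity of concatenation, which is an equality of words but not a
definitional one. -/
theorem cat_assoc : ∀ (a b c : List ℕ) (x : El n a) (y : El n b) (z : El n c),
    castLin (List.append_assoc a b c) (cat (a ++ b) c (cat a b x y) z) =
      cat a (b ++ c) x (cat b c y z)
  | [], b, c, x, y, z => by
    change cat b c ((show ℂ from x) • y) z = (show ℂ from x) • cat b c y z
    rw [map_smul, LinearMap.smul_apply]
  | k :: a, b, c, x, y, z => by
    induction x using cons_induction with
    | hadd x x' hx hx' =>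
      have h : ∀ x : El n (k :: a), castLin (List.append_assoc (k :: a) b c)
          (cat (k :: a ++ b) c (cat (k :: a) b x y) z) =
          (castLin (List.append_assoc (k :: a) b c) ∘ₗ (cat (k :: a ++ b) c).flip z ∘ₗ
            (cat (k :: a) b).flip y) x := fun _ => rfl
      rw [h] at hx hx' ⊢
      rw [map_add, hx, hx', map_add, LinearMap.add_apply]
    | hcat u v =>
      refine Eq.trans ?_ (cat_cat_singleton k a (b ++ c) u v _).symm
      refine Eq.trans ?_ (congrArg _ (cat_assoc a b c v y z))
      refine (congrArg (fun t => castLin (List.append_assoc (k :: a) b c)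
        (cat (k :: a ++ b) c t z)) (cat_cat_singleton k a b u v y)).trans ?_
      refine (congrArg _ (cat_cat_singleton k (a ++ b) c _ _ _)).trans ?_
      exact castLin_cat k (List.append_assoc a b c) _ _ _

theorem cat_nil : ∀ (a : List ℕ) (x : El n a) (c : ℂ),
    castLin (List.append_nil a) (cat a [] x c) = c • x
  | [], x, c => mul_comm (show ℂ from x) c
  | k :: a, x, c => by
    induction x using cons_induction with
    | hadd x x' hx hx' =>
      have h : ∀ x : El n (k :: a), castLin (List.append_nil (k :: a)) (cat (k :: a) [] x c) =
          (castLin (List.append_nil (k :: a)) ∘ₗ (cat (k :: a) []).flip c) x := fun _ => rfl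
      rw [h] at hx hx' ⊢
      rw [map_add, hx, hx', smul_add]
    | hcat u v =>
      refine (congrArg _ (cat_cat_singleton k a [] u v c)).trans ?_
      refine (castLin_cat k (List.append_nil a) _ _ _).trans ?_
      rw [cat_nil a v c, map_smul]

/-- All maps involved are even, so on pure tensors no signs occur and the statement becomes the
associativity of concatenation. -/
theorem rebracket_assoc (a b c : List ℕ) :
    tensorHom (rebracket n a b) (𝟙 (symTensor n c)) ≫ rebracket n (a ++ b) c ≫
        eqToHom (congrArg (symTensor n) (List.append_assoc a b c)) =
      (MonoidalSupercategory.associator (symTensor n a) (symTensor n b) (symTensor n c)).hom ≫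
        tensorHom (𝟙 (symTensor n a)) (rebracket n b c) ≫ rebracket n a (b ++ c) := by
  refine toLin_injective (TensorProduct.ext (TensorProduct.ext (LinearMap.ext fun x =>
    LinearMap.ext fun y => LinearMap.ext fun z => ?_)))
  change castLin (List.append_assoc a b c) (toLin (rebracket n (a ++ b) c) (toLin (tensorHom (rebracket n a b)
    (𝟙 (symTensor n c))) ((x ⊗ₜ[ℂ] y) ⊗ₜ[ℂ] z))) = toLin (rebracket n a (b ++ c))
      (toLin (tensorHom (𝟙 (symTensor n a)) (rebracket n b c)) (x ⊗ₜ[ℂ] (y ⊗ₜ[ℂ] z)))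
  refine (congrArg _ (congrArg _ (toLin_tensorHom_tmul _ (id_mem _) _ _))).trans ?_
  refine Eq.trans ?_ (congrArg _ (toLin_tensorHom_tmul (𝟙 _) (rebracket_mem b c) x _)).symm
  exact cat_assoc a b c x y z

theorem rebracket_nil (a : List ℕ) :
    rebracket n a [] ≫ eqToHom (congrArg (symTensor n) (List.append_nil a)) =
      (rightUnitor (symTensor n a)).hom :=
  toLin_injective (TensorProduct.ext (LinearMap.ext fun x => LinearMap.ext fun c =>
    cat_nil a x c))

end Rebracket

end QModS

namespace SuperModule

open SuperSpace

/-! ### Superderivations extending an endomorphism of `M` -/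

section Dots

variable {𝔤 : LieSuperalgebra} {M : SuperModule 𝔤}

variable (M) in
/-- The inverse of `vec`. -/
noncomputable def unvec : (symPow M 1).carrier →ₗ[ℂ] M.carrier :=
  LinearMap.snd ℂ ℂ M.carrier ∘ₗ
    symLift (X := ℂ × M.carrier)
      -- The multiplication by `v` in the algebra `ℂ ⊕ M` in which `M` has square zero. Two
      -- successive multiplications by vectors give zero, so supercommutation is automatic, and `v`
      -- sends `(1, 0)` to `(0, v)`.
      (LinearMap.mk₂ ℂ (fun v (x : ℂ × M.carrier) => (((0 : ℂ), x.1 • v) : ℂ × M.carrier))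
        (fun v w x => Prod.ext (add_zero 0).symm (smul_add _ _ _))
        (fun c v x => Prod.ext (smul_zero c).symm (smul_comm _ _ _))
        (fun v x y => Prod.ext (add_zero 0).symm (add_smul _ _ _))
        (fun c v x => Prod.ext (smul_zero c).symm (mul_smul _ _ _)))
      (1, 0) (by intro p q v _ w _ x; ext <;> simp) 1

theorem unvec_vec (v : M.carrier) : unvec M (vec M v) = v := by
  rw [unvec, LinearMap.comp_apply, vec_apply, symLift_lmul, symLift_symOne]
  simp

theorem vec_ext {X : Type*} [AddCommGroup X] [Module ℂ X] {f g : (symPow M 1).carrier →ₗ[ℂ] X}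
    (h : ∀ p, ∀ v ∈ M.part p, f (vec M v) = g (vec M v)) : f = g := by
  refine lin_ext (M := (symPow M 1).toSuperSpace) fun p x hx => ?_
  obtain ⟨v, hv, rfl⟩ := exists_vec hx
  exact h p v hv

/-- An endomorphism of `M`, on `S^1(M)`. -/
noncomputable def endOne (z : M.carrier →ₗ[ℂ] M.carrier) : EndOne M := vec M ∘ₗ z ∘ₗ unvec M

theorem endOne_vec (z : M.carrier →ₗ[ℂ] M.carrier) (v : M.carrier) :
    endOne z (vec M v) = vec M (z v) := by
  rw [endOne, LinearMap.comp_apply, LinearMap.comp_apply, unvec_vec]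

theorem endOne_id : endOne (LinearMap.id : M.carrier →ₗ[ℂ] M.carrier) = LinearMap.id :=
  vec_ext fun _ v _ => endOne_vec _ v

theorem endOne_comp (z z' : M.carrier →ₗ[ℂ] M.carrier) :
    endOne (z ∘ₗ z') = endOne z ∘ₗ endOne z' :=
  vec_ext fun _ v _ => by
    rw [endOne_vec, LinearMap.comp_apply, LinearMap.comp_apply, endOne_vec, endOne_vec]

variable {p : ZMod 2} {z : M.carrier →ₗ[ℂ] M.carrier}

theorem endOne_parity (hz : z ∈ linPart M.toSuperSpace M.toSuperSpace p) :
    EndParity p (endOne z) := by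
  intro e x hx
  obtain ⟨v, hv, rfl⟩ := exists_vec hx
  rw [endOne_vec]
  exact vec_mem (hz e v hv)

theorem act_vec (x : 𝔤.carrier) (v : M.carrier) :
    (symPow M 1).act x (vec M v) = vec M (M.act x v) := by
  have h : ((symPow M 1).act.flip (vec M v)) = vec M ∘ₗ M.act.flip v := by
    refine lin_ext (M := 𝔤.toSuperSpace) fun p x hx => ?_
    rw [LinearMap.flip_apply, LinearMap.comp_apply, LinearMap.flip_apply]
    induction v using SuperSpace.hom_induction (M := M.toSuperSpace) with
    | hadd v w hv hw => simp only [map_add, hv, hw]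
    | hom q v hv =>
      have h := (isDer_act hx).lmul 0 q v hv (symOne M)
      rw [(isDer_act hx).zero, LinearMap.zero_apply, map_zero, smul_zero, add_zero] at h
      exact h
  exact LinearMap.congr_fun h x

theorem endOne_mem_homPart (hz : z ∈ homPart M M p) :
    endOne z ∈ homPart (symPow M 1) (symPow M 1) p := by
  refine ⟨endOne_parity hz.1, fun r x hx => vec_ext fun _ v _ => ?_⟩
  have h := LinearMap.congr_fun (hz.2 r x hx) v
  simp only [LinearMap.comp_apply, LinearMap.smul_apply] at h ⊢
  rw [act_vec, endOne_vec, endOne_vec, act_vec, h, map_smul]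

/-- The superderivations of the symmetric superalgebra that extend an endomorphism of `M`. -/
noncomputable def der (z : M.carrier →ₗ[ℂ] M.carrier) (k : ℕ) :
    (symPow M k).carrier →ₗ[ℂ] (symPow M k).carrier :=
  derLeft (endOne z) k

theorem isDer_der (hz : z ∈ linPart M.toSuperSpace M.toSuperSpace p) : IsDer p z (der z) :=
  isDer_derLeft (endOne_parity hz) (endOne_vec z)

/-- Both are superderivations that extend `z`, hence equal. The square switch produces `derRight` on
the left strand and `derLeft` on the right one, while a dot is one and the same map on either
strand. -/
theorem derRight_endOne (hz : z ∈ linPart M.toSuperSpace M.toSuperSpace p) (k : ℕ) :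
    derRight (endOne z) k = der z k :=
  (isDer_derRight (endOne_parity hz) hz (endOne_vec z)).unique (isDer_der hz) k

/-- The Euler derivation multiplies by the degree; it is the source of `k - l` in the square switch.
-/
theorem der_id (k : ℕ) : der (LinearMap.id : M.carrier →ₗ[ℂ] M.carrier) k = (k : ℂ) • LinearMap.id :=
  (isDer_der linPart_id).unique isDer_id k

theorem der_one (hz : z ∈ linPart M.toSuperSpace M.toSuperSpace p) : der z 1 = endOne z :=
  vec_ext fun q v hv => by
    have h := (isDer_der hz).lmul 0 q v hv (symOne M)
    rw [(isDer_der hz).zero, LinearMap.zero_apply, map_zero, smul_zero, add_zero] at h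
    rw [endOne_vec]
    exact h

/-- In positive degree `der z` is composed of a split, `z ⊗ 1` and a merge, which are all
homomorphisms. In degree zero the labels do not add up, but there the derivation is zero. -/
theorem der_mem_homPart (hz : z ∈ homPart M M p) (k : ℕ) :
    der z k ∈ homPart (symPow M k) (symPow M k) p := by
  cases k with
  | zero => rw [(isDer_der hz.1).zero]; exact zero_mem _
  | succ k =>
    have h := comp_mem_homPart (comp_mem_homPart (split_mem_homPart (M := M) (add_comm 1 k))
      (tensorMap_mem_homPart (endOne_mem_homPart hz) (id_mem_homPart (M := symPow M k))))
      (mergeLin_mem_homPart (M := M) (add_comm 1 k))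
    rw [add_zero, add_zero, zero_add] at h
    exact h

end Dots

/-! ### The trivial supermodule and `S^0(M)` -/

section Unit

variable {𝔤 : LieSuperalgebra} {M : SuperModule 𝔤}

variable (M) in
/-- The isomorphism of the trivial supermodule with `S^0(M)`. -/
noncomputable def unitLin : (unit : SuperModule 𝔤).carrier →ₗ[ℂ] (symPow M 0).carrier :=
  LinearMap.toSpanSingleton ℂ _ (symOne M)

theorem unitLin_apply (c : ℂ) : unitLin M c = c • symOne M := rfl

theorem unitLin_mem : unitLin M ∈ homPart unit (symPow M 0) 0 := by
  refine ⟨fun p (c : ℂ) hc => ?_, fun r x hx => ?_⟩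
  · rcases parity_cases p with rfl | rfl
    · exact Submodule.smul_mem _ c symOne_mem
    · have h : c = 0 := by simpa using hc
      rw [h, map_zero]; exact zero_mem _
  · rw [(isDer_act hx).zero, LinearMap.zero_comp, smul_zero]
    exact LinearMap.comp_zero _

variable (M) in
/-- The inverse of `unitLin`. -/
noncomputable def counitLin : (symPow M 0).carrier →ₗ[ℂ] (unit : SuperModule 𝔤).carrier :=
  symLift (X := ℂ) 0 1 (by intros; simp) 0

theorem counitLin_symOne : counitLin M (symOne M) = (1 : ℂ) := symLift_symOne _ _ _

theorem counitLin_mem : counitLin M ∈ homPart (symPow M 0) unit 0 := by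
  refine ⟨fun p x hx => ?_, fun r x hx => ?_⟩
  · obtain ⟨⟨c, rfl⟩, rfl | h⟩ := symPart_zero_cases hx
    · simp
    · rw [h, map_zero]; exact zero_mem _
  · rw [(isDer_act hx).zero, LinearMap.comp_zero]
    exact (smul_zero _).symm

theorem counitLin_comp_unitLin : counitLin M ∘ₗ unitLin M = LinearMap.id := by
  refine LinearMap.ext_ring ?_
  rw [LinearMap.comp_apply, unitLin_apply, one_smul, counitLin_symOne]
  rfl

theorem unitLin_comp_counitLin : unitLin M ∘ₗ counitLin M = LinearMap.id :=
  sym_zero_ext (by rw [LinearMap.comp_apply, counitLin_symOne, unitLin_apply, one_smul]; rfl)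

end Unit

end SuperModule

/-! ### The odd involution `c` -/

section Clifford

open SuperSpace

variable {n : ℕ}

theorem cliffordC_cliffordC (v : Fin n ⊕ Fin n → ℂ) : cliffordC n (cliffordC n v) = v := by
  ext i
  rcases i with i | i
  · change -Complex.I * (Complex.I * v (Sum.inl i)) = _
    rw [← mul_assoc, neg_mul, Complex.I_mul_I, neg_neg, one_mul]
  · change Complex.I * (-Complex.I * v (Sum.inr i)) = _
    rw [← mul_assoc, mul_neg, Complex.I_mul_I, neg_neg, one_mul]

/-- The matrix of `c` has block rows `(0, -√-1)` and `(√-1, 0)`. It commutes with the block matrices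
given by `A` and anticommutes with those given by `B`, as an odd homomorphism must. -/
theorem cliffordC_mem : cliffordC n ∈ SuperModule.homPart (qNatural n) (qNatural n) 1 := by
  constructor
  · intro e v hv
    rcases parity_cases e with rfl | rfl
    · ext i
      have h : v (Sum.inr i) = 0 := congrFun hv i
      change -Complex.I * v (Sum.inr i) = 0
      rw [h, mul_zero]
    · ext i
      have h : v (Sum.inl i) = 0 := congrFun hv i
      change Complex.I * v (Sum.inl i) = 0
      rw [h, mul_zero]
  · rintro r ⟨a, b⟩ hx
    have H : ∀ m : Fin n ⊕ Fin n → ℂ, (qNatural n).act (a, b) m =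
        Sum.elim (a.mulVec (m ∘ Sum.inl) + b.mulVec (m ∘ Sum.inr))
          (b.mulVec (m ∘ Sum.inl) + a.mulVec (m ∘ Sum.inr)) := fun m =>
      (Matrix.toLin'_apply (qMatrix n (a, b)) m).trans (Matrix.fromBlocks_mulVec _ _ _ _ _)
    have hl : ∀ m : Fin n ⊕ Fin n → ℂ, cliffordC n m ∘ Sum.inl = (-Complex.I) • (m ∘ Sum.inr) :=
      fun m => rfl
    have hr : ∀ m : Fin n ⊕ Fin n → ℂ, cliffordC n m ∘ Sum.inr = Complex.I • (m ∘ Sum.inl) :=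
      fun m => rfl
    refine LinearMap.ext fun (m : Fin n ⊕ Fin n → ℂ) => ?_
    change cliffordC n ((qNatural n).act (a, b) m) =
      sgn (1 * r) • (qNatural n).act (a, b) (cliffordC n m)
    rw [H, H, hl, hr]
    simp only [Matrix.mulVec_smul]
    ext i
    change _ = sgn (1 * r) * (Sum.elim _ _ : Fin n ⊕ Fin n → ℂ) i
    rcases qLie_cases hx with ⟨rfl, rfl⟩ | ⟨rfl, rfl⟩ <;> rcases i with i | i <;>
      simp [cliffordC]

end Clifford

namespace QModS

open SuperSpace WebExpr

variable {n : ℕ}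

/-! ### Evaluation of web expressions -/

section Evaluation

/-- The morphism of supermodules attached to a web. -/
noncomputable def ev (n : ℕ) : {a b : List ℕ} → WebExpr a b → (symTensor n a ⟶ symTensor n b)
  | _, _, .id a => 𝟙 (symTensor n a)
  | _, _, .comp f g => ev n f ≫ ev n g
  | _, _, @WebExpr.tensor a b c d f g =>
    -- The space of a concatenated word is bracketed to the right, so it is first regrouped into the
    -- tensor product of the spaces of the two words.
    inv (rebracket n a c) ≫ tensorHom (ev n f) (ev n g) ≫ rebracket n b d
  | _, _, .zero _ _ => 0
  | _, _, .add f g => ev n f + ev n g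
  | _, _, .smul r f => r • ev n f
  | _, _, .dot k => ofLin (X := sym n k) (Y := sym n k) (SuperModule.der (M := qNatural n) (cliffordC n) k)
      (SuperModule.der_mem_homPart cliffordC_mem k)
  | _, _, .merge k l m h => ofLin (X := tensorObj (sym n k) (sym n l)) (Y := sym n m)
      (SuperModule.mergeLin (qNatural n) k l m) (SuperModule.mergeLin_mem_homPart h)
  | _, _, .split k l m h => ofLin (X := sym n m) (Y := tensorObj (sym n k) (sym n l))
      (SuperModule.split (qNatural n) k l m) (SuperModule.split_mem_homPart h)
  | _, _, .erase => ofLin (X := sym n 0) (Y := tensorUnit) (SuperModule.counitLin (qNatural n))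
      SuperModule.counitLin_mem
  | _, _, .create => ofLin (X := tensorUnit) (Y := sym n 0) (SuperModule.unitLin (qNatural n))
      SuperModule.unitLin_mem

theorem ev_id (a : List ℕ) : ev n (WebExpr.id a) = 𝟙 _ := by rw [ev]

theorem ev_comp {a b c : List ℕ} (f : WebExpr a b) (g : WebExpr b c) :
    ev n (.comp f g) = ev n f ≫ ev n g := by rw [ev]

theorem ev_zero (a b : List ℕ) : ev n (.zero a b) = 0 := by rw [ev]

theorem ev_add {a b : List ℕ} (f g : WebExpr a b) : ev n (.add f g) = ev n f + ev n g := by rw [ev]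

theorem ev_smul {a b : List ℕ} (r : ℂ) (f : WebExpr a b) : ev n (.smul r f) = r • ev n f := by
  rw [ev]

theorem ev_sub {a b : List ℕ} (f g : WebExpr a b) : ev n (f.sub g) = ev n f - ev n g := by
  rw [WebExpr.sub, ev_add, ev_smul, neg_one_smul, sub_eq_add_neg]

theorem ev_tensor {a b c d : List ℕ} (f : WebExpr a b) (g : WebExpr c d) :
    ev n (.tensor f g) = inv (rebracket n a c) ≫ tensorHom (ev n f) (ev n g) ≫ rebracket n b d := by
  rw [ev]

theorem rebracket_ev_tensor {a b c d : List ℕ} (f : WebExpr a b) (g : WebExpr c d) :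
    rebracket n a c ≫ ev n (.tensor f g) = tensorHom (ev n f) (ev n g) ≫ rebracket n b d := by
  rw [ev_tensor, IsIso.hom_inv_id_assoc]

theorem ev_cast {a b : List ℕ} (h : a = b) :
    ev n (WebExpr.cast h) = eqToHom (congrArg (symTensor n) h) := by
  subst h
  exact ev_id a

theorem ev_mem {p : ZMod 2} {a b : List ℕ} {f : WebExpr a b} (hf : HasParity p f) :
    ev n f ∈ homPart _ _ p := by
  induction hf with
  | id a => rw [ev_id]; exact id_mem _
  | comp _ _ hf hg => rw [ev_comp]; exact comp_mem hf hg
  | tensor _ _ hf hg =>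
    rw [ev_tensor]
    have h := comp_mem (Supercategory.inv_mem (rebracket_mem (n := n) _ _))
      (comp_mem (tensorHom_mem hf hg) (rebracket_mem (n := n) _ _))
    rw [zero_add, add_zero] at h
    exact h
  | zero p a b => rw [ev_zero]; exact zero_mem _
  | add _ _ hf hg => rw [ev_add]; exact add_mem hf hg
  | smul r _ hf => rw [ev_smul]; exact Submodule.smul_mem _ r hf
  | dot k => rw [ev]; exact ofLin_mem _ _
  | merge k l m h => rw [ev]; exact ofLin_mem _ _
  | split k l m h => rw [ev]; exact ofLin_mem _ _
  | erase => rw [ev]; exact ofLin_mem _ _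
  | create => rw [ev]; exact ofLin_mem _ _

end Evaluation

/-! ### The axioms of a strict monoidal supercategory -/

section Structural

variable {a b c a' b' c' : List ℕ}

theorem ev_tensor_id (a b : List ℕ) :
    ev n (.tensor (.id a) (.id b)) = ev n (WebExpr.id (a ++ b)) := by
  rw [ev_tensor, ev_id, ev_id, ev_id, tensorHom_id, Category.id_comp, IsIso.inv_hom_id]

theorem ev_interchange {p q : ZMod 2} (h : WebExpr a b) (f : WebExpr b c) (k : WebExpr a' b')
    (g : WebExpr b' c') (hg : HasParity p g) (hh : HasParity q h) :
    ev n (.comp (.tensor h k) (.tensor f g)) =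
      ev n (.smul (sgn (p * q)) (.tensor (.comp h f) (.comp k g))) := by
  rw [ev_comp, ev_smul, ev_tensor, ev_tensor, ev_tensor, ev_comp, ev_comp]
  simp only [Category.assoc, IsIso.hom_inv_id_assoc]
  rw [← Category.assoc (tensorHom (ev n h) (ev n k)), tensorHom_comp _ _ _ _ (ev_mem hg) (ev_mem hh),
    Linear.smul_comp, Linear.comp_smul]

/-- Precomposition with two rebracketings turns the two sides into `(f ⊗ g) ⊗ h` and `f ⊗ (g ⊗ h)`,
which the associator intertwines; `rebracket_assoc` at the source and at the target closes the
diagram. The rebracketings are even, so they pass without signs. -/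
theorem ev_tensor_assoc (f : WebExpr a a') (g : WebExpr b b') (h : WebExpr c c') :
    ev n (.comp (.tensor (.tensor f g) h) (.cast (List.append_assoc a' b' c'))) =
      ev n (.comp (.cast (List.append_assoc a b c)) (.tensor f (.tensor g h))) := by
  have i₁ : IsIso (tensorHom (rebracket n a b) (𝟙 (symTensor n c))) :=
    isIso_tensorHom _ _ (rebracket_mem a b)
  rw [ev_comp, ev_comp, ev_cast, ev_cast, ← cancel_epi (rebracket n (a ++ b) c),
    ← cancel_epi (tensorHom (rebracket n a b) (𝟙 (symTensor n c)))]
  have h₁ := rebracket_ev_tensor (n := n) (.tensor f g) h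
  have h₂ := rebracket_ev_tensor (n := n) f (.tensor g h)
  have h₃ : tensorHom (rebracket n a b) (𝟙 (symTensor n c)) ≫
      tensorHom (ev n (.tensor f g)) (ev n h) =
      tensorHom (tensorHom (ev n f) (ev n g)) (ev n h) ≫
        tensorHom (rebracket n a' b') (𝟙 (symTensor n c')) := by
    rw [tensorHom_comp_of_even_left _ _ _ (rebracket_mem a b), rebracket_ev_tensor,
      tensorHom_comp_of_even_right _ _ _ (id_mem _), Category.id_comp, Category.comp_id]
  have h₄ : tensorHom (ev n f) (tensorHom (ev n g) (ev n h)) ≫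
      tensorHom (𝟙 (symTensor n a')) (rebracket n b' c') =
      tensorHom (𝟙 (symTensor n a)) (rebracket n b c) ≫ tensorHom (ev n f) (ev n (.tensor g h)) := by
    rw [tensorHom_comp_of_even_right _ _ _ (rebracket_mem b' c'),
      tensorHom_comp_of_even_left _ _ _ (id_mem _), rebracket_ev_tensor, Category.id_comp,
      Category.comp_id]
  have h₅ := rebracket_assoc (n := n) a b c
  have h₆ := rebracket_assoc (n := n) a' b' c'
  calc tensorHom (rebracket n a b) (𝟙 (symTensor n c)) ≫ rebracket n (a ++ b) c ≫
        ev n (.tensor (.tensor f g) h) ≫ eqToHom (congrArg (symTensor n) (List.append_assoc a' b' c'))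
      = tensorHom (tensorHom (ev n f) (ev n g)) (ev n h) ≫
          tensorHom (rebracket n a' b') (𝟙 (symTensor n c')) ≫ rebracket n (a' ++ b') c' ≫
          eqToHom (congrArg (symTensor n) (List.append_assoc a' b' c')) := by
        rw [reassoc_of% h₁, reassoc_of% h₃]
    _ = (MonoidalSupercategory.associator _ _ _).hom ≫
          tensorHom (𝟙 (symTensor n a)) (rebracket n b c) ≫ rebracket n a (b ++ c) ≫
            ev n (.tensor f (.tensor g h)) := by
        rw [h₆, h₂, ← reassoc_of% h₄, ← Category.assoc, associator_naturality, Category.assoc]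
    _ = _ := by
        rw [← reassoc_of% h₅]

/-- Rebracketing with an empty left word is the left unitor, so this is its naturality. On the
right, in the next lemma, `rebracket_nil` supplies the additional cast. -/
theorem ev_id_tensor (f : WebExpr a b) : ev n (.tensor (.id []) f) = ev n f := by
  have h := rebracket_ev_tensor (n := n) (.id []) f
  rw [ev_id] at h
  exact (cancel_epi (leftUnitor (symTensor n a)).hom).1
    (h.trans (leftUnitor_naturality (ev n f)))

theorem ev_tensor_id_nil (f : WebExpr a b) :
    ev n (.comp (.tensor f (.id [])) (.cast (List.append_nil b))) =
      ev n (.comp (.cast (List.append_nil a)) f) := by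
  have h := rebracket_ev_tensor (n := n) f (.id [])
  rw [ev_id] at h
  rw [ev_comp, ev_comp, ev_cast, ev_cast, ← cancel_epi (rebracket n a []), reassoc_of% h,
    rebracket_nil, reassoc_of% (rebracket_nil (n := n) a)]
  exact rightUnitor_naturality (ev n f)

end Structural

end QModS

namespace QModS

open SuperSpace WebExpr

variable {n : ℕ}

/-! ### Webs on few strands as linear maps -/

section Shapes

/-- A single letter in front of a nonempty word is already bracketed correctly, so both
rebracketings are identities. -/
theorem ev_tensor_one {k k' l l' : ℕ} {c d : List ℕ} (f : WebExpr [k] [k'])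
    (g : WebExpr (l :: c) (l' :: d)) :
    ev n (.tensor f g) = tensorHom (ev n f) (ev n g) := by
  have h := rebracket_ev_tensor (n := n) f g
  exact (Category.id_comp (X := tensorObj (sym n k) (symTensor n (l :: c)))
    (Y := symTensor n ([k'] ++ l' :: d)) (ev n (.tensor f g))).symm.trans (h.trans
      (Category.comp_id (X := tensorObj (sym n k) (symTensor n (l :: c)))
        (Y := tensorObj (sym n k') (symTensor n (l' :: d))) (tensorHom (ev n f) (ev n g))))

/-- With two letters on the left one reassociation is needed. This is where the associators in the
formulas for ladders and for pairs of rungs come from. -/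
theorem rebracket_two (h k l : ℕ) (c : List ℕ) : rebracket n [h, k] (l :: c) =
    (MonoidalSupercategory.associator (sym n h) (sym n k) (symTensor n (l :: c))).hom := by
  change (MonoidalSupercategory.associator (sym n h) (sym n k) (symTensor n (l :: c))).hom ≫
    tensorHom (𝟙 (sym n h)) (𝟙 (tensorObj (sym n k) (symTensor n (l :: c)))) = _
  rw [tensorHom_id, Category.comp_id]

theorem toLin_tensor_two_one {h k m l l' : ℕ} (f : WebExpr [h, k] [m]) (g : WebExpr [l] [l']) :
    toLin (ev n (.tensor f g)) = toLin (tensorHom (ev n f) (ev n g)) ∘ₗ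
      (assoc (sym n h).1.toSuperSpace (sym n k).1.toSuperSpace
        (sym n l).1.toSuperSpace).symm.toLinearMap := by
  have e := congrArg toLin (rebracket_ev_tensor (n := n) f g)
  rw [rebracket_two] at e
  refine LinearMap.ext fun x => ?_
  obtain ⟨y, rfl⟩ := (assoc (sym n h).1.toSuperSpace (sym n k).1.toSuperSpace
        (sym n l).1.toSuperSpace).surjective x
  refine (LinearMap.congr_fun e y).trans (Eq.symm ?_)
  exact congrArg (toLin (tensorHom (ev n f) (ev n g))) (LinearEquiv.symm_apply_apply (assoc
    (sym n h).1.toSuperSpace (sym n k).1.toSuperSpace (sym n l).1.toSuperSpace) y)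

theorem toLin_tensor_one_two {h k m l l' : ℕ} (f : WebExpr [m] [h, k]) (g : WebExpr [l] [l']) :
    toLin (ev n (.tensor f g)) = (assoc (sym n h).1.toSuperSpace (sym n k).1.toSuperSpace
        (sym n l').1.toSuperSpace).toLinearMap ∘ₗ toLin (tensorHom (ev n f) (ev n g)) := by
  have e := congrArg toLin (rebracket_ev_tensor (n := n) f g)
  rw [rebracket_two] at e
  exact e

theorem toLin_tensor_two_two {h k h' k' l l' : ℕ} (f : WebExpr [h, k] [h', k'])
    (g : WebExpr [l] [l']) :
    toLin (ev n (.tensor f g)) = (assoc (sym n h').1.toSuperSpace (sym n k').1.toSuperSpace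
        (sym n l').1.toSuperSpace).toLinearMap ∘ₗ toLin (tensorHom (ev n f) (ev n g)) ∘ₗ
      (assoc (sym n h).1.toSuperSpace (sym n k).1.toSuperSpace
        (sym n l).1.toSuperSpace).symm.toLinearMap := by
  have e := congrArg toLin (rebracket_ev_tensor (n := n) f g)
  rw [rebracket_two, rebracket_two] at e
  refine LinearMap.ext fun x => ?_
  obtain ⟨y, rfl⟩ := (assoc (sym n h).1.toSuperSpace (sym n k).1.toSuperSpace
        (sym n l).1.toSuperSpace).surjective x
  refine (LinearMap.congr_fun e y).trans (Eq.symm ?_)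
  exact congrArg (fun t => assoc (sym n h').1.toSuperSpace (sym n k').1.toSuperSpace
    (sym n l').1.toSuperSpace (toLin (tensorHom (ev n f) (ev n g)) t))
    (LinearEquiv.symm_apply_apply (assoc (sym n h).1.toSuperSpace (sym n k).1.toSuperSpace
      (sym n l).1.toSuperSpace) y)

theorem toLin_id_tensor {k l l' : ℕ} {c d : List ℕ} (g : WebExpr (l :: c) (l' :: d)) :
    toLin (ev n (.tensor (.id [k]) g)) = tensorMap (M := (sym n k).1.toSuperSpace)
      (M' := (sym n k).1.toSuperSpace) (N := (symTensor n (l :: c)).1.toSuperSpace)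
      (N' := (symTensor n (l' :: d)).1.toSuperSpace) LinearMap.id (toLin (ev n g)) := by
  rw [ev_tensor_one, ev_id]
  rfl

theorem toLin_tensor_id {k k' l : ℕ} {c : List ℕ} (f : WebExpr [k] [k']) :
    toLin (ev n (.tensor f (.id (l :: c)))) = tensorMap (M := (sym n k).1.toSuperSpace)
      (M' := (sym n k').1.toSuperSpace) (N := (symTensor n (l :: c)).1.toSuperSpace)
      (N' := (symTensor n (l :: c)).1.toSuperSpace) (toLin (ev n f)) LinearMap.id := by
  rw [ev_tensor_one, ev_id]
  rfl

theorem toLin_dot (k : ℕ) :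
    toLin (ev n (.dot k)) = SuperModule.der (M := qNatural n) (cliffordC n) k := by
  rw [ev]; rfl

theorem toLin_merge {k l m : ℕ} (h : k + l = m) :
    toLin (ev n (.merge k l m h)) = SuperModule.mergeLin (qNatural n) k l m := by
  rw [ev]; rfl

theorem toLin_split {k l m : ℕ} (h : k + l = m) :
    toLin (ev n (.split k l m h)) = SuperModule.split (qNatural n) k l m := by
  rw [ev]; rfl

theorem toLin_create : toLin (ev n .create) = SuperModule.unitLin (qNatural n) := by
  rw [ev]; rfl

theorem toLin_erase : toLin (ev n .erase) = SuperModule.counitLin (qNatural n) := by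
  rw [ev]; rfl

/-- The endomorphism of `S^1(V_n)` attached to a web with one strand of label `1`. -/
noncomputable abbrev evOne (x : WebExpr [1] [1]) : SuperModule.EndOne (qNatural n) :=
  toLin (ev n x)

theorem toLin_ladderLeft (x : WebExpr [1] [1]) (k l : ℕ) :
    toLin (ev n (ladderLeft x k l)) =
      SuperModule.rungLeft (M := qNatural n) (evOne x) k (l + 1) (k + 1) l := by
  rw [ladderLeft, ev_comp, ev_comp, toLin_comp, toLin_comp, toLin_id_tensor]
  rw [toLin_tensor_two_one, toLin_id_tensor, toLin_tensor_id, toLin_split, toLin_tensorHom,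
    toLin_merge, ev_id]
  rfl

theorem toLin_ladderRight (x : WebExpr [1] [1]) (k l : ℕ) :
    toLin (ev n (ladderRight x k l)) =
      SuperModule.rungRight (M := qNatural n) (evOne x) (k + 1) l k (l + 1) := by
  rw [ladderRight, ev_comp, ev_comp, toLin_comp, toLin_comp, toLin_id_tensor]
  rw [toLin_tensor_one_two, toLin_id_tensor, toLin_tensor_id, toLin_merge, toLin_tensorHom,
    toLin_split, ev_id]
  rfl

end Shapes

end QModS

namespace SuperModule

open SuperSpace

section Rungs

variable {𝔤 : LieSuperalgebra} {M : SuperModule 𝔤}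

/-- A strand of label `0` has no letter to give away, so the split into the truncated label
vanishes. This matches the convention for negative labels. -/
theorem rungRight_zero (x : EndOne M) (l k l' : ℕ) (h : k = 0 - 1) : rungRight x 0 l k l' = 0 := by
  subst h
  rw [rungRight, split_pred_one_zero, tensorMap_zero_left, LinearMap.comp_zero]

theorem rungLeft_zero (x : EndOne M) (k k' l : ℕ) (h : l = 0 - 1) : rungLeft x k 0 k' l = 0 := by
  subst h
  rw [rungLeft, split_one_pred_zero, tensorMap_zero_right, LinearMap.comp_zero]

end Rungs

end SuperModule

namespace QModS

open SuperSpace WebExpr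

variable {n : ℕ}

/-! ### The defining relations -/

section Relations

theorem evOne_id : evOne (n := n) (.id [1]) = LinearMap.id := by
  rw [evOne, ev_id]; rfl

theorem evOne_dot : evOne (n := n) (.dot 1) = SuperModule.endOne (M := qNatural n) (cliffordC n) :=
  (toLin_dot 1).trans (SuperModule.der_one cliffordC_mem.1)

theorem evOne_id_parity : SuperModule.EndParity 0 (evOne (n := n) (.id [1])) := by
  rw [evOne_id]; exact linPart_id

theorem evOne_dot_parity : SuperModule.EndParity 1 (evOne (n := n) (.dot 1)) := by
  rw [evOne_dot]; exact SuperModule.endOne_parity cliffordC_mem.1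

theorem evOne_dot_dot : evOne (n := n) (.dot 1) ∘ₗ evOne (.dot 1) = LinearMap.id := by
  rw [evOne_dot]
  refine (SuperModule.endOne_comp (M := qNatural n) (cliffordC n) (cliffordC n)).symm.trans
    (Eq.trans ?_ SuperModule.endOne_id)
  exact congrArg (SuperModule.endOne (M := qNatural n)) (LinearMap.ext cliffordC_cliffordC)

/-- One formula for all labels: for `k = 0` the web is zero by convention, and the composite is zero
because its first rung vanishes. -/
theorem toLin_ladderRightLeft (x y : WebExpr [1] [1]) (k l : ℕ) :
    toLin (ev n (ladderRightLeft x y k l)) =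
      SuperModule.rungLeft (M := qNatural n) (evOne y) (k - 1) (l + 1) k l ∘ₗ
        SuperModule.rungRight (evOne x) k l (k - 1) (l + 1) := by
  cases k with
  | zero =>
    rw [SuperModule.rungRight_zero _ _ _ _ rfl, LinearMap.comp_zero, ladderRightLeft, ev_zero]
    rfl
  | succ k =>
    rw [ladderRightLeft, ev_comp, toLin_comp, toLin_ladderLeft, toLin_ladderRight]
    rfl

theorem toLin_ladderLeftRight (x y : WebExpr [1] [1]) (k l : ℕ) :
    toLin (ev n (ladderLeftRight x y k l)) =
      SuperModule.rungRight (M := qNatural n) (evOne y) (k + 1) (l - 1) k l ∘ₗ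
        SuperModule.rungLeft (evOne x) k l (k + 1) (l - 1) := by
  cases l with
  | zero =>
    rw [SuperModule.rungLeft_zero _ _ _ _ rfl, LinearMap.comp_zero]
    cases k <;> rw [ladderLeftRight, ev_zero] <;> rfl
  | succ l =>
    have h : ladderLeftRight x y k (l + 1) = .comp (ladderLeft x k l) (ladderRight y k l) := by
      cases k <;> rfl
    rw [h, ev_comp, toLin_comp, toLin_ladderLeft, toLin_ladderRight]
    rfl

/-- If the decorations are not both odd, the supercommutator in `rung_square` is a commutator. This
covers all three square switch relations. -/
theorem toLin_square {p q : ZMod 2} {x y : WebExpr [1] [1]}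
    (hx : SuperModule.EndParity p (evOne (n := n) x)) (hy : SuperModule.EndParity q (evOne (n := n) y))
    (hpq : p * q = 0) (k l : ℕ) :
    toLin (ev n (.sub (ladderRightLeft x y k l) (ladderLeftRight y x k l))) =
      tensorMap (M := (sym n k).1.toSuperSpace) (M' := (sym n k).1.toSuperSpace)
          (N := (sym n l).1.toSuperSpace) (N' := (sym n l).1.toSuperSpace)
          (SuperModule.derRight (evOne y ∘ₗ evOne x) k) LinearMap.id -
        tensorMap LinearMap.id (SuperModule.derLeft (evOne x ∘ₗ evOne y) l) := by
  have h := SuperModule.rung_square hx hy k l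
  rw [hpq, sgn_zero, one_smul, one_smul, ← toLin_ladderRightLeft, ← toLin_ladderLeftRight] at h
  rw [ev_sub]
  exact h

theorem toLin_left₂₁ (x y : WebExpr [1] [1]) (h k l : ℕ) :
    toLin (ev n (left₂₁ x y h k l)) =
      SuperModule.onLeft (SuperModule.rungLeft (M := qNatural n) (evOne y) h (k + 1) (h + 1) k) l ∘ₗ
        SuperModule.onRight h (SuperModule.rungLeft (evOne x) k (l + 1) (k + 1) l) := by
  rw [left₂₁, ev_comp, toLin_comp, toLin_id_tensor, toLin_ladderLeft]
  rw [toLin_tensor_two_two, toLin_tensorHom, toLin_ladderLeft, ev_id]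
  rfl

theorem toLin_left₁₂ (x y : WebExpr [1] [1]) (h k l : ℕ) :
    toLin (ev n (left₁₂ x y h k l)) =
      SuperModule.onRight (h + 1) (SuperModule.rungLeft (M := qNatural n) (evOne y) (k - 1) (l + 1) k l) ∘ₗ
        SuperModule.onLeft (SuperModule.rungLeft (evOne x) h k (h + 1) (k - 1)) (l + 1) := by
  cases k with
  | zero =>
    rw [SuperModule.rungLeft_zero _ _ _ _ rfl, left₁₂, ev_zero, SuperModule.onLeft,
      SuperModule.tensorMap_zero_left, LinearMap.zero_comp, LinearMap.comp_zero, LinearMap.comp_zero]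
    rfl
  | succ k =>
    rw [left₁₂, ev_comp, toLin_comp, toLin_id_tensor, toLin_ladderLeft]
    rw [toLin_tensor_two_two, toLin_tensorHom, toLin_ladderLeft, ev_id]
    rfl

theorem toLin_right₁₂ (x y : WebExpr [1] [1]) (h k l : ℕ) :
    toLin (ev n (right₁₂ x y h k l)) =
      SuperModule.onRight h (SuperModule.rungRight (M := qNatural n) (evOne y) (k + 1) l k (l + 1)) ∘ₗ
        SuperModule.onLeft (SuperModule.rungRight (evOne x) (h + 1) k h (k + 1)) l := by
  rw [right₁₂, ev_comp, toLin_comp, toLin_id_tensor, toLin_ladderRight]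
  rw [toLin_tensor_two_two, toLin_tensorHom, toLin_ladderRight, ev_id]
  rfl

theorem toLin_right₂₁ (x y : WebExpr [1] [1]) (h k l : ℕ) :
    toLin (ev n (right₂₁ x y h k l)) =
      SuperModule.onLeft (SuperModule.rungRight (M := qNatural n) (evOne y) (h + 1) (k - 1) h k) (l + 1) ∘ₗ
        SuperModule.onRight (h + 1) (SuperModule.rungRight (evOne x) k l (k - 1) (l + 1)) := by
  cases k with
  | zero =>
    rw [SuperModule.rungRight_zero _ _ _ _ rfl, right₂₁, ev_zero, SuperModule.onRight,
      SuperModule.tensorMap_zero_right, LinearMap.comp_zero]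
    rfl
  | succ k =>
    rw [right₂₁, ev_comp, toLin_comp, toLin_id_tensor, toLin_ladderRight]
    rw [toLin_tensor_two_two, toLin_tensorHom, toLin_ladderRight, ev_id]
    rfl

/-- The decorations of a web are listed from bottom to top, so reversing the order of the rungs
swaps the arguments; `y` remains on strands 1 and 2 and `x` on strands 2 and 3. -/
theorem toLin_commLeft (p q : ZMod 2) (x y : WebExpr [1] [1]) (h k l : ℕ) :
    toLin (ev n (left₂₁ x y h k l)) - sgn (p * q) • toLin (ev n (left₁₂ y x h k l)) =
      SuperModule.commLeft (M := qNatural n) p q (evOne x) (evOne y) h k l := by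
  rw [toLin_left₂₁, toLin_left₁₂]
  rfl

theorem toLin_commRight (p q : ZMod 2) (x y : WebExpr [1] [1]) (h k l : ℕ) :
    toLin (ev n (right₁₂ x y h k l)) - sgn (p * q) • toLin (ev n (right₂₁ y x h k l)) =
      SuperModule.commRight (M := qNatural n) p q (evOne x) (evOne y) h k l := by
  rw [toLin_right₁₂, toLin_right₂₁]
  rfl

theorem toLin_sub {X Y : QModS n} (f g : X ⟶ Y) : toLin (f - g) = toLin f - toLin g := rfl

theorem ev_tensor_cat {a b c d : List ℕ} (f : WebExpr a b) {g : WebExpr c d} (hg : HasParity 0 g)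
    (x : El n a) (y : El n c) :
    toLin (ev n (.tensor f g)) (cat a c x y) = cat b d (toLin (ev n f) x) (toLin (ev n g) y) := by
  have e := congrArg toLin (rebracket_ev_tensor (n := n) f g)
  refine (LinearMap.congr_fun e (x ⊗ₜ[ℂ] y)).trans ?_
  exact congrArg _ (toLin_tensorHom_tmul (ev n f) (ev_mem hg) x y)

theorem toLin_dot_tensor_id (k l : ℕ) :
    toLin (ev n (.tensor (.dot k) (.id [l]))) = tensorMap (M := (sym n k).1.toSuperSpace)
      (M' := (sym n k).1.toSuperSpace) (N := (sym n l).1.toSuperSpace)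
      (N' := (sym n l).1.toSuperSpace) (SuperModule.der (M := qNatural n) (cliffordC n) k)
        LinearMap.id := by
  rw [toLin_tensor_id, ← toLin_dot]
  rfl

theorem toLin_id_tensor_dot (k l : ℕ) :
    toLin (ev n (.tensor (.id [k]) (.dot l))) = tensorMap (M := (sym n k).1.toSuperSpace)
      (M' := (sym n k).1.toSuperSpace) (N := (sym n l).1.toSuperSpace)
      (N' := (sym n l).1.toSuperSpace) LinearMap.id
        (SuperModule.der (M := qNatural n) (cliffordC n) l) := by
  rw [toLin_id_tensor, ← toLin_dot]
  rfl

theorem tensorMap_smul_id_sub (M N : SuperSpace) (a b : ℂ) :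
    tensorMap (M := M) (N := N) (a • LinearMap.id) LinearMap.id -
      tensorMap LinearMap.id (b • LinearMap.id) = (a - b) • LinearMap.id := by
  rw [tensorMap_smul_left, tensorMap_smul_right, tensorMap_id]
  exact (sub_smul a b (LinearMap.id : M ⊗[ℂ] N →ₗ[ℂ] M ⊗[ℂ] N)).symm

theorem ev_basic {a b : List ℕ} {f g : WebExpr a b} (h : BasicRel f g) : ev n f = ev n g := by
  have e := evOne_id_parity (n := n)
  have d := evOne_dot_parity (n := n)
  have hc := cliffordC_mem (n := n)
  refine toLin_injective ?_
  cases h with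
  | merge_assoc h k l r s t h₁ h₂ h₃ h₄ =>
    rw [ev_comp, toLin_comp, toLin_merge]
    rw [toLin_tensor_two_one, toLin_tensorHom, toLin_merge, ev_comp, toLin_comp, toLin_id_tensor,
      toLin_merge, toLin_merge, ev_id]
    refine SuperModule.sym₃_ext (M := qNatural n) fun α β γ a ha b hb c hc => ?_
    have E₁ := tensorMap_tmul (M := (SuperModule.sym₂ (qNatural n) h k).toSuperSpace)
      (N := (SuperModule.symPow (qNatural n) l).toSuperSpace)
      (SuperModule.mergeLin (qNatural n) h k r) linPart_id (tmul_mem_tensorPart ha hb) c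
    have E₂ := tensorMap_tmul (N := (SuperModule.sym₂ (qNatural n) k l).toSuperSpace)
      (LinearMap.id : (SuperModule.symPow (qNatural n) h).carrier →ₗ[ℂ] _)
      (SuperModule.mergeLin_linPart (M := qNatural n) k l s) ha (b ⊗ₜ[ℂ] c)
    rw [zero_mul, sgn_zero, one_smul] at E₁ E₂
    refine (congrArg (SuperModule.mergeLin (qNatural n) r l t) E₁).trans
      (Eq.trans ?_ (congrArg (SuperModule.mergeLin (qNatural n) h s t) E₂).symm)
    exact SuperModule.merge_assoc h₁ h₂ h₃ h₄ a b c
  | split_assoc h k l r s t h₁ h₂ h₃ h₄ =>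
    rw [ev_comp, toLin_comp, toLin_split]
    rw [toLin_tensor_one_two, toLin_tensorHom, toLin_split, ev_comp, toLin_comp, toLin_id_tensor,
      toLin_split, toLin_split, ev_id]
    exact SuperModule.split_assoc h₁ h₂ h₃ h₄
  | digon k l m h =>
    rw [ev_comp, toLin_comp, toLin_merge, toLin_split, ev_smul, ev_id]
    exact SuperModule.mergeLin_split h
  | dot_dot k =>
    rw [ev_comp, toLin_comp, toLin_dot, ev_smul, ev_id]
    exact (SuperModule.isDer_der hc.1).comp_self hc.1 cliffordC_cliffordC k
  | dot_merge k l m h =>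
    rw [ev_comp, toLin_comp, ev_comp, toLin_comp, toLin_merge, toLin_dot, ev_add, toLin_add,
      toLin_id_tensor_dot, toLin_dot_tensor_id]
    exact (SuperModule.isDer_der hc.1).comp_mergeLin hc.1 h
  | dot_split k l m h =>
    rw [ev_comp, toLin_comp, ev_comp, toLin_comp, toLin_split, toLin_dot, ev_add, toLin_add,
      toLin_id_tensor_dot, toLin_dot_tensor_id]
    exact (SuperModule.isDer_der hc.1).split_comp hc.1 h
  | dumbbell =>
    have h₁ : toLin (ev n WebExpr.dumbbell) =
        SuperModule.split (qNatural n) 1 1 2 ∘ₗ SuperModule.mergeLin (qNatural n) 1 1 2 := by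
      rw [WebExpr.dumbbell, ev_comp, toLin_comp, toLin_merge, toLin_split]
      rfl
    have h₂ : toLin (ev n twoDots) = tensorMap (evOne (n := n) (.dot 1)) LinearMap.id ∘ₗ
        tensorMap LinearMap.id (evOne (n := n) (.dot 1)) := by
      rw [twoDots, ev_comp, toLin_comp, toLin_id_tensor, toLin_tensor_id]
      rfl
    rw [ev_sub, toLin_sub, ev_comp, ev_comp, toLin_comp, toLin_comp, h₁, h₂, ev_smul, ev_id]
    exact SuperModule.split_merge_conj d evOne_dot_dot
  | square k l =>
    -- Without dots both derivations extend the identity, so they are the Euler derivations with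
    -- values `k` and `l`.
    rw [toLin_square e e (zero_mul 0), evOne_id, LinearMap.id_comp, ev_smul, ev_id,
      ← SuperModule.endOne_id]
    have h₁ := SuperModule.derRight_endOne (linPart_id (M := (qNatural n).toSuperSpace)) k
    have h₂ := SuperModule.der_id (M := qNatural n) k
    have h₃ := SuperModule.der_id (M := qNatural n) l
    rw [SuperModule.der] at h₃
    rw [h₁, h₂, h₃]
    exact tensorMap_smul_id_sub _ _ _ _
  | square_dot_upper k l =>
    -- With a single dotted rung both derivations extend `c`, so they are the dots on the two
    -- strands.
    rw [toLin_square e d (zero_mul 1), evOne_id, LinearMap.id_comp, LinearMap.comp_id, evOne_dot,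
      ev_sub, toLin_sub, toLin_id_tensor_dot, toLin_dot_tensor_id]
    rw [SuperModule.derRight_endOne hc.1]
    rfl
  | square_dot_lower k l =>
    rw [toLin_square d e (mul_zero 1), evOne_id, LinearMap.id_comp, LinearMap.comp_id, evOne_dot,
      ev_sub, toLin_sub, toLin_id_tensor_dot, toLin_dot_tensor_id]
    rw [SuperModule.derRight_endOne hc.1]
    rfl
  | double_left_one h k l =>
    have h₁ := toLin_commLeft (n := n) 0 0 (.id [1]) (.id [1]) h k l
    have h₂ := toLin_commLeft (n := n) 1 1 (.dot 1) (.dot 1) h k l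
    rw [zero_mul, sgn_zero, one_smul] at h₁
    rw [one_mul, sgn_one, neg_one_smul, sub_neg_eq_add] at h₂
    rw [ev_sub, toLin_sub, ev_add, toLin_add, h₁, h₂]
    -- `1 ∘ 1 = c ∘ c`, and the total parities agree since `1 + 1 = 0`. The supercommutator of two
    -- odd rungs is an anticommutator, hence the plus sign in the relation.
    exact SuperModule.commLeft_congr e e d d rfl (by rw [evOne_dot_dot, evOne_id]; rfl) h k l
  | double_left_two h k l =>
    have h₁ := toLin_commLeft (n := n) 1 0 (.dot 1) (.id [1]) h k l
    have h₂ := toLin_commLeft (n := n) 0 1 (.id [1]) (.dot 1) h k l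
    rw [mul_zero, sgn_zero, one_smul] at h₁
    rw [zero_mul, sgn_zero, one_smul] at h₂
    rw [ev_sub, toLin_sub, ev_sub, toLin_sub, h₁, h₂]
    -- The dot may sit on either rung: `1 ∘ c = c ∘ 1`.
    exact SuperModule.commLeft_congr d e e d rfl (by rw [evOne_id]; rfl) h k l
  | double_right_one h k l =>
    have h₁ := toLin_commRight (n := n) 0 0 (.id [1]) (.id [1]) h k l
    have h₂ := toLin_commRight (n := n) 1 1 (.dot 1) (.dot 1) h k l
    rw [zero_mul, sgn_zero, one_smul] at h₁
    rw [one_mul, sgn_one, neg_one_smul, sub_neg_eq_add] at h₂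
    rw [ev_sub, toLin_sub, ev_add, toLin_add, h₁, h₂]
    exact SuperModule.commRight_congr e e d d rfl (by rw [evOne_dot_dot, evOne_id]; rfl) h k l
  | double_right_two h k l =>
    have h₁ := toLin_commRight (n := n) 1 0 (.dot 1) (.id [1]) h k l
    have h₂ := toLin_commRight (n := n) 0 1 (.id [1]) (.dot 1) h k l
    rw [mul_zero, sgn_zero, one_smul] at h₁
    rw [zero_mul, sgn_zero, one_smul] at h₂
    rw [ev_sub, toLin_sub, ev_sub, toLin_sub, h₁, h₂]
    exact SuperModule.commRight_congr d e e d rfl (by rw [evOne_id]; rfl) h k l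
  | create_erase =>
    rw [ev_comp, toLin_comp, toLin_create, toLin_erase, ev_id]
    exact SuperModule.counitLin_comp_unitLin
  | erase_create =>
    rw [ev_comp, toLin_comp, toLin_create, toLin_erase, ev_id]
    exact SuperModule.unitLin_comp_counitLin
  | merge_zero_left l h =>
    rw [ev_comp, toLin_comp, toLin_merge, ev_id]
    refine LinearMap.ext fun x => ?_
    have h₁ := ev_tensor_cat (n := n) .create (.id [l]) (1 : ℂ) x
    rw [cat_nil_left, one_smul, toLin_create, ev_id] at h₁
    refine (congrArg (SuperModule.mergeLin (qNatural n) 0 l l) h₁).trans ?_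
    refine (congrArg (fun t => SuperModule.merge (qNatural n) 0 l l t x)
      (one_smul ℂ (SuperModule.symOne (qNatural n)))).trans ?_
    exact SuperModule.merge_symOne l x
  | merge_zero_right k h =>
    rw [ev_comp, toLin_comp, toLin_merge, ev_id]
    refine LinearMap.ext fun x => ?_
    have h₁ := ev_tensor_cat (n := n) (.id [k]) .create x (1 : ℂ)
    rw [cat_nil_right, one_smul, toLin_create, ev_id] at h₁
    refine (congrArg (SuperModule.mergeLin (qNatural n) k 0 k) h₁).trans ?_
    refine (congrArg (fun t => SuperModule.merge (qNatural n) k 0 k x t)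
      (one_smul ℂ (SuperModule.symOne (qNatural n)))).trans ?_
    exact SuperModule.merge_symOne_right k x
  | split_zero_left l h =>
    rw [ev_comp, toLin_comp, toLin_split, ev_id]
    refine LinearMap.ext fun x => ?_
    have h₁ := ev_tensor_cat (n := n) .erase (.id [l]) (SuperModule.symOne (qNatural n)) x
    rw [toLin_erase, ev_id] at h₁
    exact (congrArg _ (SuperModule.split_zero_left l x)).trans (h₁.trans
      ((congrArg (fun t : ℂ => t • x) SuperModule.counitLin_symOne).trans (one_smul ℂ x)))
  | split_zero_right k h =>
    rw [ev_comp, toLin_comp, toLin_split, ev_id]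
    refine LinearMap.ext fun x => ?_
    have h₁ := ev_tensor_cat (n := n) (.id [k]) .erase x (SuperModule.symOne (qNatural n))
    rw [toLin_erase, ev_id] at h₁
    exact (congrArg _ (SuperModule.split_zero_right k x)).trans (h₁.trans
      ((congrArg (fun t : ℂ => t • x) SuperModule.counitLin_symOne).trans (one_smul ℂ x)))
  | dot_zero =>
    rw [toLin_dot, ev_zero]
    exact (SuperModule.isDer_der hc.1).zero

end Relations

end QModS

namespace QModS

open SuperSpace WebExpr

variable {n : ℕ}

/-! ### The functor and its essential surjectivity -/

section Functor

/-- Evaluation descends to webs. The linear and categorical axioms hold in any linear category, and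
the tensor axioms and the defining relations have been verified separately. -/
theorem ev_rel {a b : List ℕ} {f g : WebExpr a b} (h : Rel f g) : ev n f = ev n g := by
  induction h with
  | basic h => exact ev_basic h
  | refl f => rfl
  | symm _ h => exact h.symm
  | trans _ _ h h' => exact h.trans h'
  | comp_congr _ _ h h' => rw [ev_comp, ev_comp, h, h']
  | tensor_congr _ _ h h' => rw [ev_tensor, ev_tensor, h, h']
  | add_congr _ _ h h' => rw [ev_add, ev_add, h, h']
  | smul_congr r _ h => rw [ev_smul, ev_smul, h]
  | add_assoc f g h => simp only [ev_add, add_assoc]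
  | add_comm f g => simp only [ev_add, add_comm]
  | zero_add f => simp only [ev_add, ev_zero, zero_add]
  | one_smul f => simp only [ev_smul, one_smul]
  | zero_smul f => simp only [ev_smul, ev_zero, zero_smul]
  | mul_smul r s f => simp only [ev_smul, mul_smul]
  | smul_add r f g => simp only [ev_smul, ev_add, smul_add]
  | add_smul r s f => simp only [ev_smul, ev_add, add_smul]
  | id_comp f => rw [ev_comp, ev_id, Category.id_comp]
  | comp_id f => rw [ev_comp, ev_id, Category.comp_id]
  | comp_assoc f g h => simp only [ev_comp, Category.assoc]
  | add_comp f f' g => simp only [ev_comp, ev_add, Preadditive.add_comp]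
  | comp_add f g g' => simp only [ev_comp, ev_add, Preadditive.comp_add]
  | smul_comp r f g => simp only [ev_comp, ev_smul, Linear.smul_comp]
  | comp_smul r f g => simp only [ev_comp, ev_smul, Linear.comp_smul]
  | add_tensor f f' g =>
    simp only [ev_tensor, ev_add, map_add, LinearMap.add_apply, Preadditive.add_comp,
      Preadditive.comp_add]
  | tensor_add f g g' =>
    simp only [ev_tensor, ev_add, map_add, Preadditive.add_comp, Preadditive.comp_add]
  | smul_tensor r f g =>
    simp only [ev_tensor, ev_smul, map_smul, LinearMap.smul_apply, Linear.smul_comp,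
      Linear.comp_smul]
  | tensor_smul r f g =>
    simp only [ev_tensor, ev_smul, map_smul, Linear.smul_comp, Linear.comp_smul]
  | tensor_id a b => exact ev_tensor_id a b
  | interchange h f k g hg hh => exact ev_interchange h f k g hg hh
  | tensor_assoc f g h => exact ev_tensor_assoc f g h
  | id_tensor f => exact ev_id_tensor f
  | tensor_id_nil f => exact ev_tensor_id_nil f

/-- The action of the functor on morphisms. -/
noncomputable def evMap (n : ℕ) {a b : WebUp} : (a ⟶ b) →ₗ[ℂ] (symTensor n a ⟶ symTensor n b) where
  toFun := Quotient.lift (ev n) fun _ _ h => ev_rel h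
  map_add' f g := by
    induction f using WebHom.ind (a := a) (b := b)
    induction g using WebHom.ind (a := a) (b := b)
    exact ev_add _ _
  map_smul' r f := by
    induction f using WebHom.ind (a := a) (b := b)
    exact ev_smul _ _

theorem evMap_eqToHom {a b : WebUp} (h : a = b) :
    evMap n (eqToHom h) = eqToHom (congrArg (symTensor n) h) := by
  subst h
  exact ev_id a

/-- The canonical rebracketing isomorphism. -/
noncomputable def rebracketIso (n : ℕ) (a b : List ℕ) :
    tensorObj (symTensor n a) (symTensor n b) ≅ symTensor n (a ++ b) :=
  asIso (rebracket n a b)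

/-- The monoidal functor from upward webs to supermodules of `q(n)`. -/
noncomputable def webFunctor (n : ℕ) :
    MonoidalSuperfunctor (C := WebUp) (D := QModS n) (QModS.symTensor n) where
  map := evMap n
  map_mem {a b p f} hf := by
    obtain ⟨f, hf, rfl⟩ := hf
    exact ev_mem hf
  map_id a := ev_id a
  map_comp {a b c} f g := by
    induction f using WebHom.ind (a := a) (b := b)
    induction g using WebHom.ind (a := b) (b := c)
    exact ev_comp _ _
  unitIso := Iso.refl _
  unitIso_mem := id_mem _
  tensorIso a b := rebracketIso n a b
  tensorIso_mem a b := rebracket_mem a b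
  tensorIso_naturality {a b c d} f g := by
    induction f using WebHom.ind (a := a) (b := b)
    induction g using WebHom.ind (a := c) (b := d)
    exact (rebracket_ev_tensor _ _).symm
  associativity a b c := by
    -- The associator of webs is an `eqToHom`, and so is its image; the axiom thus becomes the
    -- coherence of rebracketing.
    refine Eq.trans ?_ (rebracket_assoc a b c)
    exact congrArg (fun t => tensorHom (rebracket n a b) (𝟙 (symTensor n c)) ≫
      rebracket n (List.append a b) c ≫ t) (evMap_eqToHom (n := n) (WebUp.append_assoc a b c))
  left_unitality a := by
    have h : evMap n (leftUnitor a).hom = 𝟙 (symTensor n a) := ev_id a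
    rw [h]
    change _ = tensorHom (𝟙 tensorUnit) (𝟙 (symTensor n a)) ≫ (leftUnitor (symTensor n a)).hom ≫ _
    rw [tensorHom_id, Category.id_comp, Category.comp_id]
  right_unitality a := by
    refine (rebracket_nil a).symm.trans ?_
    change _ = tensorHom (𝟙 (symTensor n a)) (𝟙 tensorUnit) ≫ rebracket n a [] ≫
      evMap n (eqToHom (WebUp.append_nil a))
    rw [tensorHom_id, Category.id_comp]
    exact (congrArg (rebracket n a [] ≫ ·) (evMap_eqToHom (n := n) (WebUp.append_nil a))).symm

/-- Induction on how the object is generated. For a tensor product, the tensor product of the two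
even isomorphisms is again an even isomorphism, and rebracketing identifies its source with the
object of the concatenated word. -/
theorem superEssSurj (n : ℕ) : SuperEssSurj (C := WebUp) (D := QModS n) (QModS.symTensor n) := by
  rintro ⟨Y, hY⟩
  induction hY with
  | sym p => exact ⟨[p], Iso.refl _, id_mem _⟩
  | unit => exact ⟨([] : List ℕ), Iso.refl _, id_mem _⟩
  | @tensor M N hM hN ihM ihN =>
    obtain ⟨(a : List ℕ), (i : symTensor n a ≅ (⟨M, hM⟩ : QModS n)), hi⟩ := ihM
    obtain ⟨(b : List ℕ), (j : symTensor n b ≅ (⟨N, hN⟩ : QModS n)), hj⟩ := ihN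
    have h₁ : IsIso i.hom := Iso.isIso_hom i
    have h₂ : IsIso j.hom := Iso.isIso_hom j
    have h := isIso_tensorHom i.hom j.hom hi
    refine ⟨(a ++ b : List ℕ), (rebracketIso n a b).symm ≪≫ asIso (tensorHom i.hom j.hom), ?_⟩
    have h' := comp_mem (Supercategory.inv_mem (rebracket_mem (n := n) a b)) (tensorHom_mem hi hj)
    rw [add_zero, add_zero] at h'
    exact h'

end Functor

end QModS

namespace SuperModule

open SuperSpace

/-! ### Explicit formulas on products of vectors -/

section Products

variable {𝔤 : LieSuperalgebra} {M : SuperModule 𝔤}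

theorem symProd_mem {k : ℕ} {v : Fin k → M.carrier} {p : Fin k → ZMod 2}
    (hv : ∀ i, v i ∈ M.part (p i)) : symProd M v ∈ (symPow M k).part (∑ i, p i) := by
  induction k with
  | zero => rw [symProd_zero]; exact symOne_mem
  | succ k ih =>
    rw [symProd_succ, Fin.sum_univ_succ]
    exact lmul_mem (hv 0) (ih fun i => hv i.succ) rfl

/-- Unrolling the Leibniz rule: the odd derivation reaches position `t` after passing the vectors in
front of it, whence the sign. -/
theorem IsDer.symProd {z : M.carrier →ₗ[ℂ] M.carrier}
    {D : ∀ k, (symPow M k).carrier →ₗ[ℂ] (symPow M k).carrier} (hD : IsDer 1 z D) {k : ℕ}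
    {v : Fin k → M.carrier} {p : Fin k → ZMod 2} (hv : ∀ i, v i ∈ M.part (p i)) :
    D k (symProd M v) = ∑ t : Fin k, sgn (∑ s ∈ Finset.univ.filter (fun s => s < t), p s) •
      SuperModule.symProd M (Function.update v t (z (v t))) := by
  induction k with
  | zero => rw [hD.zero]; rfl
  | succ k ih =>
    rw [symProd_succ, hD.lmul k _ _ (hv 0), ih fun i => hv i.succ, Fin.sum_univ_succ, map_sum,
      Finset.smul_sum]
    congr 1
    · have h : Finset.univ.filter (fun s : Fin (k + 1) => s < 0) = ∅ := by simp
      rw [h, Finset.sum_empty, sgn_zero, one_smul, symProd_succ, Function.update_self]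
      congr 2
    · refine Finset.sum_congr rfl fun t _ => ?_
      have h : ∑ s ∈ Finset.univ.filter (fun s => s < t.succ), p s =
          p 0 + ∑ s ∈ Finset.univ.filter (fun s => s < t), p s.succ := by
        rw [Finset.sum_filter, Finset.sum_filter, Fin.sum_univ_succ]
        simp [Fin.succ_lt_succ_iff]
      rw [h, map_smul, smul_smul, sgn_add, one_mul, symProd_succ,
        Function.update_of_ne (Fin.succ_ne_zero t).symm]
      congr 3
      funext i
      by_cases hi : i = t
      · subst hi
        rw [Function.update_self, Function.update_self]
      · rw [Function.update_of_ne hi, Function.update_of_ne fun h => hi (Fin.succ_injective _ h)]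

/-- The family `u` is characterised by its entries rather than written as `Fin.append v w`, which
spares the induction a cast between `Fin (k + 1 + l)` and `Fin (k + l + 1)`. -/
theorem merge_symProd {k l m : ℕ} (h : k + l = m) (v : Fin k → M.carrier) (w : Fin l → M.carrier)
    (u : Fin m → M.carrier) (hv : ∀ i : Fin k, u ⟨i, by omega⟩ = v i)
    (hw : ∀ j : Fin l, u ⟨k + j, by omega⟩ = w j) :
    merge M k l m (symProd M v) (symProd M w) = symProd M u := by
  induction k generalizing m with
  | zero =>
    rw [zero_add] at h
    subst h
    rw [symProd_zero, merge_symOne]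
    congr 1
    funext j
    rw [← hw j]
    exact congrArg u (Fin.ext (zero_add j.1))
  | succ k ih =>
    obtain ⟨m, rfl⟩ : ∃ m', m = m' + 1 := ⟨k + l, by omega⟩
    rw [symProd_succ, merge_lmul, symProd_succ, ih (by omega) _ (fun i => u i.succ)
      (fun i => hv i.succ) (fun j => ?_)]
    · rw [← hv 0]; rfl
    · rw [← hw j]
      congr 1
      exact Fin.ext (by simp; omega)

/-- Sorting the subsets by whether they contain `0` mirrors the two terms of the recursion for
splits: the first vector goes to the left factor or to the right one. -/
theorem sum_finset_succ {X : Type*} [AddCommMonoid X] {m : ℕ} (f : Finset (Fin (m + 1)) → X) :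
    ∑ I, f I = ∑ J : Finset (Fin m), f (insert 0 (J.map (Fin.succEmb m))) +
      ∑ J : Finset (Fin m), f (J.map (Fin.succEmb m)) := by
  let e : Finset (Fin m) ⊕ Finset (Fin m) → Finset (Fin (m + 1)) :=
    Sum.elim (fun J => insert 0 (J.map (Fin.succEmb m))) fun J => J.map (Fin.succEmb m)
  have he : Function.Bijective e := by
    constructor
    · rintro (J | J) (J' | J') h
      · congr 1
        ext i
        have := Finset.ext_iff.1 h i.succ
        simpa [e] using this
      · have := Finset.ext_iff.1 h 0
        simp [e] at this
      · have := Finset.ext_iff.1 h 0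
        simp [e] at this
      · congr 1
        ext i
        have := Finset.ext_iff.1 h i.succ
        simpa [e] using this
    · intro I
      by_cases h : 0 ∈ I
      · refine ⟨.inl (Finset.univ.filter fun i => i.succ ∈ I), ?_⟩
        ext i
        refine Fin.cases ?_ (fun i => ?_) i
        · simp [e, h]
        · simp [e]
      · refine ⟨.inr (Finset.univ.filter fun i => i.succ ∈ I), ?_⟩
        ext i
        refine Fin.cases ?_ (fun i => ?_) i
        · simp [e, h]
        · simp [e]
  rw [← Function.Bijective.sum_comp he f, Fintype.sum_sum_type]
  rfl

theorem compl_map_succ {m : ℕ} (J : Finset (Fin m)) :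
    (J.map (Fin.succEmb m))ᶜ = insert 0 (Jᶜ.map (Fin.succEmb m)) := by
  ext i
  refine Fin.cases ?_ (fun i => ?_) i <;> simp

theorem compl_insert_map_succ {m : ℕ} (J : Finset (Fin m)) :
    (insert 0 (J.map (Fin.succEmb m)))ᶜ = Jᶜ.map (Fin.succEmb m) := by
  ext i
  refine Fin.cases ?_ (fun i => ?_) i <;> simp

theorem card_insert_map_succ {m : ℕ} (J : Finset (Fin m)) :
    (insert 0 (J.map (Fin.succEmb m))).card = J.card + 1 := by
  rw [Finset.card_insert_of_notMem (by simp), Finset.card_map]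

variable (M) in
/-- The product of the `v i`, `i ∈ I`, in `S^k(M)`; zero unless `I` has `k` elements. -/
noncomputable def partialProd {m : ℕ} (v : Fin m → M.carrier) (I : Finset (Fin m)) (k : ℕ) :
    (symPow M k).carrier :=
  if h : I.card = k then symProd M (v ∘ I.orderEmbOfFin h) else 0

theorem partialProd_of_card {m k : ℕ} (v : Fin m → M.carrier) {I : Finset (Fin m)}
    (h : I.card = k) : partialProd M v I k = symProd M (v ∘ I.orderEmbOfFin h) := dif_pos h

theorem partialProd_of_card_ne {m k : ℕ} (v : Fin m → M.carrier) {I : Finset (Fin m)}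
    (h : I.card ≠ k) : partialProd M v I k = 0 := dif_neg h

theorem partialProd_mem {m : ℕ} {v : Fin m → M.carrier} {p : Fin m → ZMod 2}
    (hv : ∀ i, v i ∈ M.part (p i)) (I : Finset (Fin m)) (k : ℕ) :
    partialProd M v I k ∈ (symPow M k).part (∑ i ∈ I, p i) := by
  by_cases h : I.card = k
  · rw [partialProd_of_card v h]
    have e : ∑ i ∈ I, p i = ∑ i, p (I.orderEmbOfFin h i) := by
      nth_rewrite 1 [← Finset.map_orderEmbOfFin_univ I h]
      rw [Finset.sum_map]
      rfl
    rw [e]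
    exact symProd_mem fun i => hv _
  · rw [partialProd_of_card_ne v h]
    exact zero_mem _

/-- The increasing enumeration of a finite set is unique, so that of the shifted set is the shifted
enumeration. -/
theorem partialProd_map_succ {m : ℕ} (v : Fin (m + 1) → M.carrier) (J : Finset (Fin m)) (k : ℕ) :
    partialProd M v (J.map (Fin.succEmb m)) k = partialProd M (fun i => v i.succ) J k := by
  by_cases h : J.card = k
  · have h' : (J.map (Fin.succEmb m)).card = k := by rw [Finset.card_map, h]
    rw [partialProd_of_card _ h, partialProd_of_card _ h']
    have e : Fin.succ ∘ J.orderEmbOfFin h = (J.map (Fin.succEmb m)).orderEmbOfFin h' :=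
      Finset.orderEmbOfFin_unique h' (fun i => by simp)
        ((Fin.strictMono_succ).comp (J.orderEmbOfFin h).strictMono)
    rw [← e]
    rfl
  · rw [partialProd_of_card_ne _ h, partialProd_of_card_ne]
    rwa [Finset.card_map]

theorem partialProd_insert_map_succ {m : ℕ} (v : Fin (m + 1) → M.carrier) (J : Finset (Fin m))
    (k : ℕ) : partialProd M v (insert 0 (J.map (Fin.succEmb m))) k =
      lmulPred M k (v 0) (partialProd M (fun i => v i.succ) J (k - 1)) := by
  have hc := card_insert_map_succ J
  cases k with
  | zero =>
    rw [lmulPred_zero, partialProd_of_card_ne _ (by omega)]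
    rfl
  | succ k =>
    rw [lmulPred_succ]
    change _ = lmul M (v 0) (partialProd M (fun i => v i.succ) J k)
    by_cases h : J.card = k
    · have h' : (insert 0 (J.map (Fin.succEmb m))).card = k + 1 := by rw [hc, h]
      rw [partialProd_of_card _ h, partialProd_of_card _ h']
      -- As `0` is the least index, it comes first in the increasing enumeration, so the vector `v
      -- 0` is the first factor of the product.
      have e : (Fin.cons 0 (Fin.succ ∘ J.orderEmbOfFin h) : Fin (k + 1) → Fin (m + 1)) =
          (insert 0 (J.map (Fin.succEmb m))).orderEmbOfFin h' := by
        refine Finset.orderEmbOfFin_unique h' (fun i => ?_) ?_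
        · refine Fin.cases ?_ (fun i => ?_) i <;> simp
        · intro a b
          refine Fin.cases ?_ (fun a => ?_) a <;> refine Fin.cases ?_ (fun b => ?_) b
          · simp
          · simp
          · simp
          · intro hab
            exact Fin.succ_lt_succ_iff.2
              ((J.orderEmbOfFin h).strictMono (Fin.succ_lt_succ_iff.1 hab))
      rw [← e]
      rfl
    · rw [partialProd_of_card_ne _ h, partialProd_of_card_ne _ (by omega), map_zero]

/-- The exponent of the sign of the shuffle that moves the factors in `I` to the front. -/
def shuffleSign {m : ℕ} (p : Fin m → ZMod 2) (I : Finset (Fin m)) : ZMod 2 :=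
  ∑ i ∈ I, ∑ j ∈ Iᶜ.filter (fun j => j < i), p i * p j

theorem shuffleSign_insert_map_succ {m : ℕ} (p : Fin (m + 1) → ZMod 2) (J : Finset (Fin m)) :
    shuffleSign p (insert 0 (J.map (Fin.succEmb m))) = shuffleSign (fun i => p i.succ) J := by
  have h : (0 : Fin (m + 1)) ∉ J.map (Fin.succEmb m) := by simp
  rw [shuffleSign, compl_insert_map_succ, Finset.sum_insert h]
  simp [shuffleSign, Finset.sum_map, Finset.filter_map, Function.comp_def]

/-- If `0` lies outside the subset, every chosen index jumps over it. The extra term is the sign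
with which `1 ⊗ v 0` passes the left factor in `split_lmul`. -/
theorem shuffleSign_map_succ {m : ℕ} (p : Fin (m + 1) → ZMod 2) (J : Finset (Fin m)) :
    shuffleSign p (J.map (Fin.succEmb m)) =
      shuffleSign (fun i => p i.succ) J + p 0 * ∑ i ∈ J, p i.succ := by
  rw [shuffleSign, compl_map_succ, Finset.sum_map, shuffleSign, Finset.mul_sum,
    ← Finset.sum_add_distrib]
  refine Finset.sum_congr rfl fun i _ => ?_
  have h : (0 : Fin (m + 1)) ∉ (Jᶜ.map (Fin.succEmb m)).filter (fun j => j < i.succ) := fun h => by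
    simpa using (Finset.mem_filter.1 h).1
  change ∑ j ∈ (insert 0 (Jᶜ.map (Fin.succEmb m))).filter (fun j => j < i.succ), p i.succ * p j = _
  rw [Finset.filter_insert, if_pos (Fin.succ_pos i), Finset.sum_insert h, Finset.filter_map,
    Finset.sum_map, add_comm]
  simp [Function.comp_def, mul_comm]

/-- The sum runs over all subsets, and `partialProd` vanishes for the wrong cardinality. So the
induction matches the two terms of the recursion with `sum_finset_succ` without any bookkeeping of
cardinalities, which are restored in the next lemma. -/
theorem split_symProd {m : ℕ} (k l : ℕ) {v : Fin m → M.carrier} {p : Fin m → ZMod 2}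
    (hv : ∀ i, v i ∈ M.part (p i)) :
    split M k l m (symProd M v) = ∑ I : Finset (Fin m), sgn (shuffleSign p I) •
      (partialProd M v I k ⊗ₜ[ℂ] partialProd M v Iᶜ l) := by
  induction m generalizing k l with
  | zero =>
    have h : Finset.univ = {(∅ : Finset (Fin 0))} := by decide
    rw [symProd_zero, h, Finset.sum_singleton]
    have hI : shuffleSign p ∅ = 0 := Finset.sum_empty
    rw [hI, sgn_zero, one_smul]
    -- The empty product splits as `1 ⊗ 1` in bidegree `(0, 0)`; in every other bidegree both sides
    -- are zero.
    rcases k with _ | k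
    · rcases l with _ | l
      · rw [split_symOne, partialProd_of_card v (I := ∅) (k := 0) rfl,
          partialProd_of_card v (I := ∅ᶜ) (k := 0) rfl]
        rfl
      · rw [partialProd_of_card_ne v (I := ∅ᶜ) (k := l + 1) (by simp), TensorProduct.tmul_zero,
          split, LinearMap.comp_apply, symLift_symOne]
        rfl
    · rw [partialProd_of_card_ne v (I := ∅) (k := k + 1) (by simp), TensorProduct.zero_tmul,
        split, LinearMap.comp_apply, symLift_symOne]
      rfl
  | succ m ih =>
    rw [symProd_succ, split_lmul, ih (k - 1) l fun i => hv i.succ, ih k (l - 1) fun i => hv i.succ,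
      sum_finset_succ, map_sum, map_sum]
    congr 1
    · refine Finset.sum_congr rfl fun J _ => ?_
      rw [map_smul, tensorMap_tmul _ linPart_id (partialProd_mem (fun i => hv i.succ) J _),
        zero_mul, sgn_zero, one_smul, shuffleSign_insert_map_succ, compl_insert_map_succ,
        partialProd_map_succ, partialProd_insert_map_succ]
      rfl
    · refine Finset.sum_congr rfl fun J _ => ?_
      rw [map_smul, tensorMap_tmul _ (lmulPred_linPart l (hv 0))
        (partialProd_mem (fun i => hv i.succ) J _), smul_smul, ← sgn_add, shuffleSign_map_succ,
        compl_map_succ, partialProd_map_succ, partialProd_insert_map_succ]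
      rfl

theorem split_symProd_eq_sum_subtype {m : ℕ} (k l : ℕ) {v : Fin m → M.carrier}
    {p : Fin m → ZMod 2} (hv : ∀ i, v i ∈ M.part (p i)) :
    split M k l m (symProd M v) = ∑ I : {I : Finset (Fin m) // I.card = k ∧ Iᶜ.card = l},
      sgn (shuffleSign p I.1) • (symProd M (v ∘ I.1.orderEmbOfFin I.2.1) ⊗ₜ[ℂ]
        symProd M (v ∘ I.1ᶜ.orderEmbOfFin I.2.2)) := by
  rw [split_symProd k l hv,
    ← Finset.sum_filter_of_ne (p := fun I => I.card = k ∧ Iᶜ.card = l),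
    Finset.sum_subtype (p := fun I => I.card = k ∧ Iᶜ.card = l) _ (by simp)]
  · refine Finset.sum_congr rfl fun I _ => ?_
    rw [partialProd_of_card v I.2.1, partialProd_of_card v I.2.2]
  · intro I _ hI
    by_contra h
    refine hI ?_
    rcases not_and_or.1 h with h | h
    · rw [partialProd_of_card_ne _ h, TensorProduct.zero_tmul, smul_zero]
    · rw [partialProd_of_card_ne _ h, TensorProduct.tmul_zero, smul_zero]

end Products

end SuperModule

theorem mainTheorem8 (n : ℕ) (hn : 1 ≤ n) :
    ∃ Ψ : MonoidalSuperfunctor (C := WebUp) (D := QModS n) (QModS.symTensor n),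
      SuperEssSurj (C := WebUp) (D := QModS n) (QModS.symTensor n) ∧
      Ψ.unitIso = Iso.refl _ ∧
      (∀ a b : List ℕ, (Ψ.tensorIso a b).hom = QModS.rebracket n a b) ∧
      (∀ (k : ℕ) (v : Fin k → Fin n ⊕ Fin n → ℂ) (p : Fin k → ZMod 2),
        (∀ i, v i ∈ (qNatural n).part (p i)) →
        QModS.toLin (Ψ.map (WebUp.dot k)) (QModS.prod v) =
          ∑ t : Fin k, sgn (∑ s ∈ Finset.univ.filter (fun s => s < t), p s) •
            QModS.prod (Function.update v t (cliffordC n (v t)))) ∧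
      (∀ (k l : ℕ) (v : Fin k → Fin n ⊕ Fin n → ℂ) (w : Fin l → Fin n ⊕ Fin n → ℂ),
        QModS.toLin (Ψ.map (WebUp.merge k l)) (QModS.prod v ⊗ₜ[ℂ] QModS.prod w) =
          QModS.prod (Fin.append v w)) ∧
      (∀ (k l : ℕ) (v : Fin (k + l) → Fin n ⊕ Fin n → ℂ) (p : Fin (k + l) → ZMod 2),
        (∀ i, v i ∈ (qNatural n).part (p i)) →
        QModS.toLin (Ψ.map (WebUp.split k l)) (QModS.prod v) =
          ∑ I : {I : Finset (Fin (k + l)) // I.card = k ∧ Iᶜ.card = l},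
            sgn (∑ i ∈ I.1, ∑ j ∈ I.1ᶜ.filter (fun j => j < i), p i * p j) •
              (QModS.prod (v ∘ I.1.orderEmbOfFin I.2.1) ⊗ₜ[ℂ]
                QModS.prod (v ∘ I.1ᶜ.orderEmbOfFin I.2.2))) ∧
      QModS.toLin (Ψ.map WebUp.create) (1 : ℂ) = QModS.prod Fin.elim0 := by
  refine ⟨QModS.webFunctor n, QModS.superEssSurj n, rfl, fun _ _ => rfl, fun k v p hv => ?_,
    fun k l v w => ?_, fun k l v p hv => ?_, ?_⟩
  · exact (LinearMap.congr_fun (QModS.toLin_dot k) _).trans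
      ((SuperModule.isDer_der (M := qNatural n) cliffordC_mem.1).symProd hv)
  · refine (LinearMap.congr_fun (QModS.toLin_merge (n := n) (rfl : k + l = k + l)) _).trans ?_
    exact SuperModule.merge_symProd (M := qNatural n) rfl v w (Fin.append v w)
      (fun i => Fin.append_left v w i) fun j => Fin.append_right v w j
  · refine (LinearMap.congr_fun (QModS.toLin_split (n := n) (rfl : k + l = k + l)) _).trans ?_
    exact SuperModule.split_symProd_eq_sum_subtype (M := qNatural n) k l hv
  · refine (LinearMap.congr_fun (QModS.toLin_create (n := n)) _).trans ?_
    exact (SuperModule.unitLin_apply _).trans (one_smul ℂ _)
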